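/- Let $X_1,X_2,\ldots$ be i.i.d. random points in $\mathbb{R}^2$ whose distribution has a Lebesgue density $f\ge 0$ and compact (topological) support $E$, where $E$ is the closure of its interior $E^\circ$. Write $|\cdot|$ for the Euclidean norm, $\lambda^2$ for Lebesgue measure in the plane, $U(x,\varepsilon)$ for the open disk of radius $\varepsilon$ about $(x,0)$, $B(h)$ for the closed disk of radius $a-h$ about the origin, $Q_1,\dots,Q_4$ for the open quadrants numbered anti-clockwise from $Q_1=\{x>0,y>0\}$, and $E_i=E\cap Q_i$. Assume: A1) $\operatorname{diam}(E)=2a$ for some $a>0$, and $\inf\{x:(x,y)\in E\}=-a$, $\sup\{x:(x,y)\in E\}=a$. A2) $\operatorname{diam}\big(E\setminus(U(-a,\varepsilon)\cup U(a,\varepsilon))\big)<2a$ for every $\varepsilon>0$. A3) For every $\varepsilon>0$, $\lambda^2(E_i\cap U(a,\varepsilon))>0$ for $i\in\{1,4\}$ and $\lambda^2(E_j\cap U(-a,\varepsilon))>0$ for $j\in\{2,3\}$. A4) For some $\nu\in[0,a)$ there are continuous functions $g_1\ge 0$, $g_4\le 0$ on $[\nu,a]$ and $g_2\ge 0$, $g_3\le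 0$ on $[-a,-\nu]$ with $g_1(a)=g_4(a)=g_2(-a)=g_3(-a)=0$, $E^\circ\cap\{x>\nu\}=\{(x,y):\nu<x<a,\ g_4(x)<y<g_1(x)\}$ and $E^\circ\cap\{x<-\nu\}=\{(x,y):-a<x<-\nu,\ g_3(x)<y<g_2(x)\}$. A5) With $f_a(x)=\sqrt{a^2-x^2}/2$ there are constants $0<q_i<2$, $i\in\{1,2,3,4\}$, such that $g_1/f_a\to q_1$ and $-g_4/f_a\to q_4$ as $x\to a$, and $g_2/f_a\to q_2$ and $-g_3/f_a\to q_3$ as $x\to -a$. A6) For each $i$ and all sufficiently small $h>0$, $E_i^\circ\cap\{|x|<\nu\}\subset B(h)$, and the graph of $g_i$ meets the circle $\partial B(h)$ in exactly one point. A7) For sufficiently small $\varepsilon>0$, $f$ is continuous on $E\cap U(a,\varepsilon)$ and on $E\cap U(-a,\varepsilon)$, and $p_1:=p_4:=f((a,0))>0$, $p_2:=p_3:=f((-a,0))>0$. For $i\in\{1,2,3,4\}$ put $$c_i=\frac{2q_i\sqrt{2a}}{3\sqrt{4-q_i^2}},\qquad \sigma_i=(p_ic_i)^{-2/3},\qquad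 \tau_i=\frac{3}{2a}c_i .$$ For $\sigma,\tau>0$ let $\mathrm{NA}_\infty(\sigma,\tau)$ be the distribution of the sequence $(Z_{1,m},Z_{2,m})_{m\ge1}$ with $Z_{1,m}=\sigma S_m^{2/3}$ and $Z_{2,m}=U_m\tau\sigma^{1/2}S_m^{1/3}$, where $S_m=Y_1+\dots+Y_m$, the $Y_j$ are standard exponential, the $U_m$ are uniform on $[0,1]$, and all $Y_j,U_m$ are independent. Let $(Z^i_{1,k},Z^i_{2,k})_{k\ge1}\sim\mathrm{NA}_\infty(\sigma_i,\tau_i)$, $i\in\{1,2,3,4\}$, be independent, and put $$S^{i,j}=\min_{k,l\ge 1}\Big\{Z^i_{1,k}+Z^j_{1,l}+\tfrac a4\big(Z^i_{2,k}-Z^j_{2,l}\big)^2\Big\}\quad\text{for }(i,j)\in\{(1,3),(2,4)\},$$ $$S^{i,j}=\min_{k,l\ge 1}\Big\{Z^i_{1,k}+Z^j_{1,l}+\tfrac a4\big(Z^i_{2,k}+Z^j_{2,l}\big)^2\Big\}\quad\text{for }(i,j)\in\{(1,2),(3,4)\}.$$ Then these minima are almost surely attained, and the maximum interpoint distance $M_n=\max_{1\le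 i<j\le n}|X_i-X_j|$ satisfies $$n^{2/3}(2a-M_n)\ \xrightarrow{\ \mathcal D\ }\ \min\{S^{1,2},S^{1,3},S^{2,4},S^{3,4}\}\qquad(n\to\infty).$$ -/

import Mathlib

open MeasureTheory ProbabilityTheory Filter Set
open scoped Topology

noncomputable section

namespace LargestDistance

/-- The Euclidean plane; `z 0` is the abscissa and `z 1` the ordinate of `z`. -/
abbrev Plane : Type := EuclideanSpace ℝ (Fin 2)

/-- The four open quadrants, numbered anti-clockwise from `0` to `3`
(so index `i` stands for the quadrant usually numbered `i + 1`). -/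
def quadrant : Fin 4 → Set Plane
  | 0 => {z | 0 < z 0 ∧ 0 < z 1}
  | 1 => {z | z 0 < 0 ∧ 0 < z 1}
  | 2 => {z | z 0 < 0 ∧ z 1 < 0}
  | 3 => {z | 0 < z 0 ∧ z 1 < 0}

/-- The point `(x, 0)`. -/
def axisPoint (x : ℝ) : Plane := !₂[x, 0]

/-- The abscissa of the pole adjacent to a quadrant: `a` for the two right quadrants,
`-a` for the two left ones. -/
def poleAbscissa (a : ℝ) : Fin 4 → ℝ
  | 0 => a
  | 1 => -a
  | 2 => -a
  | 3 => a

/-- The domain of the boundary function belonging to a quadrant: `[ν, a]` on the right and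
`[-a, -ν]` on the left. -/
def boundaryDomain (a ν : ℝ) : Fin 4 → Set ℝ
  | 0 => Icc ν a
  | 1 => Icc (-a) (-ν)
  | 2 => Icc (-a) (-ν)
  | 3 => Icc ν a

/-- Upper boundary function of the ellipse with half-axes `a` and `a / 2`. -/
def ellipseBoundary (a x : ℝ) : ℝ := √(a ^ 2 - x ^ 2) / 2

/-- The probability distribution in the plane with Lebesgue density `f`. -/
def densityLaw (f : Plane → ℝ) : Measure Plane :=
  volume.withDensity fun z => ENNReal.ofReal (f z)

/-- The assumptions on the density `f` and on the support `E` of the distribution. Here `2 * a` is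
the diameter of `E`, the functions `g i` (restricted to `boundaryDomain a ν i`) are the boundary
functions of `E` near the poles `(a, 0)` and `(-a, 0)`, and `q i` describes the decay of `g i`
at the pole. -/
structure Admissible (a ν : ℝ) (g : Fin 4 → ℝ → ℝ) (q : Fin 4 → ℝ) (E : Set Plane)
    (f : Plane → ℝ) : Prop where
  /-- `f` is the density of a distribution with compact support `E`. -/
  measurable_density : Measurable f
  density_nonneg : ∀ z, 0 ≤ f z
  support_eq : (densityLaw f).support = E
  isCompact : IsCompact E
  /-- `E` is a regular closed set (it has no thin parts outside the closure of its interior). -/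
  closure_interior : closure (interior E) = E
  /-- Diameter and orientation of `E`. -/
  a_pos : 0 < a
  diam_eq : Metric.diam E = 2 * a
  isGLB_abscissa : IsGLB ((fun z : Plane => z 0) '' E) (-a)
  isLUB_abscissa : IsLUB ((fun z : Plane => z 0) '' E) a
  /-- The major axis is unique. -/
  diam_lt : ∀ ε > 0, Metric.diam
    (E \ (Metric.ball (axisPoint (-a)) ε ∪ Metric.ball (axisPoint a) ε)) < 2 * a
  /-- Every quadrant contributes a positive area near its pole. -/
  area_pos : ∀ i, ∀ ε > 0,
    0 < volume (E ∩ quadrant i ∩ Metric.ball (axisPoint (poleAbscissa a i)) ε)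
  /-- Near the poles, the interior of `E` lies between the graphs of the boundary functions. -/
  nu_nonneg : 0 ≤ ν
  nu_lt : ν < a
  boundary_continuousOn : ∀ i, ContinuousOn (g i) (boundaryDomain a ν i)
  boundary_nonneg : ∀ i ∈ ({0, 1} : Set (Fin 4)), ∀ x ∈ boundaryDomain a ν i, 0 ≤ g i x
  boundary_nonpos : ∀ i ∈ ({2, 3} : Set (Fin 4)), ∀ x ∈ boundaryDomain a ν i, g i x ≤ 0
  boundary_pole : ∀ i, g i (poleAbscissa a i) = 0
  interior_right : interior E ∩ {z | ν < z 0} =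
    {z | (ν < z 0 ∧ z 0 < a) ∧ g 3 (z 0) < z 1 ∧ z 1 < g 0 (z 0)}
  interior_left : interior E ∩ {z | z 0 < -ν} =
    {z | (-a < z 0 ∧ z 0 < -ν) ∧ g 2 (z 0) < z 1 ∧ z 1 < g 1 (z 0)}
  /-- The boundary functions decay at the poles like those of an ellipse. -/
  q_pos : ∀ i, 0 < q i
  q_lt : ∀ i, q i < 2
  decay_0 : Tendsto (fun x => g 0 x / ellipseBoundary a x) (𝓝[<] a) (𝓝 (q 0))
  decay_1 : Tendsto (fun x => g 1 x / ellipseBoundary a x) (𝓝[>] (-a)) (𝓝 (q 1))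
  decay_2 : Tendsto (fun x => -g 2 x / ellipseBoundary a x) (𝓝[>] (-a)) (𝓝 (q 2))
  decay_3 : Tendsto (fun x => -g 3 x / ellipseBoundary a x) (𝓝[<] a) (𝓝 (q 3))
  /-- Away from the poles, `E` stays inside the disk of radius `a - h` about the origin. -/
  middle_subset : ∀ i, ∀ᶠ h in 𝓝[>] (0 : ℝ),
    interior (E ∩ quadrant i) ∩ {z | |z 0| < ν} ⊆ Metric.closedBall 0 (a - h)
  /-- Each boundary function meets the circle of radius `a - h` in exactly one point. -/
  unique_intersection : ∀ i, ∀ᶠ h in 𝓝[>] (0 : ℝ),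
    ∃! x, x ∈ boundaryDomain a ν i ∧ x ^ 2 + g i x ^ 2 = (a - h) ^ 2
  /-- The density is continuous on `E` near the poles, and positive at the poles. -/
  density_continuousOn : ∀ᶠ ε in 𝓝[>] (0 : ℝ),
    ContinuousOn f (E ∩ Metric.ball (axisPoint a) ε) ∧
      ContinuousOn f (E ∩ Metric.ball (axisPoint (-a)) ε)
  density_pole_pos : ∀ i, 0 < f (axisPoint (poleAbscissa a i))

/-- `p_i`: the value of the density at the pole adjacent to quadrant `i`. -/
def poleDensity (a : ℝ) (f : Plane → ℝ) (i : Fin 4) : ℝ := f (axisPoint (poleAbscissa a i))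

/-- `c = 2 q √(2a) / (3 √(4 - q²))`. -/
def capConst (a q : ℝ) : ℝ := 2 * q * √(2 * a) / (3 * √(4 - q ^ 2))

/-- `σ = (p c)^(-2/3)`. -/
def sigmaConst (a p q : ℝ) : ℝ := (p * capConst a q) ^ (-(2 / 3) : ℝ)

/-- `τ = 3 c / (2 a)`. -/
def tauConst (a q : ℝ) : ℝ := 3 / (2 * a) * capConst a q

/-- The norm-angle sequence built from `y = (Y_1, Y_2, …)` and `u = (U_1, U_2, …)`; its entry
number `m` (counted from `0`) is `(σ S^(2/3), U_{m+1} τ σ^(1/2) S^(1/3))` with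
`S = Y_1 + … + Y_{m+1}`. -/
def normAngle (σ τ : ℝ) (w : (ℕ → ℝ) × (ℕ → ℝ)) (m : ℕ) : ℝ × ℝ :=
  (σ * (∑ j ∈ Finset.range (m + 1), w.1 j) ^ (2 / 3 : ℝ),
    w.2 m * τ * σ ^ (1 / 2 : ℝ) * (∑ j ∈ Finset.range (m + 1), w.1 j) ^ (1 / 3 : ℝ))

/-- The norm-angle distribution `NA_∞(σ, τ)`: the law of the norm-angle sequence when the `Y_m` are
standard exponential, the `U_m` are uniform on `[0, 1]` and all of them are independent. -/
def normAngleLaw (σ τ : ℝ) : Measure (ℕ → ℝ × ℝ) :=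
  ((Measure.infinitePi fun _ : ℕ => expMeasure 1).prod
    (Measure.infinitePi fun _ : ℕ => (volume.restrict (Icc 0 1) : Measure ℝ))).map (normAngle σ τ)

theorem measurable_normAngle (σ τ : ℝ) : Measurable (normAngle σ τ) := by
  unfold normAngle
  fun_prop

theorem isProbabilityMeasure_normAngleLaw (σ τ : ℝ) :
    IsProbabilityMeasure (normAngleLaw σ τ) := by
  have : IsProbabilityMeasure (expMeasure 1) := isProbabilityMeasure_expMeasure one_pos
  have : IsProbabilityMeasure (volume.restrict (Icc 0 1) : Measure ℝ) := ⟨by simp⟩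
  exact Measure.isProbabilityMeasure_map (measurable_normAngle σ τ).aemeasurable

/-- The expression minimised over `p = (k, l)` for two diagonally opposite quadrants. -/
def costDiff (a : ℝ) (z w : ℕ → ℝ × ℝ) (p : ℕ × ℕ) : ℝ :=
  (z p.1).1 + (w p.2).1 + a / 4 * ((z p.1).2 - (w p.2).2) ^ 2

/-- The expression minimised over `p = (k, l)` for two quadrants on the same side of the
horizontal axis. -/
def costSum (a : ℝ) (z w : ℕ → ℝ × ℝ) (p : ℕ × ℕ) : ℝ :=
  (z p.1).1 + (w p.2).1 + a / 4 * ((z p.1).2 + (w p.2).2) ^ 2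

/-- The minimum of `costDiff` over all pairs of indices. -/
def minDiff (a : ℝ) (z w : ℕ → ℝ × ℝ) : ℝ := ⨅ p, costDiff a z w p

/-- The minimum of `costSum` over all pairs of indices. -/
def minSum (a : ℝ) (z w : ℕ → ℝ × ℝ) : ℝ := ⨅ p, costSum a z w p

/-- The limit variable `min {S^{1,2}, S^{1,3}, S^{2,4}, S^{3,4}}` as a function of the four
norm-angle sequences. -/
def limitMin (a : ℝ) (z : Fin 4 → ℕ → ℝ × ℝ) : ℝ :=
  min (min (minSum a (z 0) (z 1)) (minDiff a (z 0) (z 2)))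
    (min (minDiff a (z 1) (z 3)) (minSum a (z 2) (z 3)))

/-- All four minima in `limitMin` are attained. -/
def MinimaAttained (a : ℝ) (z : Fin 4 → ℕ → ℝ × ℝ) : Prop :=
  IsLeast (range (costSum a (z 0) (z 1))) (minSum a (z 0) (z 1)) ∧
  IsLeast (range (costDiff a (z 0) (z 2))) (minDiff a (z 0) (z 2)) ∧
  IsLeast (range (costDiff a (z 1) (z 3))) (minDiff a (z 1) (z 3)) ∧
  IsLeast (range (costSum a (z 2) (z 3))) (minSum a (z 2) (z 3))

/-- The maximum interpoint distance of the first `n` points of the sequence `x`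
(a maximum over a finite set of pairs, nonempty for `2 ≤ n`). -/
def maxDist (x : ℕ → Plane) (n : ℕ) : ℝ :=
  ⨆ p : {p : Fin n × Fin n // p.1 < p.2}, dist (x p.1.1) (x p.1.2)

end LargestDistance

end

open MeasureTheory ProbabilityTheory Filter Set
open scoped Topology

noncomputable section

namespace LargestDistance

/-! ### Void probabilities of marked exponential partial sums -/

/-! Only points near the two poles matter, and there the right scale is n^(-2/3) along the axis and
n^(-1/3) across it. With r = n^(1/3), `poleMap` magnifies area by r³ = n, so the rescaled sample
near a pole is asymptotically a Poisson process. Its intensity is the value of the density at the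
pole, and it fills the region into which the magnified support opens up. Since the boundary behaves
like that of an ellipse, this region is bounded by parabolas y² = (a q_i²/2) x, one half for each
quadrant (`tendsto_rpow_mul_densityLaw`).

The norm-angle sequences describe the same process in other coordinates. The pairs (S_m, U_m) form a
unit-rate Poisson process on (0, ∞) × [0, 1] (`measure_void`). The norm-angle formula followed by
`polarPoint` maps this strip onto the half parabola with constant Jacobian of modulus 1/p_i; the
constants σ_i and τ_i are made for this (`measure_void_normAngleLaw`).

For points with rescaled positions x, y at opposite poles, r²(4a² - dist²) equals 4a `gapCost` minus
(x.1 + y.1)²/r² (`dist_sq_eq_gapCost`), so n^(2/3)(2a - dist) is close to `gapCost`. In norm-angle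
coordinates `gapCost` is the expression with the sum or the difference of the angles
(`gapCost_polarPoint`). Hence the statistic and the limit variable are both, the former
approximately, the least cost over pairs of points at opposite poles.

Passing to the limit needs compactness. Nearly maximal distances occur only near opposite poles,
because E lies in the disk of radius a and its diameter is attained only there
(`exists_near_poles`). There q_i < 2 makes the cost dominate a multiple of x.1 + y.1, so cheap pairs
stay in a bounded window (`exists_window`). The window is cut into finitely many cells, which
determine the cost up to a small error. Void probabilities of unions of cells converge, hence so
does the law of the set of occupied cells (`tendsto_measureReal_occupied`). This sandwiches the
distribution functions with arbitrarily small slack. -/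

theorem lipschitzWith_integral_of_le_one {k : ℝ → ℝ} (hk : Measurable k) (h0 : ∀ r, 0 ≤ k r)
    (h1 : ∀ r, k r ≤ 1) : LipschitzWith 1 fun r => ∫ v in (0 : ℝ)..r, k v := by
  have hint : ∀ x y : ℝ, IntervalIntegrable k volume x y := fun x y =>
    (intervalIntegrable_const (c := (1 : ℝ))).mono_fun hk.aestronglyMeasurable
      (Eventually.of_forall fun r => by simp [abs_of_nonneg (h0 r), h1 r])
  refine LipschitzWith.of_dist_le_mul fun x y => ?_
  rw [Real.dist_eq, Real.dist_eq,
    intervalIntegral.integral_interval_sub_left (hint _ _) (hint _ _)]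
  have := intervalIntegral.norm_integral_le_of_norm_le_const (a := y) (b := x) (f := k) (C := 1)
    fun r _ => by simp [abs_of_nonneg (h0 r), h1 r]
  simpa using this

/-- A survival function with bounded measurable hazard rate `k` is the integral of its density. -/
theorem integral_hazard_mul_exp_neg {k : ℝ → ℝ} (hk : Measurable k) (h0 : ∀ r, 0 ≤ k r)
    (h1 : ∀ r, k r ≤ 1) {x y : ℝ} :
    ∫ r in x..y, k r * Real.exp (-∫ v in (0 : ℝ)..r, k v) =
      Real.exp (-∫ v in (0 : ℝ)..x, k v) - Real.exp (-∫ v in (0 : ℝ)..y, k v) := by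
  have hint : ∀ x y : ℝ, IntervalIntegrable k volume x y := fun x y =>
    (intervalIntegrable_const (c := (1 : ℝ))).mono_fun hk.aestronglyMeasurable
      (Eventually.of_forall fun r => by simp [abs_of_nonneg (h0 r), h1 r])
  have hLip := lipschitzWith_integral_of_le_one hk h0 h1
  set κ : ℝ → ℝ := fun r => ∫ v in (0 : ℝ)..r, k v with hκ
  obtain ⟨M, hM⟩ := (isCompact_uIcc (a := x) (b := y)).exists_bound_of_continuousOn
    hLip.continuous.continuousOn
  obtain ⟨K, hK⟩ := (Real.contDiff_exp (n := 1)).contDiffOn.exists_lipschitzOnWith (by decide)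
    (convex_Icc (-M) M) isCompact_Icc
  have hmaps : MapsTo (fun r => -κ r) (uIcc x y) (Icc (-M) M) := fun r hr => by
    have := abs_le.1 (hM r hr)
    constructor <;> linarith [this.1, this.2]
  -- As `k` is merely measurable, the fundamental theorem of calculus is used in its absolutely
  -- continuous form; exp is Lipschitz on the compact range of -κ.
  have hac : AbsolutelyContinuousOnInterval (fun r => Real.exp (-κ r)) x y :=
    (hK.comp hLip.neg.lipschitzOnWith hmaps).absolutelyContinuousOnInterval
  have hderiv : ∀ᵐ r : ℝ, deriv (fun r => Real.exp (-κ r)) r = -(k r * Real.exp (-κ r)) := by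
    have hloc : LocallyIntegrable k volume :=
      (locallyIntegrable_const (1 : ℝ)).mono hk.aestronglyMeasurable
        (Eventually.of_forall fun r => by simp [abs_of_nonneg (h0 r), h1 r])
    filter_upwards [_root_.LocallyIntegrable.ae_hasDerivAt_integral hloc] with r hr
    have := (hr 0).neg.exp.deriv
    simp only [Pi.neg_apply] at this
    rw [this]; ring
  have := hac.integral_deriv_eq_sub
  rw [intervalIntegral.integral_congr_ae (hderiv.mono fun r hr _ => hr),
    intervalIntegral.integral_neg] at this
  linarith

theorem expMeasure_eq_withDensity :
    expMeasure 1 = (volume.restrict (Ioi (0 : ℝ))).withDensity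
      fun y => ENNReal.ofReal (Real.exp (-y)) := by
  rw [← withDensity_indicator measurableSet_Ioi]
  change volume.withDensity (exponentialPDF 1) = _
  refine withDensity_congr_ae ?_
  filter_upwards [Measure.ae_ne volume (0 : ℝ)] with y hy
  rcases lt_or_gt_of_ne hy with h | h
  · rw [exponentialPDF_of_neg h, indicator_of_notMem (by simpa using h.le)]
  · rw [exponentialPDF_of_nonneg h.le, indicator_of_mem (by simpa using h)]
    simp

theorem integral_expMeasure (φ : ℝ → ℝ) :
    ∫ y, φ y ∂(expMeasure 1) = ∫ y in Ioi (0 : ℝ), Real.exp (-y) * φ y := by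
  rw [expMeasure_eq_withDensity, integral_withDensity_eq_integral_toReal_smul (by fun_prop)
    (by simp)]
  simp [Real.exp_nonneg]

theorem expMeasure_ae_pos : ∀ᵐ y ∂(expMeasure 1), 0 < y := by
  rw [expMeasure_eq_withDensity]
  exact (withDensity_absolutelyContinuous _ _).ae_le (ae_restrict_mem measurableSet_Ioi)

/-- The probability that a unit rate Poisson process on `(s, T]`, thinned with rate `H`, is void. -/
def voidFun (H : ℝ → ℝ) (T s : ℝ) : ℝ := Real.exp (-∫ r in s..T, H r)

variable {H : ℝ → ℝ} {T : ℝ}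

theorem intervalIntegrable_of_le_one {H : ℝ → ℝ} (hH : Measurable H) (h0 : ∀ r, 0 ≤ H r)
    (h1 : ∀ r, H r ≤ 1) (x y : ℝ) : IntervalIntegrable H volume x y :=
  (intervalIntegrable_const (c := (1 : ℝ))).mono_fun hH.aestronglyMeasurable
    (Eventually.of_forall fun r => by simp [abs_of_nonneg (h0 r), h1 r])

theorem voidFun_of_ge (hT : ∀ r, T ≤ r → H r = 0) {s : ℝ} (hs : T ≤ s) : voidFun H T s = 1 := by
  have : ∫ r in s..T, H r = 0 := by
    rw [intervalIntegral.integral_symm, intervalIntegral.integral_congr (g := fun _ => 0)]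
    · simp
    · intro r hr
      rw [uIcc_of_le hs] at hr
      exact hT r hr.1
  simp [voidFun, this]

/-- Passing to the complementary rate 1 - H splits off a factor e^s, which cancels the exponential
density in `integral_expMeasure_voidFun` and leaves a pure hazard-rate integral. -/
theorem voidFun_eq (hH : Measurable H) (h0 : ∀ r, 0 ≤ H r) (h1 : ∀ r, H r ≤ 1) (s : ℝ) :
    voidFun H T s = Real.exp (s - ∫ v in (0 : ℝ)..s, (1 - H v)) *
      Real.exp (-(T - ∫ v in (0 : ℝ)..T, (1 - H v))) := by
  have hi := intervalIntegrable_of_le_one hH h0 h1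
  rw [voidFun, ← Real.exp_add, intervalIntegral.integral_sub (by simp) (hi _ _),
    intervalIntegral.integral_sub (by simp) (hi _ _),
    ← intervalIntegral.integral_interval_sub_left (hi 0 T) (hi 0 s)]
  congr 1
  simp [sub_eq_add_neg]

theorem continuous_voidFun (hH : Measurable H) (h0 : ∀ r, 0 ≤ H r) (h1 : ∀ r, H r ≤ 1) :
    Continuous (voidFun H T) := by
  have hc : Continuous fun r => ∫ v in (0 : ℝ)..r, (1 - H v) :=
    (lipschitzWith_integral_of_le_one (k := fun v => 1 - H v) (measurable_const.sub hH) (fun r => by linarith [h1 r])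
      (fun r => by linarith [h0 r])).continuous
  rw [show voidFun H T = _ from funext (voidFun_eq hH h0 h1)]
  fun_prop

theorem voidFun_nonneg (s : ℝ) : 0 ≤ voidFun H T s := Real.exp_nonneg _

theorem voidFun_le_one (h0 : ∀ r, 0 ≤ H r) (hT : ∀ r, T ≤ r → H r = 0) (s : ℝ) :
    voidFun H T s ≤ 1 := by
  rcases le_total T s with h | h
  · rw [voidFun_of_ge hT h]
  · refine Real.exp_le_one_iff.2 (neg_nonpos.2 ?_)
    exact intervalIntegral.integral_nonneg h fun r _ => h0 r

/-- Renewal equation: the first point after s is at s + y with y exponential, survives thinning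
unobserved with probability 1 - H(s + y), and the process starts afresh from there. -/
theorem integral_expMeasure_voidFun (hH : Measurable H) (h0 : ∀ r, 0 ≤ H r) (h1 : ∀ r, H r ≤ 1)
    (hT : ∀ r, T ≤ r → H r = 0) (s : ℝ) :
    ∫ y, (1 - H (s + y)) * voidFun H T (s + y) ∂(expMeasure 1) = voidFun H T s := by
  have hk : Measurable fun r => 1 - H r := measurable_const.sub hH
  set κ : ℝ → ℝ := fun r => ∫ v in (0 : ℝ)..r, (1 - H v) with hκ
  set C : ℝ := Real.exp (-(T - κ T)) with hC
  have hvoid : ∀ r, voidFun H T r = Real.exp (r - κ r) * C := voidFun_eq hH h0 h1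
  rw [integral_expMeasure]
  have hfun : ∀ y, Real.exp (-y) * ((1 - H (s + y)) * voidFun H T (s + y)) =
      Real.exp s * C * ((1 - H (y + s)) * Real.exp (-κ (y + s))) := fun y => by
    rw [hvoid, add_comm s y, show y + s - κ (y + s) = y + (s + -κ (y + s)) by ring,
      Real.exp_add y, Real.exp_add s, Real.exp_neg y]
    field_simp
  have hmeas : Measurable (voidFun H T) := (continuous_voidFun hH h0 h1).measurable
  have hint : IntegrableOn
      (fun y => Real.exp (-y) * ((1 - H (s + y)) * voidFun H T (s + y))) (Ioi 0) volume := by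
    refine Integrable.mono' (g := fun y => Real.exp (-y)) (exp_neg_integrableOn_Ioi 0 one_pos |>.congr_fun
      (fun y _ => by simp) measurableSet_Ioi) ?_ (Eventually.of_forall fun y => ?_)
    · exact Measurable.aestronglyMeasurable (by fun_prop)
    · rw [Real.norm_eq_abs, abs_mul, abs_of_nonneg (Real.exp_nonneg _)]
      refine mul_le_of_le_one_right (Real.exp_nonneg _) ?_
      rw [abs_of_nonneg (mul_nonneg (by linarith [h1 (s + y)]) (voidFun_nonneg _))]
      exact mul_le_one₀ (by linarith [h0 (s + y)]) (voidFun_nonneg _) (voidFun_le_one h0 hT _)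
  have hlim := intervalIntegral_tendsto_integral_Ioi 0 hint tendsto_id
  refine tendsto_nhds_unique hlim ?_
  have hval : ∀ R : ℝ, ∫ y in (0 : ℝ)..R,
      Real.exp (-y) * ((1 - H (s + y)) * voidFun H T (s + y)) =
      voidFun H T s - Real.exp (-R) * voidFun H T (R + s) := fun R => by
    simp_rw [hfun]
    rw [intervalIntegral.integral_const_mul,
      intervalIntegral.integral_comp_add_right (fun r => (1 - H r) * Real.exp (-κ r)),
      integral_hazard_mul_exp_neg hk (fun r => by linarith [h1 r]) (fun r => by linarith [h0 r]),
      hvoid, hvoid, zero_add]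
    change Real.exp s * C * (Real.exp (-κ s) - Real.exp (-κ (R + s))) = _
    rw [show R + s - κ (R + s) = R + (s + -κ (R + s)) by ring, Real.exp_add R, Real.exp_add s,
      sub_eq_add_neg s, Real.exp_add s, Real.exp_neg R]
    field_simp
  simp only [id, hval]
  have h2 : Tendsto (fun R : ℝ => Real.exp (-R) * voidFun H T (R + s)) atTop (𝓝 0) := by
    refine squeeze_zero (fun R => mul_nonneg (Real.exp_nonneg _) (voidFun_nonneg _))
      (fun R => mul_le_of_le_one_right (Real.exp_nonneg _) (voidFun_le_one h0 hT _)) ?_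
    exact Real.tendsto_exp_neg_atTop_nhds_zero
  simpa using tendsto_const_nhds.sub h2

/-! ### Independent exponential and uniform sequences -/

instance isProbabilityMeasure_expMeasure_one : IsProbabilityMeasure (expMeasure 1) :=
  isProbabilityMeasure_expMeasure one_pos

instance isProbabilityMeasure_restrict_Icc :
    IsProbabilityMeasure (volume.restrict (Icc 0 1) : Measure ℝ) := ⟨by simp⟩

/-- The law of a sequence of independent standard exponential variables. -/
def expSeq : Measure (ℕ → ℝ) := Measure.infinitePi fun _ : ℕ => expMeasure 1

/-- The law of a sequence of independent uniform variables on `[0, 1]`. -/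
def unifSeq : Measure (ℕ → ℝ) :=
  Measure.infinitePi fun _ : ℕ => (volume.restrict (Icc 0 1) : Measure ℝ)

instance : IsProbabilityMeasure expSeq := by unfold expSeq; infer_instance

instance : IsProbabilityMeasure unifSeq := by unfold unifSeq; infer_instance

theorem normAngleLaw_eq_map (σ τ : ℝ) :
    normAngleLaw σ τ = (expSeq.prod unifSeq).map (normAngle σ τ) := rfl

/-- The partial sums of a sequence. -/
def psum (y : ℕ → ℝ) (m : ℕ) : ℝ := ∑ j ∈ Finset.range m, y j

theorem measurable_psum (m : ℕ) : Measurable fun y => psum y m := by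
  unfold psum; fun_prop

theorem psum_succ (y : ℕ → ℝ) (m : ℕ) : psum y (m + 1) = psum y m + y m :=
  Finset.sum_range_succ _ _

theorem expSeq_ae_pos : ∀ᵐ y ∂expSeq, ∀ j, 0 < y j := by
  refine ae_all_iff.2 fun j => ?_
  exact (measurePreserving_eval_infinitePi (fun _ : ℕ => expMeasure 1) j).quasiMeasurePreserving.ae
    expMeasure_ae_pos

theorem expMeasure_Iic_lt_one (x : ℝ) : expMeasure 1 (Iic x) < 1 := by
  rw [← ofReal_cdf, cdf_expMeasure_eq one_pos]
  refine ENNReal.ofReal_lt_one.2 ?_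
  split_ifs
  · linarith [Real.exp_pos (-(1 * x))]
  · exact one_pos

/-- The first k terms all stay below N with probability P(Y ≤ N)^k, which tends to 0. This already
forces the partial sums to diverge, without a law of large numbers. -/
theorem expSeq_ae_unbounded : ∀ᵐ y ∂expSeq, ∀ N : ℕ, ∃ j, (N : ℝ) < y j := by
  refine ae_all_iff.2 fun N => ?_
  have h : ∀ k : ℕ, expSeq {y | ¬∃ j, (N : ℝ) < y j} ≤ expMeasure 1 (Iic (N : ℝ)) ^ k := fun k => by
    have := Measure.infinitePi_pi (fun _ : ℕ => expMeasure 1) (s := Finset.range k)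
      (t := fun _ => Iic (N : ℝ)) (fun _ _ => measurableSet_Iic)
    rw [Finset.prod_const, Finset.card_range] at this
    rw [← this]
    refine measure_mono fun y hy j _ => ?_
    simp only [not_exists, not_lt, mem_ofPred_eq] at hy
    exact hy j
  exact le_antisymm (ge_of_tendsto' (ENNReal.tendsto_pow_atTop_nhds_zero_of_lt_one
    (expMeasure_Iic_lt_one N)) h) bot_le

theorem expSeq_ae_tendsto_psum : ∀ᵐ y ∂expSeq, Tendsto (psum y) atTop atTop := by
  filter_upwards [expSeq_ae_pos, expSeq_ae_unbounded] with y hpos hub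
  refine tendsto_atTop_atTop_of_monotone
    (monotone_nat_of_le_succ fun m => by rw [psum_succ]; linarith [hpos m]) fun b => ?_
  obtain ⟨N, hN⟩ := exists_nat_ge b
  obtain ⟨j, hj⟩ := hub N
  refine ⟨j + 1, hN.trans (hj.le.trans ?_)⟩
  exact Finset.single_le_sum (f := y) (fun i _ => (hpos i).le) (Finset.self_mem_range_succ j)

theorem psum_nonneg {y : ℕ → ℝ} (hy : ∀ j, 0 < y j) (m : ℕ) : 0 ≤ psum y m :=
  Finset.sum_nonneg fun j _ => (hy j).le

theorem psum_pos {y : ℕ → ℝ} (hy : ∀ j, 0 < y j) (m : ℕ) : 0 < psum y (m + 1) := by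
  rw [psum_succ]; linarith [hy m, psum_nonneg hy m]

variable {H : ℝ → ℝ} {T : ℝ}

/-- The product times `voidFun` at the current sum is a martingale: the next exponential is
independent of the past, and integrating it out is the renewal equation. -/
theorem integral_prod_mul_voidFun (hH : Measurable H) (h0 : ∀ r, 0 ≤ H r) (h1 : ∀ r, H r ≤ 1)
    (hT : ∀ r, T ≤ r → H r = 0) (k : ℕ) :
    ∫ y, (∏ m ∈ Finset.range k, (1 - H (psum y (m + 1)))) * voidFun H T (psum y k) ∂expSeq =
      voidFun H T 0 := by
  have hW := (continuous_voidFun (T := T) hH h0 h1).measurable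
  induction k with
  | zero => simp [psum]
  | succ k ih =>
    rw [← ih]
    have hind : iIndepFun (fun (j : ℕ) (y : ℕ → ℝ) => y j) expSeq :=
      iIndepFun_infinitePi (X := fun _ x => x) fun _ => measurable_id
    have hind2 := (hind.indepFun_finset (Finset.range k) {k} (by simp)
      fun j => measurable_pi_apply j)
    -- Padding with zeros exhibits the first k factors and the k-th sum as functions of the first k
    -- coordinates alone, as the independence lemma requires.
    let ext0 : (Finset.range k → ℝ) → ℕ → ℝ := fun x j =>
      if h : j ∈ Finset.range k then x ⟨j, h⟩ else 0
    have hext : Measurable ext0 := measurable_pi_lambda _ fun j => by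
      by_cases h : j ∈ Finset.range k
      · simp only [ext0, h, dite_true]
        exact measurable_pi_apply (X := fun _ => ℝ) (⟨j, h⟩ : Finset.range k)
      · simp only [ext0, h, dite_false]
        exact measurable_const
    have hps : ∀ (y : ℕ → ℝ) (m : ℕ), m ≤ k →
        psum (ext0 fun i => y i) m = psum y m := fun y m hm => by
      refine Finset.sum_congr rfl fun j hj => ?_
      have : j < k := lt_of_lt_of_le (Finset.mem_range.1 hj) hm
      simp [ext0, this]
    let φ : (Finset.range k → ℝ) → ℝ × ℝ := fun x =>
      (∏ m ∈ Finset.range k, (1 - H (psum (ext0 x) (m + 1))), psum (ext0 x) k)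
    have hφ : Measurable φ := by
      have hps' : ∀ m, Measurable fun x => psum (ext0 x) m := fun m =>
        (measurable_psum m).comp hext
      refine Measurable.prodMk ?_ (hps' k)
      exact Finset.measurable_prod _ fun m _ => measurable_const.sub (hH.comp (hps' _))
    have hφy : ∀ y : ℕ → ℝ, φ (fun i => y i) =
        (∏ m ∈ Finset.range k, (1 - H (psum y (m + 1))), psum y k) := fun y => by
      refine Prod.ext ?_ (hps y k le_rfl)
      simp only [φ]
      refine Finset.prod_congr rfl fun m hm => ?_
      rw [hps y (m + 1) (Finset.mem_range.1 hm)]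
    set Fk : (ℕ → ℝ) → ℝ × ℝ := fun y =>
      (∏ m ∈ Finset.range k, (1 - H (psum y (m + 1))), psum y k) with hFk
    have hFm : Measurable Fk := by
      refine Measurable.prodMk ?_ (measurable_psum k)
      exact Finset.measurable_prod _ fun m _ => measurable_const.sub (hH.comp (measurable_psum _))
    have hind3 : IndepFun Fk (fun y => y k) expSeq := by
      have := hind2.comp (φ := φ) (ψ := fun x => x ⟨k, by simp⟩) hφ
        (measurable_pi_apply (X := fun _ => ℝ) (⟨k, by simp⟩ : ({k} : Finset ℕ)))
      rwa [show φ ∘ (fun (a : ℕ → ℝ) (i : Finset.range k) => a i) = Fk from funext hφy] at this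
    rw [indepFun_iff_map_prod_eq_prod_map_map hFm.aemeasurable
      (measurable_pi_apply k).aemeasurable] at hind3
    have hmapk : expSeq.map (fun y : ℕ → ℝ => y k) = expMeasure 1 :=
      Measure.infinitePi_map_eval (fun _ : ℕ => expMeasure 1) k
    rw [hmapk] at hind3
    set G : (ℝ × ℝ) × ℝ → ℝ := fun z =>
      z.1.1 * ((1 - H (z.1.2 + z.2)) * voidFun H T (z.1.2 + z.2)) with hG
    have hGm : Measurable G := by fun_prop
    have hFb : ∀ y, ‖(Fk y).1‖ ≤ 1 := fun y => by
      rw [Real.norm_eq_abs, Finset.abs_prod]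
      exact Finset.prod_le_one (fun _ _ => abs_nonneg _) fun m _ => by
        rw [abs_of_nonneg] <;> linarith [h0 (psum y (m + 1)), h1 (psum y (m + 1))]
    have hWb : ∀ r, |(1 - H r) * voidFun H T r| ≤ 1 := fun r => by
      rw [abs_of_nonneg (mul_nonneg (by linarith [h1 r]) (voidFun_nonneg _))]
      exact mul_le_one₀ (by linarith [h0 r]) (voidFun_nonneg _) (voidFun_le_one h0 hT _)
    calc
      _ = ∫ y, G (Fk y, y k) ∂expSeq := by
        refine integral_congr_ae (Eventually.of_forall fun y => ?_)
        simp only [hG, hFk, Finset.prod_range_succ, psum_succ]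
        ring
      _ = ∫ z, G z ∂(expSeq.map fun y => (Fk y, y k)) :=
        (integral_map (by fun_prop) hGm.aestronglyMeasurable).symm
      _ = ∫ x, ∫ y, G (x, y) ∂(expMeasure 1) ∂(expSeq.map Fk) := by
        have : IsProbabilityMeasure (expSeq.map Fk) :=
          Measure.isProbabilityMeasure_map hFm.aemeasurable
        rw [hind3, integral_prod]
        rw [← hind3]
        refine (integrable_map_measure hGm.aestronglyMeasurable (by fun_prop)).2 ?_
        refine Integrable.of_bound (C := 1)
          (hGm.comp (by fun_prop)).aestronglyMeasurable (Eventually.of_forall fun y => ?_)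
        simp only [Function.comp_apply, hG, norm_mul]
        calc _ ≤ (1 : ℝ) * 1 := by
              refine mul_le_mul (hFb y) ?_ (by positivity) zero_le_one
              rw [← norm_mul]; exact hWb _
          _ = 1 := one_mul 1
      _ = ∫ x, x.1 * voidFun H T x.2 ∂(expSeq.map Fk) := by
        refine integral_congr_ae (Eventually.of_forall fun x => ?_)
        simp only [hG]
        rw [integral_const_mul, integral_expMeasure_voidFun hH h0 h1 hT]
      _ = _ := by
        rw [integral_map hFm.aemeasurable (by fun_prop)]

/-- The sums pass T almost surely, after which `voidFun` is 1, so the martingale factor disappears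
in the limit by dominated convergence. -/
theorem tendsto_integral_prod (hH : Measurable H) (h0 : ∀ r, 0 ≤ H r) (h1 : ∀ r, H r ≤ 1)
    (hT : ∀ r, T ≤ r → H r = 0) :
    Tendsto (fun k => ∫ y, ∏ m ∈ Finset.range k, (1 - H (psum y (m + 1))) ∂expSeq) atTop
      (𝓝 (voidFun H T 0)) := by
  have hW := (continuous_voidFun (T := T) hH h0 h1).measurable
  have hPm : ∀ k, Measurable fun y => ∏ m ∈ Finset.range k, (1 - H (psum y (m + 1))) := fun k =>
    Finset.measurable_prod _ fun m _ => measurable_const.sub (hH.comp (measurable_psum _))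
  have hP0 : ∀ k y, 0 ≤ ∏ m ∈ Finset.range k, (1 - H (psum y (m + 1))) := fun k y =>
    Finset.prod_nonneg fun m _ => by linarith [h1 (psum y (m + 1))]
  have hP1 : ∀ k y, ∏ m ∈ Finset.range k, (1 - H (psum y (m + 1))) ≤ 1 := fun k y =>
    Finset.prod_le_one (fun m _ => by linarith [h1 (psum y (m + 1))])
      fun m _ => by linarith [h0 (psum y (m + 1))]
  have hWm : ∀ k, Measurable fun y => voidFun H T (psum y k) := fun k =>
    hW.comp (measurable_psum k)
  have hdiff : Tendsto (fun k => ∫ y, (∏ m ∈ Finset.range k, (1 - H (psum y (m + 1)))) *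
      (1 - voidFun H T (psum y k)) ∂expSeq) atTop (𝓝 (∫ _, (0 : ℝ) ∂expSeq)) := by
    refine tendsto_integral_of_dominated_convergence (fun _ => 1)
      (fun k => ((hPm k).mul (measurable_const.sub (hWm k))).aestronglyMeasurable)
      (integrable_const _) (fun k => Eventually.of_forall fun y => ?_) ?_
    · rw [norm_mul, Real.norm_of_nonneg (hP0 k y), Real.norm_of_nonneg
        (by linarith [voidFun_le_one h0 hT (psum y k)])]
      exact mul_le_one₀ (hP1 k y) (by linarith [voidFun_le_one h0 hT (psum y k)])
        (by linarith [voidFun_nonneg (H := H) (T := T) (psum y k)])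
    · filter_upwards [expSeq_ae_tendsto_psum] with y hy
      refine tendsto_const_nhds.congr' ?_
      filter_upwards [hy.eventually_ge_atTop T] with k hk
      rw [voidFun_of_ge hT hk, sub_self, mul_zero]
  have hsum := hdiff.add_const (voidFun H T 0)
  simp only [integral_zero, zero_add] at hsum
  refine hsum.congr fun k => ?_
  rw [← integral_prod_mul_voidFun hH h0 h1 hT k, ← integral_add]
  · exact integral_congr_ae (Eventually.of_forall fun y => by ring)
  · refine Integrable.of_bound (C := 1)
      ((hPm k).mul (measurable_const.sub (hWm k))).aestronglyMeasurable
      (Eventually.of_forall fun y => ?_)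
    rw [norm_mul, Real.norm_of_nonneg (hP0 k y), Real.norm_of_nonneg
        (by linarith [voidFun_le_one h0 hT (psum y k)])]
    exact mul_le_one₀ (hP1 k y) (by linarith [voidFun_le_one h0 hT (psum y k)])
        (by linarith [voidFun_nonneg (H := H) (T := T) (psum y k)])
  · refine Integrable.of_bound (C := 1)
      ((hPm k).mul (hWm k)).aestronglyMeasurable (Eventually.of_forall fun y => ?_)
    rw [norm_mul, Real.norm_of_nonneg (hP0 k y), Real.norm_of_nonneg (voidFun_nonneg _)]
    exact mul_le_one₀ (hP1 k y) (voidFun_nonneg _) (voidFun_le_one h0 hT _)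

/-- The marked exponential partial sums form a Poisson process: its void probabilities. -/
theorem measure_void {B : Set (ℝ × ℝ)} (hB : MeasurableSet B) (hT0 : 0 ≤ T)
    (hBT : ∀ z ∈ B, z.1 < T) :
    (expSeq.prod unifSeq).real {w | ∀ m, (psum w.1 (m + 1), w.2 m) ∉ B} =
      Real.exp (-(volume (B ∩ Ioi 0 ×ˢ Icc 0 1)).toReal) := by
  set U : Measure ℝ := volume.restrict (Icc 0 1) with hU
  -- H(r) is the probability that a point at time r receives a mark that puts it into B.
  set H : ℝ → ℝ := fun r => U.real (Prod.mk r ⁻¹' B) with hHdef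
  have hsec : ∀ r, MeasurableSet (Prod.mk r ⁻¹' B) := fun r => measurable_prodMk_left hB
  have hH : Measurable H := (measurable_measure_prodMk_left hB).ennreal_toReal
  have h0 : ∀ r, 0 ≤ H r := fun r => measureReal_nonneg
  have h1 : ∀ r, H r ≤ 1 := fun r => measureReal_le_one
  have hT : ∀ r, T ≤ r → H r = 0 := fun r hr => by
    have : Prod.mk r ⁻¹' B = ∅ := eq_empty_of_forall_notMem fun u hu => (hBT _ hu).not_ge hr
    simp [hHdef, this]
  have hmeas : ∀ m : ℕ, MeasurableSet {w : (ℕ → ℝ) × (ℕ → ℝ) | (psum w.1 (m + 1), w.2 m) ∉ B} :=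
    fun m => by
      have : Measurable fun w : (ℕ → ℝ) × (ℕ → ℝ) => (psum w.1 (m + 1), w.2 m) :=
        ((measurable_psum (m + 1)).comp measurable_fst).prodMk
          ((measurable_pi_apply m).comp measurable_snd)
      exact (this hB).compl
  -- Given the times, the marks are independent, so the conditional void probability is a product of
  -- factors 1 - H.
  have hfin : ∀ k : ℕ, (expSeq.prod unifSeq).real
      (⋂ m ∈ Finset.range k, {w | (psum w.1 (m + 1), w.2 m) ∉ B}) =
      ∫ y, ∏ m ∈ Finset.range k, (1 - H (psum y (m + 1))) ∂expSeq := fun k => by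
    have hmk := Finset.measurableSet_biInter (Finset.range k) fun m _ => hmeas m
    rw [Measure.real, Measure.prod_apply hmk, ← integral_toReal
      (measurable_measure_prodMk_left hmk).aemeasurable
      (Eventually.of_forall fun y => measure_lt_top _ _)]
    refine integral_congr_ae (Eventually.of_forall fun y => ?_)
    have hpre : Prod.mk y ⁻¹' (⋂ m ∈ Finset.range k,
        {w : (ℕ → ℝ) × (ℕ → ℝ) | (psum w.1 (m + 1), w.2 m) ∉ B}) =
        Set.pi (Finset.range k) fun m => (Prod.mk (psum y (m + 1)) ⁻¹' B)ᶜ := by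
      ext u; simp [Set.mem_pi]
    simp only [hpre]
    rw [unifSeq, Measure.infinitePi_pi _ fun m _ => (hsec _).compl,
      ENNReal.toReal_prod]
    refine Finset.prod_congr rfl fun m _ => ?_
    exact probReal_compl_eq_one_sub (hsec _)
  have hlim1 : Tendsto (fun k : ℕ => (expSeq.prod unifSeq).real
      (⋂ m ∈ Finset.range k, {w | (psum w.1 (m + 1), w.2 m) ∉ B})) atTop
      (𝓝 ((expSeq.prod unifSeq).real {w | ∀ m, (psum w.1 (m + 1), w.2 m) ∉ B})) := by
    have heq : {w : (ℕ → ℝ) × (ℕ → ℝ) | ∀ m, (psum w.1 (m + 1), w.2 m) ∉ B} =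
        ⋂ k : ℕ, ⋂ m ∈ Finset.range k, {w | (psum w.1 (m + 1), w.2 m) ∉ B} := by
      ext w
      simp only [mem_ofPred_eq, mem_iInter, Finset.mem_range]
      exact ⟨fun h k m _ => h m, fun h m => h (m + 1) m (Nat.lt_succ_self m)⟩
    rw [heq]
    refine (ENNReal.tendsto_toReal (measure_ne_top _ _)).comp (tendsto_measure_iInter_atTop
      (fun k => (Finset.measurableSet_biInter _ fun m _ => hmeas m).nullMeasurableSet)
      (fun i j hij => biInter_subset_biInter_left fun m hm => ?_) ⟨0, measure_ne_top _ _⟩)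
    exact Finset.mem_coe.2 (Finset.mem_range.2 ((Finset.mem_range.1 hm).trans_le hij))
  simp_rw [hfin] at hlim1
  rw [tendsto_nhds_unique hlim1 (tendsto_integral_prod hH h0 h1 hT), voidFun]
  congr 2
  have hvol : volume (B ∩ Ioi 0 ×ˢ Icc 0 1) = ((volume.restrict (Ioi (0 : ℝ))).prod U) B := by
    rw [hU, Measure.prod_restrict, Measure.restrict_apply hB]; rfl
  have hsplit : ∫⁻ r in Ioi (0 : ℝ), U (Prod.mk r ⁻¹' B) =
      ∫⁻ r in Ioc (0 : ℝ) T, U (Prod.mk r ⁻¹' B) := by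
    rw [← lintegral_indicator measurableSet_Ioi, ← lintegral_indicator measurableSet_Ioc]
    refine lintegral_congr fun r => ?_
    by_cases hr : r ∈ Ioc 0 T
    · rw [indicator_of_mem hr, indicator_of_mem (Ioc_subset_Ioi_self hr)]
    · rw [indicator_of_notMem hr]
      refine indicator_apply_eq_zero.2 fun h0r => ?_
      have : Prod.mk r ⁻¹' B = ∅ := eq_empty_of_forall_notMem fun u hu =>
        hr ⟨h0r, (hBT _ hu).le⟩
      simp [this]
  rw [hvol, Measure.prod_apply hB, hsplit, intervalIntegral.integral_of_le hT0,
    integral_eq_lintegral_of_nonneg_ae (Eventually.of_forall h0) hH.aestronglyMeasurable]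
  congr 1
  refine lintegral_congr fun r => ?_
  simp only [hHdef, Measure.real, ENNReal.ofReal_toReal (measure_ne_top U _)]

/-! ### From the Poisson process to the plane -/

/-- The map `(s, u) ↦ (A s^(2/3) + B (u s^(1/3))², C u s^(1/3))`. -/
def cubeRootMap (A B C : ℝ) (z : ℝ × ℝ) : ℝ × ℝ :=
  (A * z.1 ^ (2 / 3 : ℝ) + B * (z.2 * z.1 ^ (1 / 3 : ℝ)) ^ 2, C * (z.2 * z.1 ^ (1 / 3 : ℝ)))

theorem measurable_cubeRootMap (A B C : ℝ) : Measurable (cubeRootMap A B C) := by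
  unfold cubeRootMap; fun_prop

theorem rpow_two_thirds {s : ℝ} (hs : 0 ≤ s) : s ^ (2 / 3 : ℝ) = (s ^ (1 / 3 : ℝ)) ^ 2 := by
  rw [← Real.rpow_natCast, ← Real.rpow_mul hs]; norm_num

theorem rpow_third_cube {s : ℝ} (hs : 0 ≤ s) : (s ^ (1 / 3 : ℝ)) ^ 3 = s := by
  rw [← Real.rpow_natCast, ← Real.rpow_mul hs]; norm_num

theorem cube_rpow_third {r : ℝ} (hr : 0 ≤ r) : (r ^ 3) ^ (1 / 3 : ℝ) = r := by
  rw [← Real.rpow_natCast, ← Real.rpow_mul hr]; norm_num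

theorem injOn_cubeRootMap {A B C : ℝ} (hA : 0 < A) (hC : C ≠ 0) :
    InjOn (cubeRootMap A B C) (Ioi 0 ×ˢ Ioo 0 1) := by
  rintro ⟨s, u⟩ ⟨hs, -⟩ ⟨s', u'⟩ ⟨hs', -⟩ h
  simp only [mem_Ioi] at hs hs'
  simp only [cubeRootMap, Prod.mk.injEq, rpow_two_thirds hs.le, rpow_two_thirds hs'.le] at h
  have hr := Real.rpow_pos_of_pos hs (1 / 3)
  have hr' := Real.rpow_pos_of_pos hs' (1 / 3)
  have h2 := mul_left_cancel₀ hC h.2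
  have h1 := h.1
  rw [h2] at h1
  have h3 : s ^ (1 / 3 : ℝ) = s' ^ (1 / 3 : ℝ) := by
    have := mul_left_cancel₀ hA.ne' (add_right_cancel h1)
    exact (pow_left_inj₀ hr.le hr'.le two_ne_zero).1 this
  have h4 : s = s' := by rw [← rpow_third_cube hs.le, h3, rpow_third_cube hs'.le]
  rw [h3] at h2
  rw [h4, mul_right_cancel₀ hr'.ne' h2]

theorem image_cubeRootMap {A B C : ℝ} (hA : 0 < A) (hC : C ≠ 0) :
    cubeRootMap A B C '' (Ioi 0 ×ˢ Ioo 0 1) =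
      {z | 0 < z.2 / C ∧ (A + B) * (z.2 / C) ^ 2 < z.1} := by
  ext ⟨x, y⟩
  simp only [mem_image, Prod.exists, mem_prod, mem_Ioi, mem_Ioo, mem_ofPred_eq]
  constructor
  · rintro ⟨s, u, ⟨hs, hu0, hu1⟩, h⟩
    simp only [cubeRootMap, Prod.mk.injEq, rpow_two_thirds hs.le] at h
    have hr := Real.rpow_pos_of_pos hs (1 / 3)
    rw [← h.1, ← h.2, mul_div_cancel_left₀ _ hC]
    refine ⟨by positivity, ?_⟩
    have : (u * s ^ (1 / 3 : ℝ)) ^ 2 < (s ^ (1 / 3 : ℝ)) ^ 2 :=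
      pow_lt_pow_left₀ (by nlinarith) (by positivity) two_ne_zero
    nlinarith
  · rintro ⟨hv, hlt⟩
    -- v stands for u s^(1/3) and D for s^(2/3), so that u < 1 becomes v² < D.
    set v := y / C with hvdef
    have hD : v ^ 2 < (x - B * v ^ 2) / A := by
      rw [lt_div_iff₀ hA]; linarith
    set D := (x - B * v ^ 2) / A with hDdef
    have hvr : v < √D := Real.lt_sqrt_of_sq_lt hD
    have hr : 0 < √D := hv.trans hvr
    have hD0 : 0 ≤ D := (sq_nonneg v).trans hD.le
    refine ⟨√D ^ 3, v / √D, ⟨by positivity, by positivity, (div_lt_one hr).2 hvr⟩, ?_⟩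
    rw [cubeRootMap, Prod.mk.injEq]
    simp only [rpow_two_thirds (pow_nonneg hr.le 3), cube_rpow_third hr.le,
      div_mul_cancel₀ _ hr.ne', Real.sq_sqrt hD0]
    constructor
    · rw [hDdef]; field_simp; ring
    · rw [hvdef]; field_simp

/-- The derivative of `cubeRootMap`. -/
def cubeRootMapDeriv (A B C : ℝ) (z : ℝ × ℝ) : ℝ × ℝ →L[ℝ] ℝ × ℝ :=
  (Matrix.toLin (Module.Basis.finTwoProd ℝ) (Module.Basis.finTwoProd ℝ)
    !![(2 / 3) * z.1 ^ (-(1 / 3) : ℝ) * (A + B * z.2 ^ 2), 2 * B * z.2 * z.1 ^ (2 / 3 : ℝ);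
      C * z.2 * ((1 / 3) * z.1 ^ (-(2 / 3) : ℝ)), C * z.1 ^ (1 / 3 : ℝ)]).toContinuousLinearMap

theorem hasFDerivAt_cubeRootMap (A B C : ℝ) {z : ℝ × ℝ} (hz : 0 < z.1) :
    HasFDerivAt (cubeRootMap A B C) (cubeRootMapDeriv A B C z) z := by
  have h1 : HasFDerivAt (fun z : ℝ × ℝ => z.1 ^ (1 / 3 : ℝ))
      (((1 / 3 : ℝ) * z.1 ^ ((1 / 3 : ℝ) - 1)) • ContinuousLinearMap.fst ℝ ℝ ℝ) z :=
    hasFDerivAt_fst.rpow_const (Or.inl hz.ne')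
  have h2 : HasFDerivAt (fun z : ℝ × ℝ => z.1 ^ (2 / 3 : ℝ))
      (((2 / 3 : ℝ) * z.1 ^ ((2 / 3 : ℝ) - 1)) • ContinuousLinearMap.fst ℝ ℝ ℝ) z :=
    hasFDerivAt_fst.rpow_const (Or.inl hz.ne')
  rw [show (1 / 3 : ℝ) - 1 = -(2 / 3) by norm_num] at h1
  rw [show (2 / 3 : ℝ) - 1 = -(1 / 3) by norm_num] at h2
  have h3 := (hasFDerivAt_snd (𝕜 := ℝ) (p := z)).mul h1
  have h4 := ((h2.const_mul A).add ((h3.pow 2).const_mul B)).prodMk (h3.const_mul C)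
  refine h4.congr_fderiv ?_
  have e3 : z.1 ^ (3⁻¹ : ℝ) * z.1 ^ (-(2 / 3) : ℝ) = z.1 ^ (-3⁻¹ : ℝ) := by
    rw [← Real.rpow_add hz]; norm_num
  ext
  · simp [cubeRootMapDeriv]
    rw [← e3]; ring
  · simp [cubeRootMapDeriv]
    ring
  · simp [cubeRootMapDeriv, rpow_two_thirds hz.le]
    ring
  · simp [cubeRootMapDeriv]

/-- The powers of s cancel. A constant Jacobian is what makes the image of a homogeneous Poisson
process homogeneous. -/
theorem det_cubeRootMapDeriv (A B C : ℝ) {z : ℝ × ℝ} (hz : 0 < z.1) :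
    (cubeRootMapDeriv A B C z).det = 2 / 3 * A * C := by
  have e1 : z.1 ^ (-(1 / 3) : ℝ) * z.1 ^ (1 / 3 : ℝ) = 1 := by
    rw [← Real.rpow_add hz]; norm_num
  have e2 : z.1 ^ (2 / 3 : ℝ) * z.1 ^ (-(2 / 3) : ℝ) = 1 := by
    rw [← Real.rpow_add hz]; norm_num
  rw [cubeRootMapDeriv, LinearMap.det_toContinuousLinearMap, LinearMap.det_toLin,
    Matrix.det_fin_two_of]
  linear_combination (2 / 3 * C * (A + B * z.2 ^ 2)) * e1 - (2 / 3 * B * z.2 ^ 2 * C) * e2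

theorem volume_preimage_cubeRootMap {A B C : ℝ} (hA : 0 < A) (hC : C ≠ 0) {S : Set (ℝ × ℝ)}
    (hS : MeasurableSet S) :
    ENNReal.ofReal (2 / 3 * A * |C|) * volume (cubeRootMap A B C ⁻¹' S ∩ Ioi 0 ×ˢ Icc 0 1) =
      volume (S ∩ {z | 0 < z.2 / C ∧ (A + B) * (z.2 / C) ^ 2 < z.1}) := by
  have hpre := measurable_cubeRootMap A B C hS
  have hD : MeasurableSet (Ioi (0 : ℝ) ×ˢ Ioo (0 : ℝ) 1) := measurableSet_Ioi.prod measurableSet_Ioo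
  have hae : volume (cubeRootMap A B C ⁻¹' S ∩ Ioi 0 ×ˢ Icc 0 1) =
      volume (cubeRootMap A B C ⁻¹' S ∩ Ioi 0 ×ˢ Ioo 0 1) := by
    refine measure_congr ((ae_eq_refl _).inter ?_)
    exact Measure.set_prod_ae_eq (ae_eq_refl _) Ioo_ae_eq_Icc.symm
  have := lintegral_abs_det_fderiv_eq_addHaar_image (volume : Measure (ℝ × ℝ))
    (f := cubeRootMap A B C) (f' := cubeRootMapDeriv A B C) (hpre.inter hD)
    (fun z hz => (hasFDerivAt_cubeRootMap A B C hz.2.1).hasFDerivWithinAt)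
    ((injOn_cubeRootMap hA hC).mono inter_subset_right)
  rw [image_preimage_inter, image_cubeRootMap hA hC] at this
  rw [← this, hae, setLIntegral_congr_fun (hpre.inter hD) (g := fun _ =>
    ENNReal.ofReal (2 / 3 * A * |C|)), setLIntegral_const]
  intro z hz
  simp only
  rw [det_cubeRootMapDeriv A B C hz.2.1, abs_mul, abs_of_pos (by positivity)]

/-! ### The constants c, σ, τ and the Poisson process of a norm-angle sequence -/

theorem capConst_pos {a q : ℝ} (ha : 0 < a) (hq : 0 < q) (hq2 : q < 2) : 0 < capConst a q := by
  have : 0 < 4 - q ^ 2 := by nlinarith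
  unfold capConst; positivity

theorem sigmaConst_pos {a p q : ℝ} (ha : 0 < a) (hp : 0 < p) (hq : 0 < q) (hq2 : q < 2) :
    0 < sigmaConst a p q :=
  Real.rpow_pos_of_pos (mul_pos hp (capConst_pos ha hq hq2)) _

theorem tauConst_pos {a q : ℝ} (ha : 0 < a) (hq : 0 < q) (hq2 : q < 2) : 0 < tauConst a q := by
  have := capConst_pos ha hq hq2
  unfold tauConst; positivity

theorem tauConst_sq {a q : ℝ} (ha : 0 < a) (hq : 0 < q) (hq2 : q < 2) :
    tauConst a q ^ 2 = 2 * q ^ 2 / (a * (4 - q ^ 2)) := by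
  have h : 0 < 4 - q ^ 2 := by nlinarith
  have h1 : √(2 * a) ^ 2 = 2 * a := Real.sq_sqrt (by positivity)
  have h2 : √(4 - q ^ 2) ^ 2 = 4 - q ^ 2 := Real.sq_sqrt h.le
  have h3 : √(4 - q ^ 2) ≠ 0 := by positivity
  rw [tauConst, capConst, mul_pow, div_pow, div_pow, mul_pow, mul_pow (3 : ℝ), mul_pow (2 * q), h1,
    h2]
  field_simp

theorem sq_rpow_half {σ : ℝ} (hσ : 0 < σ) : (σ ^ (1 / 2 : ℝ)) ^ 2 = σ := by
  rw [← Real.sqrt_eq_rpow, Real.sq_sqrt hσ.le]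

/-- This is σ^(3/2), the power of σ in the Jacobian (2/3) σ · a τ σ^(1/2); together with τ = 3c/(2a)
it reduces that Jacobian to 1/p. -/
theorem sigmaConst_mul_rpow_half {a p q : ℝ} (ha : 0 < a) (hp : 0 < p) (hq : 0 < q)
    (hq2 : q < 2) :
    sigmaConst a p q * sigmaConst a p q ^ (1 / 2 : ℝ) = (p * capConst a q)⁻¹ := by
  have h : 0 < p * capConst a q := mul_pos hp (capConst_pos ha hq hq2)
  have hσ := sigmaConst_pos ha hp hq hq2
  nth_rewrite 1 [← Real.rpow_one (sigmaConst a p q)]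
  rw [← Real.rpow_add hσ, sigmaConst, ← Real.rpow_mul h.le]
  rw [show -(2 / 3 : ℝ) * (1 + 1 / 2) = -1 by norm_num, Real.rpow_neg_one]

/-- The position, after rescaling about a pole, of the point with rescaled norm `z.1` and rescaled
angle `z.2`, above (`ε = 1`) or below (`ε = -1`) the axis. -/
def polarPoint (a ε : ℝ) (z : ℝ × ℝ) : ℝ × ℝ := (z.1 + a / 2 * z.2 ^ 2, ε * a * z.2)

theorem measurable_polarPoint (a ε : ℝ) : Measurable (polarPoint a ε) := by
  unfold polarPoint; fun_prop

/-- The rescaled shape of the support near a pole, above or below the axis. -/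
def halfParabola (a q ε : ℝ) : Set (ℝ × ℝ) := {z | 0 < ε * z.2 ∧ z.2 ^ 2 < a * q ^ 2 / 2 * z.1}

theorem measurableSet_halfParabola (a q ε : ℝ) : MeasurableSet (halfParabola a q ε) := by
  unfold halfParabola
  exact MeasurableSet.inter
    (measurableSet_lt measurable_const (measurable_snd.const_mul ε))
    (measurableSet_lt (measurable_snd.pow_const 2) (measurable_fst.const_mul _))

theorem polarPoint_normAngle {a ε σ τ : ℝ} (hσ : 0 < σ) (w : (ℕ → ℝ) × (ℕ → ℝ)) (m : ℕ) :
    polarPoint a ε (normAngle σ τ w m) =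
      cubeRootMap σ (a / 2 * τ ^ 2 * σ) (ε * a * τ * σ ^ (1 / 2 : ℝ))
        (psum w.1 (m + 1), w.2 m) := by
  simp only [polarPoint, normAngle, cubeRootMap, psum, Prod.mk.injEq]
  constructor
  · rw [mul_pow, mul_pow, sq_rpow_half hσ]; ring
  · ring

/-- The points `polarPoint` of a norm-angle sequence are the image of the marked exponential sums
under a `cubeRootMap` with Jacobian of modulus 1/p onto the half parabola. They thus form a Poisson
process of intensity p there. -/
theorem measure_void_normAngleLaw {a p q ε K : ℝ} (ha : 0 < a) (hp : 0 < p) (hq : 0 < q)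
    (hq2 : q < 2) (hε : ε ^ 2 = 1) {S : Set (ℝ × ℝ)} (hS : MeasurableSet S)
    (hK : ∀ z ∈ S, z.1 < K) :
    (normAngleLaw (sigmaConst a p q) (tauConst a q)).real {z | ∀ m, polarPoint a ε (z m) ∉ S} =
      Real.exp (-(p * (volume (S ∩ halfParabola a q ε)).toReal)) := by
  have hσ := sigmaConst_pos ha hp hq hq2
  have hτ := tauConst_pos ha hq hq2
  have hτ2 := tauConst_sq ha hq hq2
  have hc := capConst_pos ha hq hq2
  have hσσ := sigmaConst_mul_rpow_half ha hp hq hq2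
  have hτdef : tauConst a q = 3 / (2 * a) * capConst a q := rfl
  set σ := sigmaConst a p q
  set τ := tauConst a q
  have hε0 : ε ≠ 0 := by rintro rfl; norm_num at hε
  have hεabs : |ε| = 1 := by
    rcases _root_.sq_eq_one_iff.1 hε with h | h <;> simp [h]
  have hσh : 0 < σ ^ (1 / 2 : ℝ) := Real.rpow_pos_of_pos hσ _
  set B := a / 2 * τ ^ 2 * σ
  set C := ε * a * τ * σ ^ (1 / 2 : ℝ) with hC
  have hC0 : C ≠ 0 := by positivity
  have hS' := measurable_cubeRootMap σ B C hS
  have hB0 : 0 ≤ B := by positivity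
  have hms : MeasurableSet {z : ℕ → ℝ × ℝ | ∀ m, polarPoint a ε (z m) ∉ S} := by
    have : {z : ℕ → ℝ × ℝ | ∀ m, polarPoint a ε (z m) ∉ S} =
        ⋂ m, (fun z : ℕ → ℝ × ℝ => polarPoint a ε (z m)) ⁻¹' Sᶜ := by
      ext; simp
    rw [this]
    exact MeasurableSet.iInter fun m =>
      ((measurable_polarPoint a ε).comp (measurable_pi_apply m)) hS.compl
  rw [normAngleLaw_eq_map, map_measureReal_apply (measurable_normAngle σ τ) hms]
  have hpre : normAngle σ τ ⁻¹' {z | ∀ m, polarPoint a ε (z m) ∉ S} =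
      {w | ∀ m, (psum w.1 (m + 1), w.2 m) ∉ cubeRootMap σ B C ⁻¹' S} := by
    ext w; simp only [mem_preimage, mem_ofPred_eq, polarPoint_normAngle hσ]; rfl
  -- The first coordinate of the image is at least σ s^(2/3), so the bound K on it bounds the time s
  -- by (K/σ)^(3/2).
  have hT : ∀ z ∈ cubeRootMap σ B C ⁻¹' S, z.1 < √(max K 0 / σ) ^ 3 := fun z hz => by
    by_contra! hle
    have hsq : √(max K 0 / σ) ^ 2 = max K 0 / σ := Real.sq_sqrt (by positivity)
    have h0 : 0 ≤ z.1 := le_trans (by positivity) hle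
    have h1 : √(max K 0 / σ) ≤ z.1 ^ (1 / 3 : ℝ) := by
      rw [← cube_rpow_third (Real.sqrt_nonneg (max K 0 / σ))]
      exact Real.rpow_le_rpow (by positivity) hle (by norm_num)
    have h2 : max K 0 ≤ σ * z.1 ^ (2 / 3 : ℝ) := by
      rw [rpow_two_thirds h0]
      have := pow_le_pow_left₀ (Real.sqrt_nonneg _) h1 2
      rw [hsq, div_le_iff₀ hσ] at this
      linarith
    have h3 := hK _ hz
    simp only [cubeRootMap] at h3
    have : 0 ≤ B * (z.2 * z.1 ^ (1 / 3 : ℝ)) ^ 2 := by positivity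
    linarith [le_max_left K 0]
  rw [hpre, measure_void hS' (by positivity) hT]
  have hvol := volume_preimage_cubeRootMap (B := B) hσ hC0 hS
  have hjac : 2 / 3 * σ * |C| = p⁻¹ := by
    rw [hC, abs_mul, abs_mul, abs_mul, hεabs, abs_of_pos ha, abs_of_pos hτ, abs_of_pos hσh]
    calc 2 / 3 * σ * (1 * a * τ * σ ^ (1 / 2 : ℝ))
        = 2 / 3 * a * τ * (σ * σ ^ (1 / 2 : ℝ)) := by ring
      _ = p⁻¹ := by rw [hσσ, hτdef]; field_simp
  have hreg : {z : ℝ × ℝ | 0 < z.2 / C ∧ (σ + B) * (z.2 / C) ^ 2 < z.1} = halfParabola a q ε := by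
    ext z
    have h4 : 0 < 4 - q ^ 2 := by nlinarith
    have hCε : z.2 / C = ε * z.2 / (a * τ * σ ^ (1 / 2 : ℝ)) := by
      rw [hC, div_eq_div_iff (by positivity) (by positivity)]
      linear_combination (-(z.2 * a * τ * σ ^ (1 / 2 : ℝ))) * hε
    -- Here σ + B = 4σ/(4 - q²) and C² = 2aq²σ/(4 - q²), so the quotient is 2/(aq²).
    have hsq : (σ + B) * (z.2 / C) ^ 2 = z.2 ^ 2 / (a * q ^ 2 / 2) := by
      rw [hC, div_pow, mul_pow, mul_pow, mul_pow, hε, sq_rpow_half hσ, hτ2]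
      simp only [B, hτ2]
      field_simp
      ring
    simp only [halfParabola, mem_ofPred_eq]
    rw [hsq, div_lt_iff₀' (by positivity), hCε, div_pos_iff_of_pos_right (by positivity)]
  rw [hjac, hreg] at hvol
  rw [← hvol, ENNReal.toReal_mul, ENNReal.toReal_ofReal (by positivity), ← mul_assoc,
    mul_inv_cancel₀ hp.ne', one_mul]

/-- As U ≤ 1, the squared angle is at most τ² times the norm, so a bound on norms is a bound on
angles. Divergence of the norms is what makes the minima attained. -/
theorem ae_normAngleLaw {a p q : ℝ} (ha : 0 < a) (hp : 0 < p) (hq : 0 < q) (hq2 : q < 2) :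
    ∀ᵐ z ∂normAngleLaw (sigmaConst a p q) (tauConst a q),
      (∀ m, 0 ≤ (z m).1 ∧ (z m).2 ^ 2 ≤ tauConst a q ^ 2 * (z m).1) ∧ (∀ m, 0 ≤ (z m).2) ∧
      Tendsto (fun m => (z m).1) atTop atTop := by
  have hσ := sigmaConst_pos ha hp hq hq2
  have hτ := tauConst_pos ha hq hq2
  set σ := sigmaConst a p q
  set τ := tauConst a q
  have hunif : ∀ᵐ u ∂unifSeq, ∀ j, u j ∈ Icc (0 : ℝ) 1 := by
    refine ae_all_iff.2 fun j => ?_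
    exact (measurePreserving_eval_infinitePi (fun _ : ℕ => (volume.restrict (Icc 0 1) : Measure ℝ))
      j).quasiMeasurePreserving.ae (ae_restrict_mem measurableSet_Icc)
  have key : ∀ w : (ℕ → ℝ) × (ℕ → ℝ), (∀ j, 0 < w.1 j) → Tendsto (psum w.1) atTop atTop →
      (∀ j, w.2 j ∈ Icc (0 : ℝ) 1) →
      (∀ m, 0 ≤ (normAngle σ τ w m).1 ∧
        (normAngle σ τ w m).2 ^ 2 ≤ τ ^ 2 * (normAngle σ τ w m).1) ∧
      (∀ m, 0 ≤ (normAngle σ τ w m).2) ∧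
      Tendsto (fun m => (normAngle σ τ w m).1) atTop atTop := fun w hw ht hu => by
    refine ⟨fun m => ?_, fun m => ?_, ?_⟩
    · have hs := (psum_pos hw m).le
      change 0 ≤ σ * psum w.1 (m + 1) ^ (2 / 3 : ℝ) ∧
        (w.2 m * τ * σ ^ (1 / 2 : ℝ) * psum w.1 (m + 1) ^ (1 / 3 : ℝ)) ^ 2 ≤
          τ ^ 2 * (σ * psum w.1 (m + 1) ^ (2 / 3 : ℝ))
      refine ⟨by positivity, ?_⟩
      rw [rpow_two_thirds hs, mul_pow, mul_pow, mul_pow, sq_rpow_half hσ]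
      have h1 : w.2 m ^ 2 ≤ 1 := pow_le_one₀ (hu m).1 (hu m).2
      have h2 : 0 ≤ τ ^ 2 * σ * (psum w.1 (m + 1) ^ (1 / 3 : ℝ)) ^ 2 := by positivity
      nlinarith
    · have hs := (psum_pos hw m).le
      have := (hu m).1
      change 0 ≤ w.2 m * τ * σ ^ (1 / 2 : ℝ) * psum w.1 (m + 1) ^ (1 / 3 : ℝ)
      positivity
    · exact ((tendsto_rpow_atTop (by norm_num)).comp
        (ht.comp (tendsto_add_atTop_nat 1))).const_mul_atTop hσ
  have hc : ∀ m : ℕ, Measurable fun z : ℕ → ℝ × ℝ => z m := fun m => measurable_pi_apply m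
  have hc1 : ∀ m : ℕ, Measurable fun z : ℕ → ℝ × ℝ => (z m).1 := fun m => measurable_fst.comp (hc m)
  have hc2 : ∀ m : ℕ, Measurable fun z : ℕ → ℝ × ℝ => (z m).2 := fun m => measurable_snd.comp (hc m)
  rw [normAngleLaw_eq_map, ae_map_iff (measurable_normAngle σ τ).aemeasurable]
  · have h1 := Measure.quasiMeasurePreserving_fst (μ := expSeq) (ν := unifSeq)
    have h2 := Measure.quasiMeasurePreserving_snd (μ := expSeq) (ν := unifSeq)
    filter_upwards [h1.ae expSeq_ae_pos, h1.ae expSeq_ae_tendsto_psum, h2.ae hunif] with w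
    exact key w
  · have m1 : MeasurableSet {z : ℕ → ℝ × ℝ | ∀ m, 0 ≤ (z m).1 ∧
        (z m).2 ^ 2 ≤ τ ^ 2 * (z m).1} := by
      rw [ofPred_forall]
      exact MeasurableSet.iInter fun m => (measurableSet_le measurable_const (hc1 m)).inter
        (measurableSet_le ((hc2 m).pow_const 2) ((hc1 m).const_mul _))
    have m2 : MeasurableSet {z : ℕ → ℝ × ℝ | ∀ m, 0 ≤ (z m).2} := by
      rw [ofPred_forall]
      exact MeasurableSet.iInter fun m => measurableSet_le measurable_const (hc2 m)
    exact m1.inter (m2.inter (measurableSet_tendsto atTop hc1))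

/-! ### The limit variable -/

/-- The limit of the rescaled gap between the distance of two points, one near each pole, and the
diameter, as a function of their rescaled positions. -/
def gapCost (a : ℝ) (x y : ℝ × ℝ) : ℝ := x.1 + y.1 - (x.2 - y.2) ^ 2 / (4 * a)

theorem gapCost_comm (a : ℝ) (x y : ℝ × ℝ) : gapCost a x y = gapCost a y x := by
  unfold gapCost; ring

/-- The sign of the ordinate in a quadrant. -/
def upSign : Fin 4 → ℝ
  | 0 => 1
  | 1 => 1
  | 2 => -1
  | 3 => -1

/-- The sign of the abscissa in a quadrant. -/
def rightSign : Fin 4 → ℝ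
  | 0 => 1
  | 1 => -1
  | 2 => -1
  | 3 => 1

theorem upSign_sq (i : Fin 4) : upSign i ^ 2 = 1 := by fin_cases i <;> norm_num [upSign]

theorem rightSign_eq_one_iff {i : Fin 4} : rightSign i = 1 ↔ i = 0 ∨ i = 3 := by
  match i with
  | 0 => simp [rightSign]
  | 1 => norm_num [rightSign]; decide
  | 2 => norm_num [rightSign]; decide
  | 3 => simp [rightSign]

theorem rightSign_eq_neg_one_iff {i : Fin 4} : rightSign i = -1 ↔ i = 1 ∨ i = 2 := by
  match i with
  | 0 => norm_num [rightSign]; decide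
  | 1 => simp [rightSign]
  | 2 => simp [rightSign]
  | 3 => norm_num [rightSign]; decide

theorem poleAbscissa_eq (a : ℝ) (i : Fin 4) : poleAbscissa a i = rightSign i * a := by
  fin_cases i <;> simp [poleAbscissa, rightSign]

/-- The curvature terms (a/2)(z₂² + w₂²) minus (a/4)(εz₂ - δw₂)² complete to (a/4)(z₂ + εδw₂)². The
sign flips: quadrants on the same side of the axis give the sum of the angles, diagonally opposite
ones the difference. -/
theorem gapCost_polarPoint (a : ℝ) (ε δ : ℝ) (hε : ε ^ 2 = 1) (hδ : δ ^ 2 = 1)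
    (z w : ℝ × ℝ) : gapCost a (polarPoint a ε z) (polarPoint a δ w) =
      z.1 + w.1 + a / 4 * (z.2 + ε * δ * w.2) ^ 2 := by
  simp only [gapCost, polarPoint]
  field_simp
  linear_combination (-2 * a * z.2 ^ 2 - 2 * a * δ ^ 2 * w.2 ^ 2) * hε + (-4 * a * w.2 ^ 2) * hδ

/-- Below any level only finitely many index pairs remain, whence the infimum is attained in
`isLeast_range_iInf`. -/
theorem tendsto_cofinite_of_add_le {F : ℕ × ℕ → ℝ} {u v : ℕ → ℝ} (hu : ∀ k, 0 ≤ u k)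
    (hv : ∀ k, 0 ≤ v k) (hut : Tendsto u atTop atTop) (hvt : Tendsto v atTop atTop)
    (hF : ∀ p, u p.1 + v p.2 ≤ F p) : Tendsto F cofinite atTop := by
  refine tendsto_atTop.2 fun b => ?_
  obtain ⟨N, hN⟩ := eventually_atTop.1 (hut.eventually_ge_atTop b)
  obtain ⟨M, hM⟩ := eventually_atTop.1 (hvt.eventually_ge_atTop b)
  refine ((finite_lt_nat N).prod (finite_lt_nat M)).subset fun p hp => ?_
  simp only [mem_compl_iff, mem_ofPred_eq, not_le] at hp
  constructor
  · change p.1 < N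
    by_contra! h
    linarith [hF p, hN _ h, hv p.2]
  · change p.2 < M
    by_contra! h
    linarith [hF p, hM _ h, hu p.1]

theorem isLeast_range_iInf {F : ℕ × ℕ → ℝ} (hF : Tendsto F cofinite atTop) :
    IsLeast (range F) (⨅ p, F p) := by
  obtain ⟨p, hp⟩ := hF.exists_forall_le
  have : ⨅ p, F p = F p := le_antisymm
    (ciInf_le ⟨F p, by rintro _ ⟨x, rfl⟩; exact hp x⟩ p) (le_ciInf hp)
  rw [this]
  exact ⟨⟨p, rfl⟩, by rintro _ ⟨x, rfl⟩; exact hp x⟩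

theorem minimaAttained_of_tendsto {a : ℝ} (ha : 0 < a) {z : Fin 4 → ℕ → ℝ × ℝ}
    (h0 : ∀ i m, 0 ≤ (z i m).1) (ht : ∀ i, Tendsto (fun m => (z i m).1) atTop atTop) :
    MinimaAttained a z := by
  have hS : ∀ i j, IsLeast (range (costSum a (z i) (z j))) (minSum a (z i) (z j)) := fun i j => by
    refine isLeast_range_iInf (tendsto_cofinite_of_add_le (h0 i) (h0 j) (ht i) (ht j) fun p => ?_)
    unfold costSum
    linarith [show 0 ≤ a / 4 * ((z i p.1).2 + (z j p.2).2) ^ 2 by positivity]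
  have hD : ∀ i j, IsLeast (range (costDiff a (z i) (z j))) (minDiff a (z i) (z j)) := fun i j => by
    refine isLeast_range_iInf (tendsto_cofinite_of_add_le (h0 i) (h0 j) (ht i) (ht j) fun p => ?_)
    unfold costDiff
    linarith [show 0 ≤ a / 4 * ((z i p.1).2 - (z j p.2).2) ^ 2 by positivity]
  exact ⟨hS 0 1, hD 0 2, hD 1 3, hS 2 3⟩

/-- Nonnegativity bounds the range below; without a lower bound the real infimum would be its
default value 0. -/
theorem iInf_lt_iff_of_nonneg {F : ℕ × ℕ → ℝ} (hF : ∀ p, 0 ≤ F p) {t : ℝ} :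
    ⨅ p, F p < t ↔ ∃ k l, F (k, l) < t := by
  rw [ciInf_lt_iff ⟨0, by rintro _ ⟨x, rfl⟩; exact hF x⟩, Prod.exists]

/-- The four index pairs in the limit are exactly the pairings of a right with a left quadrant, so
the limit is the least cost between the two polar point processes. -/
theorem limitMin_lt_iff {a t : ℝ} (ha : 0 < a) {z : Fin 4 → ℕ → ℝ × ℝ}
    (h0 : ∀ i m, 0 ≤ (z i m).1) : limitMin a z < t ↔
      ∃ i j, rightSign i = 1 ∧ rightSign j = -1 ∧ ∃ k l,
        gapCost a (polarPoint a (upSign i) (z i k)) (polarPoint a (upSign j) (z j l)) < t := by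
  have hS : ∀ i j p, 0 ≤ costSum a (z i) (z j) p := fun i j p => by
    have := h0 i p.1; have := h0 j p.2; unfold costSum; positivity
  have hD : ∀ i j p, 0 ≤ costDiff a (z i) (z j) p := fun i j p => by
    have := h0 i p.1; have := h0 j p.2; unfold costDiff; positivity
  simp only [limitMin, min_lt_iff, minSum, minDiff, iInf_lt_iff_of_nonneg (hS _ _),
    iInf_lt_iff_of_nonneg (hD _ _), gapCost_polarPoint a _ _ (upSign_sq _) (upSign_sq _)]
  have e01 : ∀ k l, costSum a (z 0) (z 1) (k, l) = (z 0 k).1 + (z 1 l).1 +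
      a / 4 * ((z 0 k).2 + upSign 0 * upSign 1 * (z 1 l).2) ^ 2 := fun k l => by
    simp [costSum, upSign]
  have e02 : ∀ k l, costDiff a (z 0) (z 2) (k, l) = (z 0 k).1 + (z 2 l).1 +
      a / 4 * ((z 0 k).2 + upSign 0 * upSign 2 * (z 2 l).2) ^ 2 := fun k l => by
    simp [costDiff, upSign, sub_eq_add_neg]
  have e13 : ∀ k l, costDiff a (z 1) (z 3) (k, l) = (z 3 l).1 + (z 1 k).1 +
      a / 4 * ((z 3 l).2 + upSign 3 * upSign 1 * (z 1 k).2) ^ 2 := fun k l => by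
    simp only [costDiff, upSign]; ring
  have e23 : ∀ k l, costSum a (z 2) (z 3) (k, l) = (z 3 l).1 + (z 2 k).1 +
      a / 4 * ((z 3 l).2 + upSign 3 * upSign 2 * (z 2 k).2) ^ 2 := fun k l => by
    simp only [costSum, upSign]; ring
  simp only [e01, e02, e13, e23]
  constructor
  · rintro ((⟨k, l, h⟩ | ⟨k, l, h⟩) | (⟨k, l, h⟩ | ⟨k, l, h⟩))
    · exact ⟨0, 1, rfl, rfl, k, l, h⟩
    · exact ⟨0, 2, rfl, rfl, k, l, h⟩
    · exact ⟨3, 1, rfl, rfl, l, k, h⟩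
    · exact ⟨3, 2, rfl, rfl, l, k, h⟩
  · rintro ⟨i, j, hi, hj, k, l, h⟩
    rcases rightSign_eq_one_iff.1 hi with rfl | rfl <;>
      rcases rightSign_eq_neg_one_iff.1 hj with rfl | rfl
    · exact Or.inl (Or.inl ⟨k, l, h⟩)
    · exact Or.inl (Or.inr ⟨k, l, h⟩)
    · exact Or.inr (Or.inl ⟨l, k, h⟩)
    · exact Or.inr (Or.inr ⟨l, k, h⟩)

/-! ### Geometry of the support -/

theorem Plane.norm_sq (z : Plane) : ‖z‖ ^ 2 = z 0 ^ 2 + z 1 ^ 2 := by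
  rw [EuclideanSpace.real_norm_sq_eq, Fin.sum_univ_two]

theorem Plane.dist_sq (z w : Plane) : dist z w ^ 2 = (z 0 - w 0) ^ 2 + (z 1 - w 1) ^ 2 := by
  rw [dist_eq_norm, Plane.norm_sq]; simp

theorem Plane.continuous_apply (j : Fin 2) : Continuous fun z : Plane => z j := by fun_prop

/-- The boundary function of a quadrant, reflected into the first quadrant. -/
def profile (g : Fin 4 → ℝ → ℝ) (i : Fin 4) (x : ℝ) : ℝ := upSign i * g i (rightSign i * x)

/-- The abscissa sign of a side: `true` is the right side. -/
def sideSign (b : Bool) : ℝ := if b then 1 else -1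

/-- The upper quadrant of a side. -/
def topIdx (b : Bool) : Fin 4 := if b then 0 else 1

/-- The lower quadrant of a side. -/
def botIdx (b : Bool) : Fin 4 := if b then 3 else 2

theorem sideSign_sq (b : Bool) : sideSign b ^ 2 = 1 := by cases b <;> simp [sideSign]

theorem sideSign_mul_self (b : Bool) : sideSign b * sideSign b = 1 := by
  cases b <;> simp [sideSign]

namespace Admissible

variable {a ν : ℝ} {g : Fin 4 → ℝ → ℝ} {q : Fin 4 → ℝ} {E : Set Plane} {f : Plane → ℝ}

theorem continuousOn_profile (hE : Admissible a ν g q E f) (i : Fin 4) :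
    ContinuousOn (profile g i) (Icc ν a) := by
  refine continuousOn_const.mul ((hE.boundary_continuousOn i).comp
    (continuous_const.mul continuous_id).continuousOn fun x hx => ?_)
  match i with
  | 0 => simpa [rightSign, boundaryDomain] using hx
  | 1 => simpa [rightSign, boundaryDomain, and_comm] using hx
  | 2 => simpa [rightSign, boundaryDomain, and_comm] using hx
  | 3 => simpa [rightSign, boundaryDomain] using hx

theorem profile_nonneg (hE : Admissible a ν g q E f) (i : Fin 4) {x : ℝ} (hx : x ∈ Icc ν a) :
    0 ≤ profile g i x := by
  match i with
  | 0 => simpa [profile, upSign, rightSign] using hE.boundary_nonneg 0 (by simp) x hx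
  | 1 => simpa [profile, upSign, rightSign] using hE.boundary_nonneg 1 (by simp) (-x)
          ⟨by linarith [hx.2], by linarith [hx.1]⟩
  | 2 => simpa [profile, upSign, rightSign] using hE.boundary_nonpos 2 (by simp) (-x)
          ⟨by linarith [hx.2], by linarith [hx.1]⟩
  | 3 => simpa [profile, upSign, rightSign] using hE.boundary_nonpos 3 (by simp) x hx

theorem profile_pole (hE : Admissible a ν g q E f) (i : Fin 4) : profile g i a = 0 := by
  have := hE.boundary_pole i
  rw [poleAbscissa_eq] at this
  rw [profile, this, mul_zero]

theorem tendsto_profile (hE : Admissible a ν g q E f) (i : Fin 4) :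
    Tendsto (fun x => profile g i x / ellipseBoundary a x) (𝓝[<] a) (𝓝 (q i)) := by
  have hneg : Tendsto (fun x : ℝ => -x) (𝓝[<] a) (𝓝[>] (-a)) := tendsto_neg_nhdsLT
  have hell : ∀ x, ellipseBoundary a (-x) = ellipseBoundary a x := fun x => by
    simp [ellipseBoundary]
  match i with
  | 0 => simpa [profile, upSign, rightSign] using hE.decay_0
  | 1 => simpa [profile, upSign, rightSign, Function.comp_def, hell] using hE.decay_1.comp hneg
  | 2 => simpa [profile, upSign, rightSign, Function.comp_def, hell] using hE.decay_2.comp hneg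
  | 3 => simpa [profile, upSign, rightSign] using hE.decay_3

theorem existsUnique_profile (hE : Admissible a ν g q E f) (i : Fin 4) :
    ∀ᶠ h in 𝓝[>] (0 : ℝ), ∃! x, x ∈ Icc ν a ∧ x ^ 2 + profile g i x ^ 2 = (a - h) ^ 2 := by
  filter_upwards [hE.unique_intersection i] with h hh
  have hneg : ∀ j : Fin 4, (∃! x, x ∈ Icc (-a) (-ν) ∧ x ^ 2 + g j x ^ 2 = (a - h) ^ 2) →
      ∃! x, x ∈ Icc ν a ∧ x ^ 2 + g j (-x) ^ 2 = (a - h) ^ 2 := by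
    rintro j ⟨x, ⟨hx, hxe⟩, huniq⟩
    refine ⟨-x, ⟨⟨by linarith [hx.2], by linarith [hx.1]⟩, by simpa using hxe⟩, fun y hy => ?_⟩
    have := huniq (-y) ⟨⟨by linarith [hy.1.2], by linarith [hy.1.1]⟩, by simpa using hy.2⟩
    linarith
  match i with
  | 0 => simpa [profile, upSign, rightSign, boundaryDomain] using hh
  | 1 => simpa [profile, upSign, rightSign] using hneg 1 hh
  | 2 => simpa [profile, upSign, rightSign] using hneg 2 hh
  | 3 => simpa [profile, upSign, rightSign, boundaryDomain] using hh

theorem mem_interior_iff (hE : Admissible a ν g q E f) (b : Bool) {z : Plane}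
    (hz : ν < sideSign b * z 0) : z ∈ interior E ↔ sideSign b * z 0 < a ∧
      -profile g (botIdx b) (sideSign b * z 0) < z 1 ∧
      z 1 < profile g (topIdx b) (sideSign b * z 0) := by
  cases b with
  | true =>
    have h := Set.ext_iff.1 hE.interior_right z
    simp only [sideSign, if_true, one_mul] at hz ⊢
    simp only [mem_inter_iff, mem_ofPred_eq, hz, and_true, true_and] at h
    simp [h, botIdx, topIdx, profile, upSign, rightSign]
  | false =>
    have h := Set.ext_iff.1 hE.interior_left z
    simp only [sideSign, Bool.false_eq_true, if_false, neg_mul, one_mul] at hz ⊢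
    have hz' : z 0 < -ν := by linarith
    simp only [mem_inter_iff, mem_ofPred_eq, hz', and_true] at h
    rw [h]
    simp [botIdx, topIdx, profile, upSign, rightSign, neg_lt]

theorem ellipseBoundary_pos {a x : ℝ} (hx : x < a) (hx' : -a < x) :
    0 < ellipseBoundary a x := by
  have : 0 < a ^ 2 - x ^ 2 := by nlinarith
  unfold ellipseBoundary; positivity

theorem continuous_ellipseBoundary (a : ℝ) : Continuous (ellipseBoundary a) := by
  unfold ellipseBoundary; fun_prop

theorem ellipseBoundary_sq {a x : ℝ} (hx : x ^ 2 ≤ a ^ 2) :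
    ellipseBoundary a x ^ 2 = (a ^ 2 - x ^ 2) / 4 := by
  rw [ellipseBoundary, div_pow, Real.sq_sqrt (by linarith)]; norm_num

theorem exists_profile_near (hE : Admissible a ν g q E f) {δ : ℝ} (hδ : 0 < δ) :
    ∃ ρ > 0, ρ ≤ a - ν ∧ ∀ i, ∀ x, a - ρ < x → x < a →
      (q i - δ) * ellipseBoundary a x < profile g i x ∧
      profile g i x < (q i + δ) * ellipseBoundary a x := by
  have h : ∀ᶠ x in 𝓝[<] a, ∀ i, profile g i x / ellipseBoundary a x ∈ Ioo (q i - δ) (q i + δ) :=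
    eventually_all.2 fun i => hE.tendsto_profile i
      (Ioo_mem_nhds (by linarith) (by linarith))
  obtain ⟨l, hl, hsub⟩ := (mem_nhdsLT_iff_exists_Ioo_subset).1 h
  simp only [mem_Iio] at hl
  refine ⟨min (a - l) (a - ν), lt_min (by linarith) (by linarith [hE.nu_lt]), min_le_right _ _,
    fun i x hx hxa => ?_⟩
  have h1 : l < x := by linarith [min_le_left (a - l) (a - ν)]
  have h2 : ν < x := by linarith [min_le_right (a - l) (a - ν)]
  have hpos := ellipseBoundary_pos hxa (by linarith [hE.nu_nonneg, hE.a_pos])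
  have := hsub ⟨h1, hxa⟩ i
  rw [mem_Ioo, lt_div_iff₀ hpos, div_lt_iff₀ hpos] at this
  exact this

theorem exists_profile_sq_lt (hE : Admissible a ν g q E f) (i : Fin 4) :
    ∃ ρ > 0, ρ ≤ a - ν ∧ ∀ x, a - ρ < x → x < a → x ^ 2 + profile g i x ^ 2 < a ^ 2 := by
  -- With δ = 2 - q_i the upper bound is twice `ellipseBoundary`, which is the circle of radius a.
  obtain ⟨ρ, hρ, hρν, h⟩ := hE.exists_profile_near (sub_pos.2 (hE.q_lt i))
  refine ⟨ρ, hρ, hρν, fun x hx hxa => ?_⟩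
  have hν : ν < x := by linarith
  have hx0 : 0 < x := lt_of_le_of_lt hE.nu_nonneg hν
  have h1 := (h i x hx hxa).2
  have h0 := hE.profile_nonneg i ⟨hν.le, hxa.le⟩
  have h2 := ellipseBoundary_sq (a := a) (x := x) (by nlinarith)
  have h3 : profile g i x ^ 2 < (2 * ellipseBoundary a x) ^ 2 :=
    pow_lt_pow_left₀ (by linarith) h0 two_ne_zero
  linarith

/-- The graphs of the boundary functions lie in the disk of radius `a`. -/
theorem profile_sq_le (hE : Admissible a ν g q E f) (i : Fin 4) {x : ℝ} (hx : x ∈ Icc ν a) :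
    x ^ 2 + profile g i x ^ 2 ≤ a ^ 2 := by
  by_contra! hgt
  have ha := hE.a_pos
  set r : ℝ → ℝ := fun x => x ^ 2 + profile g i x ^ 2 with hr
  have hxa : x < a := lt_of_le_of_ne hx.2 fun h => by
    rw [h, hE.profile_pole i] at hgt; simp at hgt
  obtain ⟨ρ, hρ, hρν, h⟩ := hE.exists_profile_sq_lt i
  -- The graph would be outside the disk at x, strictly inside at y (near the pole, where q_i < 2
  -- applies) and on the circle at a. For small h it would then meet the circle of radius a - h in
  -- [x, y] and in [y, a]. Uniqueness forces both crossings to be y, where the radius is too small.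
  set y := max ((x + a) / 2) (a - ρ / 2) with hy
  have hya : y < a := max_lt (by linarith) (by linarith)
  have hxy : x < y := lt_of_lt_of_le (by linarith) (le_max_left _ _)
  have hry : r y < a ^ 2 := h y (by linarith [le_max_right ((x + a) / 2) (a - ρ / 2)]) hya
  have hra : r a = a ^ 2 := by simp [hr, hE.profile_pole i]
  have hcont : ContinuousOn r (Icc ν a) :=
    (continuous_pow 2).continuousOn.add ((hE.continuousOn_profile i).pow 2)
  have hev : ∀ᶠ h in 𝓝[>] (0 : ℝ), r y < (a - h) ^ 2 ∧ (a - h) ^ 2 < a ^ 2 := by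
    have h1 : Tendsto (fun h : ℝ => (a - h) ^ 2) (𝓝[>] 0) (𝓝 ((a - 0) ^ 2)) :=
      (Continuous.tendsto (by fun_prop) 0).mono_left nhdsWithin_le_nhds
    rw [sub_zero] at h1
    filter_upwards [h1.eventually_const_lt hry, Ioo_mem_nhdsGT ha] with h hh hmem
    exact ⟨hh, by nlinarith [hmem.1, hmem.2]⟩
  obtain ⟨h, huniq, hh1, hh2⟩ := ((hE.existsUnique_profile i).and hev).exists
  have hI1 : Icc x y ⊆ Icc ν a := Icc_subset_Icc hx.1 hya.le
  have hI2 : Icc y a ⊆ Icc ν a := Icc_subset_Icc (hx.1.trans hxy.le) le_rfl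
  obtain ⟨u, hu, hue⟩ := intermediate_value_Icc' hxy.le (hcont.mono hI1)
    ⟨hh1.le, (hh2.trans hgt).le⟩
  obtain ⟨v, hv, hve⟩ := intermediate_value_Icc hya.le (hcont.mono hI2)
    (show (a - h) ^ 2 ∈ Icc (r y) (r a) from ⟨hh1.le, by rw [hra]; exact hh2.le⟩)
  have huv := huniq.unique ⟨hI1 hu, hue⟩ ⟨hI2 hv, hve⟩
  have : u = y := le_antisymm hu.2 (huv ▸ hv.1)
  rw [← this] at hh1
  exact hh1.ne hue

theorem mem_quadrant_cases {z : Plane} (h0 : z 0 ≠ 0) (h1 : z 1 ≠ 0) : ∃ i, z ∈ quadrant i := by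
  rcases lt_or_gt_of_ne h0 with h0 | h0 <;> rcases lt_or_gt_of_ne h1 with h1 | h1
  · exact ⟨2, h0, h1⟩
  · exact ⟨1, h0, h1⟩
  · exact ⟨3, h0, h1⟩
  · exact ⟨0, h0, h1⟩

theorem isOpen_quadrant (i : Fin 4) : IsOpen (quadrant i) := by
  have h0 := Plane.continuous_apply 0
  have h1 := Plane.continuous_apply 1
  match i with
  | 0 => exact (isOpen_lt continuous_const h0).inter (isOpen_lt continuous_const h1)
  | 1 => exact (isOpen_lt h0 continuous_const).inter (isOpen_lt continuous_const h1)
  | 2 => exact (isOpen_lt h0 continuous_const).inter (isOpen_lt h1 continuous_const)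
  | 3 => exact (isOpen_lt continuous_const h0).inter (isOpen_lt h1 continuous_const)

/-- A set of diameter 2a need not lie in a disk of radius a. Here the outer parts are controlled by
`profile_sq_le` and the middle part by the assumption on small h; the lines covered by neither are
reached as limits. -/
theorem subset_closedBall (hE : Admissible a ν g q E f) : E ⊆ Metric.closedBall 0 a := by
  have ha := hE.a_pos
  have hside : ∀ b, ∀ z ∈ interior E, ν < sideSign b * z 0 → z ∈ Metric.closedBall (0 : Plane) a :=
    fun b z hz hν => by
      obtain ⟨h1, h2, h3⟩ := (hE.mem_interior_iff b hν).1 hz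
      have hmem : sideSign b * z 0 ∈ Icc ν a := ⟨hν.le, h1.le⟩
      have ht := hE.profile_sq_le (topIdx b) hmem
      have hb := hE.profile_sq_le (botIdx b) hmem
      have ht0 := hE.profile_nonneg (topIdx b) hmem
      have hb0 := hE.profile_nonneg (botIdx b) hmem
      rw [mul_pow, sideSign_sq, one_mul] at ht hb
      rw [mem_closedBall_zero_iff]
      refine abs_le_of_sq_le_sq' (a := ‖z‖) (b := a) ?_ ha.le |>.2
      rw [Plane.norm_sq]
      rcases le_total 0 (z 1) with h | h <;> nlinarith
  have hgood : ∀ z ∈ interior E, z 0 ≠ ν → z 0 ≠ -ν → z 0 ≠ 0 → z 1 ≠ 0 →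
      z ∈ Metric.closedBall (0 : Plane) a := fun z hz hn1 hn2 h0 h1 => by
    by_cases hr : ν < z 0
    · exact hside true z hz (by simpa [sideSign] using hr)
    by_cases hl : z 0 < -ν
    · exact hside false z hz (by simp only [sideSign]; norm_num; linarith)
    have hlt : |z 0| < ν := abs_lt.2 ⟨lt_of_le_of_ne (not_lt.1 hl) (Ne.symm hn2),
      lt_of_le_of_ne (not_lt.1 hr) hn1⟩
    obtain ⟨i, hi⟩ := mem_quadrant_cases h0 h1
    obtain ⟨h, hh, hh0⟩ := ((hE.middle_subset i).and self_mem_nhdsWithin).exists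
    have hmem : z ∈ interior (E ∩ quadrant i) := by
      rw [interior_inter, (isOpen_quadrant i).interior_eq]; exact ⟨hz, hi⟩
    exact Metric.closedBall_subset_closedBall (by linarith [show 0 < h from hh0]) (hh ⟨hmem, hlt⟩)
  have hint : interior E ⊆ Metric.closedBall 0 a := fun z hz => by
    -- A small diagonal shift leaves each of the exceptional lines, on which an abscissa is 0 or ±ν
    -- or an ordinate is 0.
    set w : ℝ → Plane := fun t => z + t • !₂[1, 1] with hw
    have hw0 : ∀ t, w t 0 = z 0 + t := fun t => by simp [hw]
    have hw1 : ∀ t, w t 1 = z 1 + t := fun t => by simp [hw]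
    have hcont : Tendsto w (𝓝[≠] 0) (𝓝 z) := by
      have : Tendsto w (𝓝 0) (𝓝 (w 0)) := Continuous.tendsto (by fun_prop) 0
      simpa [hw] using this.mono_left nhdsWithin_le_nhds
    have hne : ∀ c d : ℝ, ∀ᶠ t in 𝓝[≠] (0 : ℝ), c + t ≠ d := fun c d => by
      by_cases hcd : c = d
      · filter_upwards [self_mem_nhdsWithin] with t ht h
        exact ht (by simpa [hcd] using h)
      · have : Tendsto (fun t : ℝ => c + t) (𝓝[≠] 0) (𝓝 (c + 0)) :=
          (Continuous.tendsto (by fun_prop) 0).mono_left nhdsWithin_le_nhds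
        exact this.eventually_ne (by simpa using hcd)
    refine Metric.isClosed_closedBall.mem_of_tendsto hcont ?_
    filter_upwards [hcont (isOpen_interior.mem_nhds hz), hne (z 0) ν, hne (z 0) (-ν),
      hne (z 0) 0, hne (z 1) 0] with t h1 h2 h3 h4 h5
    exact hgood _ h1 (by rwa [hw0]) (by rwa [hw0]) (by rwa [hw0]) (by rwa [hw1])
  rw [← hE.closure_interior]
  exact closure_minimal hint Metric.isClosed_closedBall

/-- Near a pole the support lies between slightly enlarged ellipses. -/
theorem exists_outer_shape (hE : Admissible a ν g q E f) {δ : ℝ} (hδ : 0 < δ) :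
    ∃ ρ > 0, ρ ≤ a ∧ ∀ b, ∀ z ∈ E, a - ρ < sideSign b * z 0 → sideSign b * z 0 ≤ a ∧
      -((q (botIdx b) + δ) * ellipseBoundary a (sideSign b * z 0)) ≤ z 1 ∧
      z 1 ≤ (q (topIdx b) + δ) * ellipseBoundary a (sideSign b * z 0) := by
  obtain ⟨ρ, hρ, hρν, h⟩ := hE.exists_profile_near hδ
  refine ⟨ρ, hρ, by linarith [hE.nu_nonneg], fun b z hz hzρ => ?_⟩
  have hc0 : Continuous fun z : Plane => sideSign b * z 0 := by fun_prop
  have hc1 : Continuous fun z : Plane => z 1 := by fun_prop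
  have hce := (continuous_ellipseBoundary a).comp hc0
  have hopen : IsOpen {z : Plane | a - ρ < sideSign b * z 0} := isOpen_lt continuous_const hc0
  have hclosed : IsClosed {z : Plane | sideSign b * z 0 ≤ a ∧
      -((q (botIdx b) + δ) * ellipseBoundary a (sideSign b * z 0)) ≤ z 1 ∧
      z 1 ≤ (q (topIdx b) + δ) * ellipseBoundary a (sideSign b * z 0)} :=
    (isClosed_le hc0 continuous_const).inter
      ((isClosed_le (continuous_const.mul hce).neg hc1).inter
        (isClosed_le hc1 (continuous_const.mul hce)))
  rw [← hE.closure_interior] at hz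
  -- The enlarged shape is closed, so it suffices to check interior points, where the boundary
  -- functions apply.
  have := hopen.inter_closure ⟨hzρ, hz⟩
  refine closure_minimal (fun w hw => ?_) hclosed this
  have hw1 : a - ρ < sideSign b * w 0 := hw.1
  obtain ⟨h1, h2, h3⟩ := (hE.mem_interior_iff b (by linarith)).1 hw.2
  have hb := h (botIdx b) _ hw1 h1
  have ht := h (topIdx b) _ hw1 h1
  exact ⟨h1.le, by linarith [hb.2], by linarith [ht.2]⟩

/-- Near a pole the support contains the region between slightly diminished ellipses. -/
theorem exists_inner_shape (hE : Admissible a ν g q E f) {δ : ℝ} (hδ : 0 < δ) :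
    ∃ ρ > 0, ∀ b, ∀ z : Plane, a - ρ < sideSign b * z 0 → sideSign b * z 0 < a →
      -((q (botIdx b) - δ) * ellipseBoundary a (sideSign b * z 0)) < z 1 →
      z 1 < (q (topIdx b) - δ) * ellipseBoundary a (sideSign b * z 0) → z ∈ E := by
  obtain ⟨ρ, hρ, hρν, h⟩ := hE.exists_profile_near hδ
  refine ⟨ρ, hρ, fun b z hz hza h1 h2 => interior_subset ?_⟩
  have hb := h (botIdx b) _ hz hza
  have ht := h (topIdx b) _ hz hza
  exact (hE.mem_interior_iff b (by linarith)).2 ⟨hza, by linarith [hb.1], by linarith [ht.1]⟩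

/-- Near a pole the support lies in an ellipse that is flatter than the circle. -/
theorem exists_flat_shape (hE : Admissible a ν g q E f) :
    ∃ κ < 1, 0 ≤ κ ∧ ∃ ρ > 0, ∀ b, ∀ z ∈ E, a - ρ < sideSign b * z 0 → sideSign b * z 0 ≤ a ∧
      z 1 ^ 2 ≤ κ * (a ^ 2 - z 0 ^ 2) := by
  obtain ⟨Q, hQ2, hQ⟩ : ∃ Q < 2, ∀ i, q i < Q := by
    have hfin : (range q).Finite := finite_range q
    obtain ⟨i, hi⟩ := Finite.exists_max q
    exact ⟨(q i + 2) / 2, by linarith [hE.q_lt i], fun j => by linarith [hi j, hE.q_lt i]⟩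
  have hQ0 : 0 < Q := (hE.q_pos 0).trans (hQ 0)
  obtain ⟨ρ, hρ, hρa, h⟩ := hE.exists_outer_shape (δ := (2 - Q) / 2) (by linarith)
  -- R = Q + (2 - Q)/2 is still below 2, and the ellipse of height R times `ellipseBoundary` has
  -- squared height (R/2)²(a² - x²); this is the choice of κ.
  set R := (Q + 2) / 2 with hR
  refine ⟨(R / 2) ^ 2, by nlinarith, by positivity, ρ, hρ, fun b z hz hzρ => ?_⟩
  obtain ⟨h1, h2, h3⟩ := h b z hz hzρ
  refine ⟨h1, ?_⟩
  have hsq : (sideSign b * z 0) ^ 2 = z 0 ^ 2 := by rw [mul_pow, sideSign_sq, one_mul]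
  have hle : (sideSign b * z 0) ^ 2 ≤ a ^ 2 := by nlinarith
  have he := ellipseBoundary_sq hle
  have he0 : 0 ≤ ellipseBoundary a (sideSign b * z 0) := by unfold ellipseBoundary; positivity
  rw [hsq] at he
  have hb : (q (botIdx b) + (2 - Q) / 2) * ellipseBoundary a (sideSign b * z 0) ≤
      R * ellipseBoundary a (sideSign b * z 0) :=
    mul_le_mul_of_nonneg_right (by linarith [hQ (botIdx b)]) he0
  have ht : (q (topIdx b) + (2 - Q) / 2) * ellipseBoundary a (sideSign b * z 0) ≤
      R * ellipseBoundary a (sideSign b * z 0) :=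
    mul_le_mul_of_nonneg_right (by linarith [hQ (topIdx b)]) he0
  have : z 1 ^ 2 ≤ (R * ellipseBoundary a (sideSign b * z 0)) ^ 2 :=
    sq_le_sq' (by linarith) (by linarith)
  rw [mul_pow, he] at this
  linarith

/-- Points of the support at nearly maximal distance lie near opposite poles. -/
theorem exists_near_poles (hE : Admissible a ν g q E f) {ε : ℝ} (hε : 0 < ε) :
    ∃ δ > 0, ∀ z ∈ E, ∀ w ∈ E, 2 * a - δ ≤ dist z w →
      (dist z (axisPoint a) < ε ∧ dist w (axisPoint (-a)) < ε) ∨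
      (dist w (axisPoint a) < ε ∧ dist z (axisPoint (-a)) < ε) := by
  have ha := hE.a_pos
  have hneg : axisPoint (-a) = -axisPoint a := by
    ext j; fin_cases j <;> simp [axisPoint]
  set E' := E \ (Metric.ball (axisPoint (-a)) (ε / 2) ∪ Metric.ball (axisPoint a) (ε / 2)) with hE'
  have hd : Metric.diam E' < 2 * a := hE.diam_lt (ε / 2) (by linarith)
  have hbdd : Bornology.IsBounded E' := hE.isCompact.isBounded.subset sdiff_subset
  -- The first bound prevents both points from avoiding the polar disks, the second permits squaring
  -- 2a - δ. By the third, the parallelogram law gives ‖z + w‖² ≤ 4aδ ≤ ε²/8.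
  set δ := min ((2 * a - Metric.diam E') / 2) (min a (ε ^ 2 / (32 * a))) with hδ
  have hδ1 : δ ≤ (2 * a - Metric.diam E') / 2 := min_le_left _ _
  have hδ2 : δ ≤ a := (min_le_right _ _).trans (min_le_left _ _)
  have hδ3 : δ ≤ ε ^ 2 / (32 * a) := (min_le_right _ _).trans (min_le_right _ _)
  refine ⟨δ, lt_min (by linarith) (lt_min ha (by positivity)), fun z hz w hw hzw => ?_⟩
  have hsum : ‖z + w‖ < ε / 2 := by
    have hz' := mem_closedBall_zero_iff.1 (hE.subset_closedBall hz)
    have hw' := mem_closedBall_zero_iff.1 (hE.subset_closedBall hw)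
    have hpar := parallelogram_law_with_norm ℝ z w
    rw [dist_eq_norm] at hzw
    have h1 : (2 * a - δ) ^ 2 ≤ ‖z - w‖ ^ 2 := pow_le_pow_left₀ (by linarith) hzw 2
    have h2 : ‖z‖ ^ 2 ≤ a ^ 2 := pow_le_pow_left₀ (norm_nonneg _) hz' 2
    have h3 : ‖w‖ ^ 2 ≤ a ^ 2 := pow_le_pow_left₀ (norm_nonneg _) hw' 2
    have h4 : δ * (32 * a) ≤ ε ^ 2 := (le_div_iff₀ (by positivity)).1 hδ3
    refine abs_lt_of_sq_lt_sq (a := ‖z + w‖) ?_ (by linarith) |> (le_abs_self _).trans_lt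
    nlinarith [sq_nonneg δ, sq_pos_of_pos hε]
  have hsymm : ∀ (u v c : Plane), ‖u + v‖ < ε / 2 → dist u c < ε / 2 → dist v (-c) < ε :=
    fun u v c huv hu => by
      have : v - -c = (u + v) - (u - c) := by abel
      rw [dist_eq_norm, this]
      rw [dist_eq_norm] at hu
      linarith [norm_sub_le (u + v) (u - c)]
  have hsum' : ‖w + z‖ < ε / 2 := by rwa [add_comm]
  -- One of the points is within ε/2 of a pole; as z + w is small, the other one is near the
  -- opposite pole.
  by_cases hmem : z ∈ E' ∧ w ∈ E'
  · have := Metric.dist_le_diam_of_mem hbdd hmem.1 hmem.2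
    linarith
  · simp only [hE', Set.mem_sdiff, hz, hw, true_and, mem_union, Metric.mem_ball, ← not_or, not_not]
      at hmem
    rw [hneg] at hmem ⊢
    rcases hmem with ((h | h) | (h | h))
    · exact Or.inr ⟨by simpa using hsymm z w _ hsum h, by linarith⟩
    · exact Or.inl ⟨by linarith, hsymm z w _ hsum h⟩
    · exact Or.inl ⟨by simpa using hsymm w z _ hsum' h, by linarith⟩
    · exact Or.inr ⟨by linarith, hsymm w z _ hsum' h⟩

end Admissible

/-! ### Rescaling about the poles -/

/-- Anisotropic rescaling about a pole. -/
def poleMap (a : ℝ) (b : Bool) (r : ℝ) (z : Plane) : ℝ × ℝ :=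
  (r ^ 2 * (a - sideSign b * z 0), r * z 1)

/-- The inverse of `poleMap`. -/
def polePoint (a : ℝ) (b : Bool) (r : ℝ) (x : ℝ × ℝ) : Plane :=
  !₂[sideSign b * (a - x.1 / r ^ 2), x.2 / r]

@[simp] theorem polePoint_zero (a : ℝ) (b : Bool) (r : ℝ) (x : ℝ × ℝ) :
    polePoint a b r x 0 = sideSign b * (a - x.1 / r ^ 2) := rfl

@[simp] theorem polePoint_one (a : ℝ) (b : Bool) (r : ℝ) (x : ℝ × ℝ) :
    polePoint a b r x 1 = x.2 / r := rfl

theorem measurable_poleMap (a : ℝ) (b : Bool) (r : ℝ) : Measurable (poleMap a b r) := by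
  unfold poleMap; fun_prop

theorem continuous_polePoint (a : ℝ) (b : Bool) (r : ℝ) : Continuous (polePoint a b r) := by
  refine (PiLp.continuous_toLp 2 _).comp (continuous_pi fun j => ?_)
  fin_cases j
  · change Continuous fun x : ℝ × ℝ => sideSign b * (a - x.1 / r ^ 2)
    fun_prop
  · change Continuous fun x : ℝ × ℝ => x.2 / r
    fun_prop

theorem poleMap_polePoint (a : ℝ) (b : Bool) {r : ℝ} (hr : 0 < r) (x : ℝ × ℝ) :
    poleMap a b r (polePoint a b r x) = x := by
  refine Prod.ext ?_ ?_
  · simp only [poleMap, polePoint_zero]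
    rw [← mul_assoc, sideSign_mul_self]; field_simp; ring
  · simp only [poleMap, polePoint_one]; field_simp

theorem map_affine_volume {c : ℝ} (hc : c ≠ 0) (d : ℝ) :
    (volume : Measure ℝ).map (fun x => d + c * x) = ENNReal.ofReal |c⁻¹| • volume := by
  rw [show (fun x : ℝ => d + c * x) = (fun x => d + x) ∘ (fun x => c * x) from rfl,
    ← Measure.map_map (by fun_prop) (by fun_prop), Real.map_volume_mul_left hc, Measure.map_smul,
    map_add_left_eq_self]

/-- `polePoint` contracts the abscissa by r² and the ordinate by r. The factor r³ is n at r =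
n^(1/3), the normalisation of the binomial-to-Poisson limit. -/
theorem map_polePoint_volume (a : ℝ) (b : Bool) {r : ℝ} (hr : 0 < r) :
    (volume : Measure (ℝ × ℝ)).map (polePoint a b r) = ENNReal.ofReal (r ^ 3) • volume := by
  have hs : sideSign b ≠ 0 := by cases b <;> simp [sideSign]
  have habs : |sideSign b| = 1 := by cases b <;> simp [sideSign]
  let toPlane : ℝ × ℝ → Plane := fun x => !₂[x.1, x.2]
  have htp : MeasurePreserving toPlane volume volume :=
    (EuclideanSpace.volume_preserving_symm_measurableEquiv_toLp (Fin 2)).symm.comp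
      (volume_preserving_finTwoArrow ℝ).symm
  let h1 : ℝ → ℝ := fun x => sideSign b * a + (-(sideSign b / r ^ 2)) * x
  let h2 : ℝ → ℝ := fun x => 0 + r⁻¹ * x
  have hcomp : polePoint a b r = toPlane ∘ Prod.map h1 h2 := by
    ext x j
    fin_cases j
    · simp [polePoint, toPlane, h1]; ring
    · simp [polePoint, toPlane, h2]; ring
  have hm1 : Measurable h1 := by fun_prop
  have hm2 : Measurable h2 := by fun_prop
  have e1 : (volume : Measure ℝ).map h1 = ENNReal.ofReal (r ^ 2) • volume := by
    rw [map_affine_volume (neg_ne_zero.2 (div_ne_zero hs (by positivity)))]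
    congr 2
    rw [inv_neg, abs_neg, inv_div, abs_div, habs, div_one, abs_of_pos (by positivity)]
  have e2 : (volume : Measure ℝ).map h2 = ENNReal.ofReal r • volume := by
    rw [map_affine_volume (by positivity)]
    congr 2
    rw [inv_inv, abs_of_pos hr]
  rw [hcomp, ← Measure.map_map htp.measurable (hm1.prodMap hm2), Measure.volume_eq_prod,
    ← Measure.map_prod_map _ _ hm1 hm2, e1, e2, Measure.prod_smul_left, Measure.prod_smul_right,
    smul_smul, ← ENNReal.ofReal_mul (by positivity), Measure.map_smul, ← Measure.volume_eq_prod,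
    htp.map_eq]
  congr 2

/-- On the scale of `poleMap` an ellipse becomes a parabola: the left side is √(2aξ - ξ²/r²)/2. A
negative radicand gives the value 0. -/
theorem tendsto_mul_ellipseBoundary (a ξ : ℝ) :
    Tendsto (fun r : ℝ => r * ellipseBoundary a (a - ξ / r ^ 2)) atTop
      (𝓝 (√(2 * a * ξ) / 2)) := by
  have h : ∀ᶠ r : ℝ in atTop, √(2 * a * ξ - ξ ^ 2 / r ^ 2) / 2 =
      r * ellipseBoundary a (a - ξ / r ^ 2) := by
    filter_upwards [eventually_gt_atTop 0] with r hr
    rw [ellipseBoundary, mul_div_assoc', ← Real.sqrt_sq hr.le, ← Real.sqrt_mul (by positivity),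
      Real.sqrt_sq hr.le]
    congr 2
    field_simp
    ring
  refine Tendsto.congr' h ?_
  have h2 : Tendsto (fun r : ℝ => ξ ^ 2 / r ^ 2) atTop (𝓝 0) :=
    tendsto_const_nhds.div_atTop (tendsto_pow_atTop two_ne_zero)
  have h3 := (tendsto_const_nhds (x := 2 * a * ξ)).sub h2
  rw [sub_zero] at h3
  exact ((Real.continuous_sqrt.tendsto _).comp h3).div_const 2

/-- The strict inequality leaves room to diminish q by δ. The tolerance δ is fixed before r grows
because the range of validity ρ in `exists_inner_shape` depends on it. -/
theorem eventually_lt_mul_ellipseBoundary {a q ξ η : ℝ} (hq : 0 < q)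
    (h : η ^ 2 < a * q ^ 2 / 2 * ξ) :
    ∀ᶠ δ in 𝓝[>] (0 : ℝ), ∀ᶠ r : ℝ in atTop,
      η / r < (q - δ) * ellipseBoundary a (a - ξ / r ^ 2) := by
  have h1 : η < (q - 0) * (√(2 * a * ξ) / 2) := by
    have : η / (q / 2) < √(2 * a * ξ) := Real.lt_sqrt_of_sq_lt (by
      rw [div_pow, div_lt_iff₀ (by positivity)]; linarith)
    rw [div_lt_iff₀ (by positivity)] at this
    linarith
  have h2 : Tendsto (fun δ : ℝ => (q - δ) * (√(2 * a * ξ) / 2)) (𝓝[>] 0)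
      (𝓝 ((q - 0) * (√(2 * a * ξ) / 2))) :=
    (Continuous.tendsto (by fun_prop) 0).mono_left nhdsWithin_le_nhds
  filter_upwards [h2.eventually_const_lt h1] with δ hδ
  have h3 := (tendsto_mul_ellipseBoundary a ξ).const_mul (q - δ)
  filter_upwards [h3.eventually_const_lt hδ, eventually_gt_atTop 0] with r hr hr0
  rw [div_lt_iff₀ hr0]; linarith

theorem eventually_mul_ellipseBoundary_lt {a q ξ η : ℝ} (hq : 0 < q) (hη : 0 < η)
    (h : a * q ^ 2 / 2 * ξ < η ^ 2) :
    ∀ᶠ δ in 𝓝[>] (0 : ℝ), ∀ᶠ r : ℝ in atTop,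
      (q + δ) * ellipseBoundary a (a - ξ / r ^ 2) < η / r := by
  have h1 : (q + 0) * (√(2 * a * ξ) / 2) < η := by
    have : √(2 * a * ξ) < η / (q / 2) := (Real.sqrt_lt' (by positivity)).2 (by
      rw [div_pow, lt_div_iff₀ (by positivity)]; linarith)
    rw [lt_div_iff₀ (by positivity)] at this
    linarith
  have h2 : Tendsto (fun δ : ℝ => (q + δ) * (√(2 * a * ξ) / 2)) (𝓝[>] 0)
      (𝓝 ((q + 0) * (√(2 * a * ξ) / 2))) :=
    (Continuous.tendsto (by fun_prop) 0).mono_left nhdsWithin_le_nhds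
  filter_upwards [h2.eventually_lt_const h1] with δ hδ
  have h3 := (tendsto_mul_ellipseBoundary a ξ).const_mul (q + δ)
  filter_upwards [h3.eventually_lt_const hδ, eventually_gt_atTop 0] with r hr hr0
  rw [lt_div_iff₀ hr0]; linarith

/-- These curves are the exceptional set in the pointwise convergence of the rescaled support; k = 0
gives the axis. -/
theorem volume_parabola_eq_zero (k : ℝ) : volume {x : ℝ × ℝ | x.2 ^ 2 = k * x.1} = 0 := by
  have hm : MeasurableSet {x : ℝ × ℝ | x.2 ^ 2 = k * x.1} :=
    measurableSet_eq_fun (measurable_snd.pow_const 2) (measurable_fst.const_mul k)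
  rw [Measure.volume_eq_prod, Measure.measure_prod_null hm]
  refine Eventually.of_forall fun ξ => ?_
  have hsub : Prod.mk ξ ⁻¹' {x : ℝ × ℝ | x.2 ^ 2 = k * x.1} ⊆ {√(k * ξ), -√(k * ξ)} := fun η hη => by
    have h : η ^ 2 = k * ξ := hη
    have : √(k * ξ) ^ 2 = η ^ 2 := by rw [← h, Real.sqrt_sq_eq_abs, sq_abs]
    rcases sq_eq_sq_iff_eq_or_eq_neg.1 this with h | h
    · exact Or.inl h.symm
    · exact Or.inr (by simp [h])
  exact ((Set.toFinite _).subset hsub).measure_zero _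

theorem tendsto_polePoint (a : ℝ) (b : Bool) (x : ℝ × ℝ) :
    Tendsto (fun r => polePoint a b r x) atTop (𝓝 (axisPoint (sideSign b * a))) := by
  have h1 : Tendsto (fun r : ℝ => x.1 / r ^ 2) atTop (𝓝 0) :=
    tendsto_const_nhds.div_atTop (tendsto_pow_atTop two_ne_zero)
  have h2 : Tendsto (fun r : ℝ => x.2 / r) atTop (𝓝 0) := tendsto_const_nhds.div_atTop tendsto_id
  refine ((PiLp.continuous_toLp 2 _).tendsto _).comp (tendsto_pi_nhds.2 fun j => ?_)
  fin_cases j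
  · simpa using (tendsto_const_nhds (x := a)).sub h1 |>.const_mul (sideSign b)
  · simpa using h2

namespace Admissible

variable {a ν : ℝ} {g : Fin 4 → ℝ → ℝ} {q : Fin 4 → ℝ} {E : Set Plane} {f : Plane → ℝ}

theorem isClosed (hE : Admissible a ν g q E f) : IsClosed E := hE.isCompact.isClosed

theorem axisPoint_mem (hE : Admissible a ν g q E f) (b : Bool) :
    axisPoint (sideSign b * a) ∈ E := by
  rw [← hE.isClosed.closure_eq, Metric.mem_closure_iff]
  intro ε hε
  have h := hE.area_pos (topIdx b) ε hε
  rw [poleAbscissa_eq, show rightSign (topIdx b) = sideSign b by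
    cases b <;> simp [rightSign, topIdx, sideSign]] at h
  obtain ⟨z, hz⟩ := nonempty_of_measure_ne_zero h.ne'
  exact ⟨z, hz.1.1, by rw [dist_comm]; exact hz.2⟩

theorem tendsto_density (hE : Admissible a ν g q E f) (b : Bool) :
    Tendsto f (𝓝[E] axisPoint (sideSign b * a)) (𝓝 (f (axisPoint (sideSign b * a)))) := by
  obtain ⟨ε, hε, hpos⟩ := (hE.density_continuousOn.and self_mem_nhdsWithin).exists
  have hpos : 0 < ε := hpos
  have hc : ContinuousOn f (E ∩ Metric.ball (axisPoint (sideSign b * a)) ε) := by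
    cases b
    · simpa [sideSign] using hε.2
    · simpa [sideSign] using hε.1
  have := hc _ ⟨hE.axisPoint_mem b, Metric.mem_ball_self hpos⟩
  rw [ContinuousWithinAt, nhdsWithin_inter_of_mem'
    (mem_nhdsWithin_of_mem_nhds (Metric.ball_mem_nhds _ hpos))] at this
  exact this

theorem densityLaw_compl (hE : Admissible a ν g q E f) : densityLaw f Eᶜ = 0 := by
  rw [← hE.support_eq]; exact Measure.measure_compl_support

/-- Near the poles f is continuous only along E, and off E it vanishes only almost everywhere. The
indicator makes pointwise limits of the integrand available. -/
theorem densityLaw_apply (hE : Admissible a ν g q E f) {G : Set Plane} (hG : MeasurableSet G) :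
    densityLaw f G = ∫⁻ z in G, E.indicator (fun z => ENNReal.ofReal (f z)) z := by
  rw [setLIntegral_indicator hE.isClosed.measurableSet, inter_comm, ← withDensity_apply _
    (hG.inter hE.isClosed.measurableSet)]
  refine (measure_inter_conull hE.densityLaw_compl |>.symm.trans ?_)
  rfl

theorem rpow_mul_densityLaw (hE : Admissible a ν g q E f) (b : Bool) {r : ℝ} (hr : 0 < r)
    {c : Set (ℝ × ℝ)} (hc : MeasurableSet c) :
    ENNReal.ofReal (r ^ 3) * densityLaw f (poleMap a b r ⁻¹' c) =
      ∫⁻ x in c, E.indicator (fun z => ENNReal.ofReal (f z)) (polePoint a b r x) := by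
  have hG := measurable_poleMap a b r hc
  have hF : Measurable (E.indicator fun z => ENNReal.ofReal (f z)) :=
    hE.measurable_density.ennreal_ofReal.indicator hE.isClosed.measurableSet
  have hm := (continuous_polePoint a b r).measurable
  rw [hE.densityLaw_apply hG, ← lintegral_indicator hG, ← lintegral_indicator hc,
    ← smul_eq_mul]
  have hsm := lintegral_smul_measure (μ := (volume : Measure Plane)) (ENNReal.ofReal (r ^ 3))
    ((poleMap a b r ⁻¹' c).indicator (E.indicator fun z => ENNReal.ofReal (f z)))
  rw [← map_polePoint_volume a b hr, lintegral_map (hF.indicator hG) hm] at hsm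
  rw [← hsm]
  refine lintegral_congr fun x => ?_
  by_cases hx : x ∈ c
  · rw [indicator_of_mem hx, indicator_of_mem (by
      rw [mem_preimage, poleMap_polePoint a b hr]; exact hx)]
  · rw [indicator_of_notMem hx, indicator_of_notMem (by
      rw [mem_preimage, poleMap_polePoint a b hr]; exact hx)]

theorem eventually_mem (hE : Admissible a ν g q E f) (b : Bool) {x : ℝ × ℝ}
    (hx : x ∈ halfParabola a (q (topIdx b)) 1 ∪ halfParabola a (q (botIdx b)) (-1)) :
    ∀ᶠ r in atTop, polePoint a b r x ∈ E := by
  have hξ : 0 < x.1 := by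
    rcases hx with ⟨h1, h2⟩ | ⟨h1, h2⟩
    · by_contra! hle
      have : 0 ≤ a * q (topIdx b) ^ 2 / 2 := by have := hE.a_pos; positivity
      nlinarith [sq_nonneg x.2]
    · by_contra! hle
      have : 0 ≤ a * q (botIdx b) ^ 2 / 2 := by have := hE.a_pos; positivity
      nlinarith [sq_nonneg x.2]
  -- This keeps the opposite diminished boundary on its own side of the axis, so that it imposes no
  -- condition.
  have hsmall : ∀ᶠ δ in 𝓝[>] (0 : ℝ), ∀ i, δ < q i :=
    eventually_all.2 fun i => nhdsWithin_le_nhds (Iio_mem_nhds (hE.q_pos i))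
  have key : ∃ δ > 0, ∀ᶠ r : ℝ in atTop, 0 < r ∧
      -((q (botIdx b) - δ) * ellipseBoundary a (a - x.1 / r ^ 2)) < x.2 / r ∧
      x.2 / r < (q (topIdx b) - δ) * ellipseBoundary a (a - x.1 / r ^ 2) := by
    have hnn : ∀ y, 0 ≤ ellipseBoundary a y := fun y => by unfold ellipseBoundary; positivity
    rcases hx with ⟨h1, h2⟩ | ⟨h1, h2⟩
    · rw [one_mul] at h1
      obtain ⟨δ, ⟨hδ1, hδ2⟩, hδ0⟩ := (((eventually_lt_mul_ellipseBoundary (hE.q_pos _) h2).and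
        hsmall).and self_mem_nhdsWithin).exists
      refine ⟨δ, hδ0, ?_⟩
      filter_upwards [hδ1, eventually_gt_atTop 0] with r hr hr0
      refine ⟨hr0, ?_, hr⟩
      have : 0 < x.2 / r := by positivity
      have := mul_nonneg (sub_pos.2 (hδ2 (botIdx b))).le (hnn (a - x.1 / r ^ 2))
      linarith
    · have h1' : 0 < -x.2 := by linarith
      rw [← neg_sq] at h2
      obtain ⟨δ, ⟨hδ1, hδ2⟩, hδ0⟩ := (((eventually_lt_mul_ellipseBoundary (hE.q_pos _) h2).and
        hsmall).and self_mem_nhdsWithin).exists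
      refine ⟨δ, hδ0, ?_⟩
      filter_upwards [hδ1, eventually_gt_atTop 0] with r hr hr0
      rw [neg_div] at hr
      refine ⟨hr0, by linarith, ?_⟩
      have : 0 < -x.2 / r := by positivity
      rw [neg_div] at this
      have := mul_nonneg (sub_pos.2 (hδ2 (topIdx b))).le (hnn (a - x.1 / r ^ 2))
      linarith
  obtain ⟨δ, hδ, hev⟩ := key
  obtain ⟨ρ, hρ, hshape⟩ := hE.exists_inner_shape hδ
  have h1 : Tendsto (fun r : ℝ => x.1 / r ^ 2) atTop (𝓝 0) :=
    tendsto_const_nhds.div_atTop (tendsto_pow_atTop two_ne_zero)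
  filter_upwards [hev, h1.eventually_lt_const hρ] with r ⟨hr0, hr1, hr2⟩ hr3
  have hs : sideSign b * polePoint a b r x 0 = a - x.1 / r ^ 2 := by
    rw [polePoint_zero, ← mul_assoc, sideSign_mul_self, one_mul]
  have : 0 < x.1 / r ^ 2 := by positivity
  exact hshape b _ (by rw [hs]; linarith) (by rw [hs]; linarith) (by rw [hs]; exact hr1)
    (by rw [hs]; exact hr2)

theorem eventually_notMem (hE : Admissible a ν g q E f) (b : Bool) {x : ℝ × ℝ} (h0 : x.2 ≠ 0)
    (ht : x.2 ^ 2 ≠ a * q (topIdx b) ^ 2 / 2 * x.1) (hb : x.2 ^ 2 ≠ a * q (botIdx b) ^ 2 / 2 * x.1)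
    (hx : x ∉ halfParabola a (q (topIdx b)) 1 ∪ halfParabola a (q (botIdx b)) (-1)) :
    ∀ᶠ r in atTop, polePoint a b r x ∉ E := by
  simp only [mem_union, not_or, halfParabola, mem_ofPred_eq, not_and, not_lt] at hx
  have key : ∃ δ > 0, ∀ᶠ r : ℝ in atTop,
      x.2 / r < -((q (botIdx b) + δ) * ellipseBoundary a (a - x.1 / r ^ 2)) ∨
      (q (topIdx b) + δ) * ellipseBoundary a (a - x.1 / r ^ 2) < x.2 / r := by
    rcases lt_or_gt_of_ne h0 with h | h
    · have h' : 0 < -x.2 := by linarith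
      have hlt := lt_of_le_of_ne (hx.2 (by linarith)) hb.symm
      rw [← neg_sq x.2] at hlt
      obtain ⟨δ, hδ1, hδ0⟩ := ((eventually_mul_ellipseBoundary_lt (hE.q_pos _) h' hlt).and
        self_mem_nhdsWithin).exists
      refine ⟨δ, hδ0, ?_⟩
      filter_upwards [hδ1] with r hr
      rw [neg_div] at hr
      exact Or.inl (by linarith)
    · have hlt := lt_of_le_of_ne (hx.1 (by linarith)) ht.symm
      obtain ⟨δ, hδ1, hδ0⟩ := ((eventually_mul_ellipseBoundary_lt (hE.q_pos _) h hlt).and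
        self_mem_nhdsWithin).exists
      exact ⟨δ, hδ0, hδ1.mono fun r hr => Or.inr hr⟩
  obtain ⟨δ, hδ, hev⟩ := key
  obtain ⟨ρ, hρ, -, hshape⟩ := hE.exists_outer_shape hδ
  have h1 : Tendsto (fun r : ℝ => x.1 / r ^ 2) atTop (𝓝 0) :=
    tendsto_const_nhds.div_atTop (tendsto_pow_atTop two_ne_zero)
  filter_upwards [hev, h1.eventually_lt_const hρ] with r hr1 hr2 hmem
  have hs : sideSign b * polePoint a b r x 0 = a - x.1 / r ^ 2 := by
    rw [polePoint_zero, ← mul_assoc, sideSign_mul_self, one_mul]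
  obtain ⟨-, h3, h4⟩ := hshape b _ hmem (by rw [hs]; linarith)
  rw [hs, polePoint_one] at h3 h4
  rcases hr1 with h | h <;> linarith

/-- The expected number of points in a rescaled region near a pole converges. -/
theorem tendsto_rpow_mul_densityLaw (hE : Admissible a ν g q E f) (b : Bool) {c : Set (ℝ × ℝ)}
    (hc : MeasurableSet c) {K : ℝ} (hK : ∀ x ∈ c, |x.1| ≤ K ∧ |x.2| ≤ K) :
    Tendsto (fun r : ℝ => ENNReal.ofReal (r ^ 3) * densityLaw f (poleMap a b r ⁻¹' c)) atTop
      (𝓝 (ENNReal.ofReal (f (axisPoint (sideSign b * a))) *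
        (volume (c ∩ halfParabola a (q (topIdx b)) 1) +
          volume (c ∩ halfParabola a (q (botIdx b)) (-1))))) := by
  set P := axisPoint (sideSign b * a) with hP
  set R := halfParabola a (q (topIdx b)) 1 ∪ halfParabola a (q (botIdx b)) (-1) with hR
  have hF : Measurable (E.indicator fun z => ENNReal.ofReal (f z)) :=
    hE.measurable_density.ennreal_ofReal.indicator hE.isClosed.measurableSet
  have hRm : MeasurableSet R :=
    (measurableSet_halfParabola _ _ _).union (measurableSet_halfParabola _ _ _)
  have hdisj : Disjoint (c ∩ halfParabola a (q (topIdx b)) 1)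
      (c ∩ halfParabola a (q (botIdx b)) (-1)) := by
    refine Set.disjoint_left.2 fun x hx hx' => ?_
    have h1 : 0 < 1 * x.2 := hx.2.1
    have h2 : 0 < -1 * x.2 := hx'.2.1
    linarith
  have hlim : ENNReal.ofReal (f P) * (volume (c ∩ halfParabola a (q (topIdx b)) 1) +
      volume (c ∩ halfParabola a (q (botIdx b)) (-1))) =
      ∫⁻ x in c, R.indicator (fun _ => ENNReal.ofReal (f P)) x := by
    rw [← measure_union hdisj (hc.inter (measurableSet_halfParabola _ _ _)), ← inter_union_distrib_left,
      ← hR, setLIntegral_indicator hRm, setLIntegral_const, inter_comm]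
  rw [hlim]
  have hcfin : volume c ≠ ⊤ := by
    have hsub : c ⊆ Icc (-K) K ×ˢ Icc (-K) K := fun x hx =>
      ⟨abs_le.1 (hK x hx).1, abs_le.1 (hK x hx).2⟩
    exact ((measure_mono hsub).trans_lt (isCompact_Icc.prod isCompact_Icc).measure_lt_top).ne
  -- The rescaled bounded region shrinks to the pole uniformly, so continuity along E supplies a
  -- constant dominating function.
  have hbd : ∀ᶠ r : ℝ in atTop, ∀ x ∈ c,
      E.indicator (fun z => ENNReal.ofReal (f z)) (polePoint a b r x) ≤ ENNReal.ofReal (f P + 1) := by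
    have h := (hE.tendsto_density b).eventually_le_const (lt_add_one (f P))
    obtain ⟨ε, hε, hsub⟩ := Metric.mem_nhdsWithin_iff.1 h
    have h1 : Tendsto (fun r : ℝ => (K / r ^ 2) ^ 2 + (K / r) ^ 2) atTop (𝓝 (0 ^ 2 + 0 ^ 2)) :=
      ((tendsto_const_nhds.div_atTop (tendsto_pow_atTop two_ne_zero)).pow 2).add
        ((tendsto_const_nhds.div_atTop tendsto_id).pow 2)
    filter_upwards [h1.eventually_lt_const (show (0 : ℝ) ^ 2 + 0 ^ 2 < ε ^ 2 by
      have := sq_pos_of_pos hε; linarith), eventually_gt_atTop 0] with r hr hr0 x hx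
    refine indicator_apply_le' (fun hmem => ENNReal.ofReal_le_ofReal (hsub ⟨?_, hmem⟩))
      fun _ => bot_le
    rw [Metric.mem_ball]
    refine lt_of_pow_lt_pow_left₀ 2 hε.le (lt_of_le_of_lt ?_ hr)
    rw [Plane.dist_sq]
    have e0 : polePoint a b r x 0 - P 0 = -(sideSign b * (x.1 / r ^ 2)) := by
      simp [hP, axisPoint]; ring
    have e1 : polePoint a b r x 1 - P 1 = x.2 / r := by simp [hP, axisPoint]
    rw [e0, e1, neg_sq, mul_pow, sideSign_sq, one_mul]
    obtain ⟨k1, k2⟩ := hK x hx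
    refine add_le_add (sq_le_sq.2 ?_) (sq_le_sq.2 ?_)
    · rw [abs_div, abs_div, abs_of_pos (pow_pos hr0 2)]
      exact div_le_div_of_nonneg_right (k1.trans (le_abs_self K)) (by positivity)
    · rw [abs_div, abs_div, abs_of_pos hr0]
      exact div_le_div_of_nonneg_right (k2.trans (le_abs_self K)) (by positivity)
  have hmain := tendsto_lintegral_filter_of_dominated_convergence (μ := volume.restrict c)
    (l := (atTop : Filter ℝ))
    (F := fun r x => E.indicator (fun z => ENNReal.ofReal (f z)) (polePoint a b r x))
    (f := fun x => R.indicator (fun _ => ENNReal.ofReal (f P)) x)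
    (fun _ => ENNReal.ofReal (f P + 1))
    (Eventually.of_forall fun r => hF.comp (continuous_polePoint a b r).measurable)
    (hbd.mono fun r hr => (ae_restrict_iff' hc).2 (Eventually.of_forall hr))
    (by rw [lintegral_const, Measure.restrict_apply_univ]
        exact ENNReal.mul_ne_top ENNReal.ofReal_ne_top hcfin) ?_
  · refine hmain.congr' ?_
    filter_upwards [eventually_gt_atTop 0] with r hr
    exact (hE.rpow_mul_densityLaw b hr hc).symm
  · refine ae_restrict_of_ae ?_
    have n1 := measure_eq_zero_iff_ae_notMem.1 (volume_parabola_eq_zero 0)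
    have n2 := measure_eq_zero_iff_ae_notMem.1 (volume_parabola_eq_zero (a * q (topIdx b) ^ 2 / 2))
    have n3 := measure_eq_zero_iff_ae_notMem.1 (volume_parabola_eq_zero (a * q (botIdx b) ^ 2 / 2))
    filter_upwards [n1, n2, n3] with x h1 h2 h3
    simp only [zero_mul, pow_eq_zero_iff two_ne_zero] at h1 h2 h3
    by_cases hx : x ∈ R
    · rw [indicator_of_mem hx]
      have hmem := hE.eventually_mem b hx
      have ht : Tendsto (fun r => polePoint a b r x) atTop (𝓝[E] P) :=
        tendsto_nhdsWithin_iff.2 ⟨tendsto_polePoint a b x, hmem⟩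
      refine Tendsto.congr' ?_ (ENNReal.tendsto_ofReal ((hE.tendsto_density b).comp ht))
      filter_upwards [hmem] with r hr
      rw [indicator_of_mem hr]; rfl
    · rw [indicator_of_notMem hx]
      refine tendsto_const_nhds.congr' ?_
      filter_upwards [hE.eventually_notMem b h1 h2 h3 hx] with r hr
      rw [indicator_of_notMem hr]

end Admissible

/-! ### Convergence criteria -/

section Occupancy

variable {C Ω : Type*} [Fintype C]

open Classical in
/-- The set of cells that are hit. -/
def occupied (h : C → Set Ω) (ω : Ω) : Finset C := Finset.univ.filter fun c => ω ∈ h c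

theorem mem_occupied {h : C → Set Ω} {ω : Ω} {c : C} : c ∈ occupied h ω ↔ ω ∈ h c := by
  simp [occupied]

theorem biInter_compl_eq_occupied [DecidableEq C] (h : C → Set Ω) (B : Finset C) :
    (⋂ c ∈ Bᶜ, (h c)ᶜ) = {ω | occupied h ω ∈ B.powerset} := by
  ext ω
  simp only [mem_iInter, mem_compl_iff, Finset.mem_compl, mem_ofPred_eq, Finset.mem_powerset,
    Finset.subset_iff, mem_occupied]
  exact forall_congr' fun c => not_imp_not

variable [MeasurableSpace Ω]

theorem measurableSet_occupied_eq {h : C → Set Ω} (hm : ∀ c, MeasurableSet (h c)) (B : Finset C) :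
    MeasurableSet {ω | occupied h ω = B} := by
  have : {ω | occupied h ω = B} = ⋂ c, {ω | ω ∈ h c ↔ c ∈ B} := by
    ext ω; simp [Finset.ext_iff, mem_occupied]
  rw [this]
  refine MeasurableSet.iInter fun c => ?_
  by_cases hc : c ∈ B
  · simp only [hc, iff_true]; exact hm c
  · simp only [hc, iff_false]; exact (hm c).compl

theorem measureReal_occupied_mem (μ : Measure Ω) [IsFiniteMeasure μ] {h : C → Set Ω}
    (hm : ∀ c, MeasurableSet (h c)) (S : Finset (Finset C)) :
    μ.real {ω | occupied h ω ∈ S} = ∑ B ∈ S, μ.real {ω | occupied h ω = B} := by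
  rw [← measureReal_biUnion_finset (fun B _ B' _ hne => Set.disjoint_left.2
    fun ω h1 h2 => hne (h1.symm.trans h2)) fun B _ => measurableSet_occupied_eq hm B]
  congr 1
  ext ω; simp

variable {Ω' : Type*} [MeasurableSpace Ω']

/-- Convergence of void probabilities implies convergence of the law of the set of hit cells. -/
theorem tendsto_measureReal_occupied {P : Measure Ω} [IsProbabilityMeasure P] {P' : Measure Ω'}
    [IsProbabilityMeasure P'] {h : ℕ → C → Set Ω} {h' : C → Set Ω'}
    (hm : ∀ n c, MeasurableSet (h n c)) (hm' : ∀ c, MeasurableSet (h' c))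
    (hvoid : ∀ A : Finset C, Tendsto (fun n => P.real (⋂ c ∈ A, (h n c)ᶜ)) atTop
      (𝓝 (P'.real (⋂ c ∈ A, (h' c)ᶜ)))) (S : Finset (Finset C)) :
    Tendsto (fun n => P.real {ω | occupied (h n) ω ∈ S}) atTop
      (𝓝 (P'.real {ω | occupied h' ω ∈ S})) := by
  classical
  simp_rw [measureReal_occupied_mem P (hm _), measureReal_occupied_mem P' hm']
  refine tendsto_finsetSum _ fun B hB => ?_
  clear hB
  -- The void probability of the complement of B is the sum, over all subsets of B, of the
  -- probabilities of being the occupied set; the proper subsets are known by induction and are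
  -- subtracted.
  induction B using Finset.strongInduction with
  | H B ih =>
    have h1 := hvoid Bᶜ
    have hsum : ∀ u : Finset C → ℝ, ∑ B' ∈ B.powerset, u B' =
        u B + ∑ B' ∈ B.powerset.erase B, u B' := fun u =>
      (Finset.add_sum_erase _ u (Finset.mem_powerset_self B)).symm
    simp_rw [biInter_compl_eq_occupied, measureReal_occupied_mem P (hm _),
      measureReal_occupied_mem P' hm', hsum] at h1
    have h2 := tendsto_finsetSum (B.powerset.erase B) fun B' hB' => ih B' (by
      rw [Finset.mem_erase, Finset.mem_powerset] at hB'
      exact Finset.ssubset_iff_subset_ne.2 ⟨hB'.2, hB'.1⟩)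
    simpa using h1.sub h2

end Occupancy

/-- Void probabilities of binomial processes. -/
theorem tendsto_measureReal_forall_notMem {Ω 𝓧 : Type*} [MeasurableSpace Ω] [MeasurableSpace 𝓧]
    {P : Measure Ω} [IsProbabilityMeasure P] {μ : Measure 𝓧} {X : ℕ → Ω → 𝓧}
    (hX : iIndepFun X P) (hlaw : ∀ i, HasLaw (X i) μ P) {G : ℕ → Set 𝓧}
    (hG : ∀ n, MeasurableSet (G n)) {t : ℝ}
    (h : Tendsto (fun n : ℕ => (n : ℝ) * μ.real (G n)) atTop (𝓝 t)) :
    Tendsto (fun n : ℕ => P.real {ω | ∀ i < n, X i ω ∉ G n}) atTop (𝓝 (Real.exp (-t))) := by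
  have hμ : IsProbabilityMeasure μ := (hlaw 0).isProbabilityMeasure_iff.1 inferInstance
  have hpow : ∀ n : ℕ, (1 + -μ.real (G n)) ^ n = P.real {ω | ∀ i < n, X i ω ∉ G n} := fun n => by
    have := hX.measure_inter_preimage_eq_mul (Finset.range n) (sets := fun _ => (G n)ᶜ)
      fun _ _ => (hG n).compl
    have heq : {ω | ∀ i < n, X i ω ∉ G n} = ⋂ i ∈ Finset.range n, X i ⁻¹' (G n)ᶜ := by
      ext ω; simp
    rw [← sub_eq_add_neg, ← probReal_compl_eq_one_sub (hG n), heq, measureReal_def P, this,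
      ENNReal.toReal_prod]
    have hi : ∀ i, P (X i ⁻¹' (G n)ᶜ) = μ (G n)ᶜ := fun i =>
      (hlaw i).measure_eq (p := fun x => x ∈ (G n)ᶜ) (hG n).compl
    simp only [hi, Finset.prod_const, Finset.card_range, Measure.real]
  refine (Real.tendsto_one_add_pow_exp_of_tendsto (g := fun n => -μ.real (G n)) ?_).congr hpow
  simpa using h.neg

/-- Convergence in distribution of real random variables from asymptotic bounds on the
distribution functions. -/
theorem tendstoInDistribution_of_cdf_bounds {Ω Ω' : Type*} [MeasurableSpace Ω]
    [MeasurableSpace Ω'] {P : Measure Ω} [IsProbabilityMeasure P] {P' : Measure Ω'}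
    [IsProbabilityMeasure P'] {Y : ℕ → Ω → ℝ} {L : Ω' → ℝ} (hY : ∀ n, AEMeasurable (Y n) P)
    (hL : AEMeasurable L P')
    (hupper : ∀ s t, s < t → ∀ ε > 0, ∀ᶠ n in atTop, P.real {ω | Y n ω ≤ s} ≤
      P'.real {ω | L ω < t} + ε)
    (hlower : ∀ s t, s < t → ∀ ε > 0, ∀ᶠ n in atTop, P'.real {ω | L ω < s} - ε ≤
      P.real {ω | Y n ω ≤ t}) :
    TendstoInDistribution Y atTop L (fun _ => P) P' := by
  refine ⟨hY, hL, ?_⟩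
  have hprob : IsProbabilityMeasure (P'.map L) := Measure.isProbabilityMeasure_map hL
  have hprobY : ∀ n, IsProbabilityMeasure (P.map (Y n)) := fun n =>
    Measure.isProbabilityMeasure_map (hY n)
  set F := cdf (P'.map L) with hF
  have hFle : ∀ t, P'.real {ω | L ω ≤ t} = F t := fun t => by
    rw [hF, cdf_eq_real, map_measureReal_apply_of_aemeasurable hL measurableSet_Iic]; rfl
  set G : Set ℝ := {t | ContinuousAt F t} with hG
  have hdense : Dense G := by
    have := (monotone_cdf (P'.map L)).countable_not_continuousAt
    have h2 := this.dense_compl ℝ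
    convert h2 using 1
    ext t; simp [hG, hF]
  have hconv : ∀ t ∈ G, Tendsto (fun n => (P.map (Y n)).real (Iic t)) atTop
      (𝓝 ((P'.map L).real (Iic t))) := fun t ht => by
    have hYle : ∀ n, (P.map (Y n)).real (Iic t) = P.real {ω | Y n ω ≤ t} := fun n =>
      map_measureReal_apply_of_aemeasurable (hY n) measurableSet_Iic
    rw [← cdf_eq_real, Metric.tendsto_atTop']
    intro ε hε
    obtain ⟨δ, hδ, hball⟩ := Metric.continuousAt_iff.1 (show ContinuousAt F t from ht) (ε / 2)
      (by linarith)
    have hr : F (t + δ / 2) < F t + ε / 2 := by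
      have := hball (x := t + δ / 2) (by
        rw [Real.dist_eq, abs_lt]; constructor <;> linarith)
      rw [Real.dist_eq] at this
      linarith [(abs_lt.1 this).2]
    have hl : F t - ε / 2 < F (t - δ / 2) := by
      have := hball (x := t - δ / 2) (by
        rw [Real.dist_eq, abs_lt]; constructor <;> linarith)
      rw [Real.dist_eq] at this
      linarith [(abs_lt.1 this).1]
    have hu := hupper t (t + δ / 2) (by linarith) (ε / 4) (by linarith)
    have hlo := hlower (t - δ / 4) t (by linarith) (ε / 4) (by linarith)
    have e1 : P'.real {ω | L ω < t + δ / 2} ≤ F (t + δ / 2) := by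
      rw [← hFle]; exact measureReal_mono fun ω (hω : L ω < t + δ / 2) => hω.le
    have e2 : F (t - δ / 2) ≤ P'.real {ω | L ω < t - δ / 4} := by
      rw [← hFle]
      exact measureReal_mono fun ω (hω : L ω ≤ t - δ / 2) =>
        show L ω < t - δ / 4 by linarith
    obtain ⟨N, hN⟩ := eventually_atTop.1 (hu.and hlo)
    refine ⟨N, fun n hn => ?_⟩
    obtain ⟨h1, h2⟩ := hN n hn.le
    rw [hYle, Real.dist_eq, abs_lt]
    constructor <;> linarith
  -- Continuity points of the limit are dense, so half-open intervals with such endpoints form a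
  -- π-system that contains small neighbourhoods of every point; convergence on it suffices.
  refine (isPiSystem_Ioc_mem G G).tendsto_probabilityMeasure_of_tendsto_of_mem ?_ ?_ ?_
  · rintro _ ⟨l, -, u, -, -, rfl⟩; exact measurableSet_Ioc
  · intro U hU x hx
    obtain ⟨ε, hε, hball⟩ := Metric.isOpen_iff.1 hU x hx
    obtain ⟨l, hl, hl1, hl2⟩ := hdense.exists_between (show x - ε < x by linarith)
    obtain ⟨u, hu, hu1, hu2⟩ := hdense.exists_between (show x < x + ε by linarith)
    refine ⟨Ioc l u, ⟨l, hl, u, hu, hl2.trans hu1, rfl⟩, Ioc_mem_nhds hl2 hu1, fun y hy => ?_⟩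
    refine hball ?_
    rw [Metric.mem_ball, Real.dist_eq, abs_lt]
    constructor <;> linarith [hy.1, hy.2]
  · rintro _ ⟨l, hl, u, hu, hlu, rfl⟩
    rw [← NNReal.tendsto_coe]
    have hdiff : ∀ (ρ : Measure ℝ) [IsProbabilityMeasure ρ],
        ρ.real (Ioc l u) = ρ.real (Iic u) - ρ.real (Iic l) := fun ρ _ => by
      rw [← measureReal_sdiff (Iic_subset_Iic.2 hlu.le) measurableSet_Iic]
      congr 1
      ext x; simp [and_comm]
    have := (hconv u hu).sub (hconv l hl)
    rw [← hdiff] at this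
    exact this.congr fun n => (hdiff (P.map (Y n))).symm

/-! ### Distances of points near opposite poles -/

/-- The horizontal separation is 2a - u/r² with u the sum of the first rescaled coordinates. Working
with the squared distance keeps the expansion exact, with u²/r² as the only error. -/
theorem dist_sq_eq_gapCost {a r : ℝ} (ha : 0 < a) (hr : 0 < r) (z w : Plane) :
    r ^ 2 * (4 * a ^ 2 - dist z w ^ 2) =
      4 * a * gapCost a (poleMap a true r z) (poleMap a false r w) -
        ((poleMap a true r z).1 + (poleMap a false r w).1) ^ 2 / r ^ 2 := by
  rw [Plane.dist_sq]
  simp only [gapCost, poleMap, sideSign, if_true, Bool.false_eq_true, if_false]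
  field_simp
  ring

/-- A small rescaled cost forces a large distance. -/
theorem eventually_le_dist {a s t : ℝ} (ha : 0 < a) (hst : s < t) :
    ∀ᶠ r : ℝ in atTop, ∀ z w : Plane,
      gapCost a (poleMap a true r z) (poleMap a false r w) < s → 2 * a - t / r ^ 2 ≤ dist z w := by
  have h0 : ∀ c : ℝ, Tendsto (fun r : ℝ => c / r ^ 2) atTop (𝓝 0) := fun c =>
    tendsto_const_nhds.div_atTop (tendsto_pow_atTop two_ne_zero)
  have hpos : 0 < 4 * a * (t - s) := mul_pos (by linarith) (by linarith)
  filter_upwards [eventually_gt_atTop 0, (h0 (t ^ 2)).eventually_lt_const hpos] with r hr h1 z w hG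
  by_contra! hlt
  have hd : dist z w ^ 2 < (2 * a - t / r ^ 2) ^ 2 := pow_lt_pow_left₀ hlt dist_nonneg two_ne_zero
  have hid := dist_sq_eq_gapCost ha hr z w
  set u := (poleMap a true r z).1 + (poleMap a false r w).1
  have hu : 0 ≤ u ^ 2 / r ^ 2 := by positivity
  have h2 : r ^ 2 * (4 * a ^ 2 - (2 * a - t / r ^ 2) ^ 2) = 4 * a * t - t ^ 2 / r ^ 2 := by
    field_simp; ring
  have h3 := mul_lt_mul_of_pos_left hd (pow_pos hr 2)
  nlinarith

/-- A bound on the rescaled positions of points of the support near a pole. -/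
theorem poleMap_bounds {a κ ρ r : ℝ} {E : Set Plane} (hκ0 : 0 ≤ κ)
    (hflat : ∀ b, ∀ z ∈ E, a - ρ < sideSign b * z 0 → sideSign b * z 0 ≤ a ∧
      z 1 ^ 2 ≤ κ * (a ^ 2 - z 0 ^ 2)) (b : Bool) {z : Plane} (hz : z ∈ E)
    (hzρ : a - ρ < sideSign b * z 0) :
    0 ≤ (poleMap a b r z).1 ∧ (poleMap a b r z).2 ^ 2 ≤ 2 * a * κ * (poleMap a b r z).1 := by
  obtain ⟨h1, h2⟩ := hflat b z hz hzρ
  have hsq : z 0 ^ 2 = (sideSign b * z 0) ^ 2 := by rw [mul_pow, sideSign_sq, one_mul]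
  simp only [poleMap]
  refine ⟨mul_nonneg (sq_nonneg r) (by linarith), ?_⟩
  rw [hsq] at h2
  set y := sideSign b * z 0
  have h3 : a ^ 2 - y ^ 2 ≤ 2 * a * (a - y) := by nlinarith [sq_nonneg (a - y)]
  calc (r * z 1) ^ 2 = r ^ 2 * z 1 ^ 2 := by ring
    _ ≤ r ^ 2 * (κ * (2 * a * (a - y))) := by
      refine mul_le_mul_of_nonneg_left (h2.trans ?_) (sq_nonneg r)
      exact mul_le_mul_of_nonneg_left h3 hκ0
    _ = _ := by ring

/-- Flatness gives `gapCost` ≥ (1 - κ)u with u = x.1 + y.1. While u ≤ 2r²a(1 - κ), the error u²/r²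
eats at most half of 4a(1 - κ)u, so the remaining half bounds u. -/
theorem window_of_dist {a κ r s d : ℝ} (ha : 0 < a) (hκ : κ < 1) (hr : 0 < r) {x y : ℝ × ℝ}
    (hid : r ^ 2 * (4 * a ^ 2 - d ^ 2) = 4 * a * gapCost a x y - (x.1 + y.1) ^ 2 / r ^ 2)
    (hd : 2 * a - s / r ^ 2 ≤ d) (hs : s / r ^ 2 < 2 * a)
    (hx : 0 ≤ x.1 ∧ x.2 ^ 2 ≤ 2 * a * κ * x.1) (hy : 0 ≤ y.1 ∧ y.2 ^ 2 ≤ 2 * a * κ * y.1)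
    (hxy : x.1 + y.1 ≤ 2 * (r ^ 2 * (a * (1 - κ)))) :
    x.1 + y.1 ≤ 2 * |s| / (1 - κ) ∧
      4 * a * gapCost a x y ≤ 4 * a * s + (x.1 + y.1) ^ 2 / r ^ 2 := by
  have hG0 : 4 * a * gapCost a x y = 4 * a * (x.1 + y.1) - (x.2 - y.2) ^ 2 := by
    unfold gapCost; field_simp
  have hu0 : 0 ≤ x.1 + y.1 := add_nonneg hx.1 hy.1
  have hv : (x.2 - y.2) ^ 2 ≤ 4 * a * κ * (x.1 + y.1) := by
    have e1 : (x.2 - y.2) ^ 2 ≤ 2 * (x.2 ^ 2 + y.2 ^ 2) := by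
      linarith [sq_nonneg (x.2 + y.2), add_sq x.2 y.2, sub_sq x.2 y.2]
    linarith [hx.2, hy.2]
  have hd2 : (2 * a - s / r ^ 2) ^ 2 ≤ d ^ 2 := pow_le_pow_left₀ (by linarith) hd 2
  have h2 : r ^ 2 * (4 * a ^ 2 - (2 * a - s / r ^ 2) ^ 2) = 4 * a * s - s ^ 2 / r ^ 2 := by
    field_simp; ring
  have h3 : r ^ 2 * (4 * a ^ 2 - d ^ 2) ≤ r ^ 2 * (4 * a ^ 2 - (2 * a - s / r ^ 2) ^ 2) :=
    mul_le_mul_of_nonneg_left (by linarith) (sq_nonneg r)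
  have h4 : 0 ≤ s ^ 2 / r ^ 2 := by positivity
  have hG : 4 * a * gapCost a x y ≤ 4 * a * s + (x.1 + y.1) ^ 2 / r ^ 2 := by linarith
  refine ⟨?_, hG⟩
  set u := x.1 + y.1
  have hur : u ^ 2 / r ^ 2 ≤ 2 * a * (1 - κ) * u := by
    rw [div_le_iff₀ (by positivity), sq u]
    calc u * u ≤ 2 * (r ^ 2 * (a * (1 - κ))) * u := mul_le_mul_of_nonneg_right hxy hu0
      _ = _ := by ring
  rw [le_div_iff₀ (by linarith)]
  have h5 : 2 * a * (u * (1 - κ)) ≤ 2 * a * (2 * s) := by linarith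
  have h6 := le_of_mul_le_mul_left h5 (by positivity)
  linarith [le_abs_self s]

namespace Admissible

variable {a ν : ℝ} {g : Fin 4 → ℝ → ℝ} {q : Fin 4 → ℝ} {E : Set Plane} {f : Plane → ℝ}

/-- A large distance forces a small rescaled cost, at bounded rescaled positions. -/
theorem exists_window (hE : Admissible a ν g q E f) {s t : ℝ} (hst : s < t) :
    ∃ K, ∀ᶠ r : ℝ in atTop, ∀ z ∈ E, ∀ w ∈ E, 2 * a - s / r ^ 2 ≤ dist z w →
      ∃ z' w', ((z' = z ∧ w' = w) ∨ (z' = w ∧ w' = z)) ∧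
        (|(poleMap a true r z').1| ≤ K ∧ |(poleMap a true r z').2| ≤ K) ∧
        (|(poleMap a false r w').1| ≤ K ∧ |(poleMap a false r w').2| ≤ K) ∧
        gapCost a (poleMap a true r z') (poleMap a false r w') < t := by
  have ha := hE.a_pos
  obtain ⟨κ, hκ, hκ0, ρ₀, hρ₀, hflat₀⟩ := hE.exists_flat_shape
  have hκ1 : 0 < 1 - κ := by linarith
  set ρ := min ρ₀ a with hρdef
  have hρ : 0 < ρ := lt_min hρ₀ ha
  have hflat : ∀ b, ∀ z ∈ E, a - ρ < sideSign b * z 0 → sideSign b * z 0 ≤ a ∧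
      z 1 ^ 2 ≤ κ * (a ^ 2 - z 0 ^ 2) := fun b z hz h =>
    hflat₀ b z hz (by linarith [min_le_left ρ₀ a])
  -- The first bound places the points where the support is flat, the second meets the size
  -- condition of `window_of_dist`.
  set ε := min ρ (a * (1 - κ)) with hεdef
  have hε : 0 < ε := lt_min hρ (by positivity)
  obtain ⟨δ, hδ, hnear⟩ := hE.exists_near_poles hε
  set K₁ := 2 * |s| / (1 - κ) with hK₁
  have hK₁0 : 0 ≤ K₁ := by positivity
  -- K₁ bounds the first coordinates; the squared second ones are at most m = 2aκK₁, and v² ≤ m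
  -- implies |v| ≤ m + 1.
  set K := K₁ + (2 * a * κ * K₁ + 1) with hK
  have hKK : 0 ≤ 2 * a * κ * K₁ := by positivity
  have h0 : ∀ c : ℝ, Tendsto (fun r : ℝ => c / r ^ 2) atTop (𝓝 0) := fun c =>
    tendsto_const_nhds.div_atTop (tendsto_pow_atTop two_ne_zero)
  have hpos : 0 < 4 * a * (t - s) := mul_pos (by linarith) (by linarith)
  have key : ∀ r : ℝ, 0 < r → K₁ ^ 2 / r ^ 2 < 4 * a * (t - s) → s / r ^ 2 < 2 * a →
      ∀ z ∈ E, ∀ w ∈ E, 2 * a - s / r ^ 2 ≤ dist z w →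
      dist z (axisPoint a) < ε → dist w (axisPoint (-a)) < ε →
        (|(poleMap a true r z).1| ≤ K ∧ |(poleMap a true r z).2| ≤ K) ∧
        (|(poleMap a false r w).1| ≤ K ∧ |(poleMap a false r w).2| ≤ K) ∧
        gapCost a (poleMap a true r z) (poleMap a false r w) < t := by
    intro r hr hr1 hr2 z hz w hw hd hza hwa
    have hcoord : ∀ (u v : Plane), |u 0 - v 0| ≤ dist u v := fun u v => by
      refine abs_le_of_sq_le_sq ?_ dist_nonneg
      rw [Plane.dist_sq]; nlinarith [sq_nonneg (u 1 - v 1)]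
    have hz0 : a - ε < sideSign true * z 0 := by
      have := abs_le.1 (hcoord z (axisPoint a))
      simp only [axisPoint] at this hza
      simp [sideSign] at this ⊢
      linarith
    have hw0 : a - ε < sideSign false * w 0 := by
      have := abs_le.1 (hcoord w (axisPoint (-a)))
      simp only [axisPoint] at this hwa
      simp [sideSign] at this ⊢
      linarith
    have hερ : ε ≤ ρ := min_le_left _ _
    have hεκ : ε ≤ a * (1 - κ) := min_le_right _ _
    obtain ⟨hx1, hx2⟩ := poleMap_bounds (r := r) hκ0 hflat true hz (by linarith)
    obtain ⟨hy1, hy2⟩ := poleMap_bounds (r := r) hκ0 hflat false hw (by linarith)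
    have hu1 : (poleMap a true r z).1 ≤ r ^ 2 * ε :=
      mul_le_mul_of_nonneg_left (by linarith) (sq_nonneg r)
    have hu2 : (poleMap a false r w).1 ≤ r ^ 2 * ε :=
      mul_le_mul_of_nonneg_left (by linarith) (sq_nonneg r)
    have hid := dist_sq_eq_gapCost ha hr z w
    have hεr := mul_le_mul_of_nonneg_left hεκ (sq_nonneg r)
    obtain ⟨huK, hG⟩ := window_of_dist ha hκ hr hid hd hr2 ⟨hx1, hx2⟩ ⟨hy1, hy2⟩ (by linarith)
    have hu0 := add_nonneg hx1 hy1
    set x := poleMap a true r z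
    set y := poleMap a false r w
    set u := x.1 + y.1 with hu
    have hbd : ∀ p : ℝ × ℝ, 0 ≤ p.1 → p.2 ^ 2 ≤ 2 * a * κ * p.1 → p.1 ≤ K₁ →
        |p.1| ≤ K ∧ |p.2| ≤ K := fun p hp1 hp2 hpK => by
      refine ⟨by rw [abs_of_nonneg hp1]; linarith, ?_⟩
      have h5 : p.2 ^ 2 ≤ 2 * a * κ * K₁ :=
        hp2.trans (mul_le_mul_of_nonneg_left hpK (by positivity))
      have h6 : |p.2| ≤ 2 * a * κ * K₁ + 1 :=
        abs_le_of_sq_le_sq (by nlinarith) (by linarith)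
      linarith
    refine ⟨hbd x hx1 hx2 (by linarith), hbd y hy1 hy2 (by linarith), ?_⟩
    have h7 : u ^ 2 / r ^ 2 ≤ K₁ ^ 2 / r ^ 2 :=
      div_le_div_of_nonneg_right (pow_le_pow_left₀ hu0 huK 2) (by positivity)
    have h8 : 4 * a * gapCost a x y < 4 * a * t := by linarith
    exact lt_of_mul_lt_mul_left h8 (by positivity)
  refine ⟨K, ?_⟩
  filter_upwards [eventually_gt_atTop 0, (h0 (K₁ ^ 2)).eventually_lt_const hpos,
    (h0 s).eventually_lt_const (show 0 < 2 * a by linarith), (h0 s).eventually_lt_const hδ]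
    with r hr hr1 hr2 hr3 z hz w hw hd
  rcases hnear z hz w hw (by linarith) with ⟨h1, h2⟩ | ⟨h1, h2⟩
  · exact ⟨z, w, Or.inl ⟨rfl, rfl⟩, key r hr hr1 hr2 z hz w hw hd h1 h2⟩
  · exact ⟨w, z, Or.inr ⟨rfl, rfl⟩, key r hr hr1 hr2 w hw z hz (by rwa [dist_comm]) h1 h2⟩

end Admissible

/-- Bounded rescaled positions in the limit process. -/
theorem polarPoint_window {a t τ ε δ : ℝ} (ha : 0 < a) (hε : ε ^ 2 = 1) (hδ : δ ^ 2 = 1)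
    {z w : ℝ × ℝ} (hz : 0 ≤ z.1) (hw : 0 ≤ w.1) (hz2 : z.2 ^ 2 ≤ τ * z.1)
    (hτ : 0 ≤ τ) (ht : gapCost a (polarPoint a ε z) (polarPoint a δ w) < t) :
    |(polarPoint a ε z).1| ≤ t + a * τ * t + a ^ 2 * τ * t + 1 ∧
      |(polarPoint a ε z).2| ≤ t + a * τ * t + a ^ 2 * τ * t + 1 := by
  rw [gapCost_polarPoint a ε δ hε hδ] at ht
  have h0 : 0 ≤ a / 4 * (z.2 + ε * δ * w.2) ^ 2 := by positivity
  have hzt : z.1 ≤ t := by linarith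
  have ht0 : 0 ≤ t := by linarith
  have h1 : z.2 ^ 2 ≤ τ * t := hz2.trans (mul_le_mul_of_nonneg_left hzt hτ)
  have h2 : 0 ≤ a * τ * t := by positivity
  have h3 : 0 ≤ a ^ 2 * τ * t := by positivity
  have h4 := mul_le_mul_of_nonneg_left h1 ha.le
  simp only [polarPoint]
  constructor
  · rw [abs_of_nonneg (by positivity)]
    nlinarith
  · have h5 := mul_le_mul_of_nonneg_left h1 (sq_nonneg a)
    have h6 : |ε * a * z.2| ≤ a ^ 2 * τ * t + 1 := by
      refine abs_le_of_sq_le_sq ?_ (by linarith)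
      rw [mul_pow, mul_pow, hε]
      nlinarith
    linarith

/-! ### Grid cells -/

/-- The index of the grid cell of mesh `1 / N` containing a point. -/
def cellIndex (N : ℕ) (x : ℝ × ℝ) : ℤ × ℤ := (⌊(N : ℝ) * x.1⌋, ⌊(N : ℝ) * x.2⌋)

theorem measurable_cellIndex (N : ℕ) : Measurable (cellIndex N) :=
  (Int.measurable_floor.comp (measurable_fst.const_mul _)).prodMk
    (Int.measurable_floor.comp (measurable_snd.const_mul _))

theorem abs_sub_le_of_floor_eq {N : ℕ} (hN : 0 < N) {x y : ℝ}
    (h : ⌊(N : ℝ) * x⌋ = ⌊(N : ℝ) * y⌋) : |x - y| ≤ 1 / N := by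
  have hN' : (0 : ℝ) < N := Nat.cast_pos.2 hN
  have := (Int.abs_sub_lt_one_of_floor_eq_floor h).le
  rwa [← mul_sub, abs_mul, abs_of_pos hN', ← le_div_iff₀' hN'] at this

theorem gapCost_le_of_cellIndex_eq {a K η : ℝ} (ha : 0 < a) (hK : 0 ≤ K) (hη : 0 < η) :
    ∃ N : ℕ, 0 < N ∧ ∀ x y x' y' : ℝ × ℝ, |x.2| ≤ K → |y.2| ≤ K →
      cellIndex N x = cellIndex N x' → cellIndex N y = cellIndex N y' →
      gapCost a x' y' ≤ gapCost a x y + η := by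
  -- With mesh m = 1/N ≤ 1, the abscissae contribute at most 2m. The difference of squares factors
  -- into terms of size at most 2m and 4K + 2.
  obtain ⟨N, hN⟩ := exists_nat_gt ((2 + 2 * (4 * K + 2) / (4 * a)) / η)
  have hN0 : (0 : ℝ) < N := lt_of_le_of_lt (by positivity) hN
  have hNpos : 0 < N := Nat.cast_pos.1 hN0
  refine ⟨N, hNpos, fun x y x' y' hx hy hxx hyy => ?_⟩
  rw [div_lt_iff₀ hη, ← div_lt_iff₀' hN0] at hN
  simp only [cellIndex, Prod.mk.injEq] at hxx hyy
  have a1 := abs_le.1 (abs_sub_le_of_floor_eq hNpos hxx.1)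
  have a2 := abs_le.1 (abs_sub_le_of_floor_eq hNpos hxx.2)
  have b1 := abs_le.1 (abs_sub_le_of_floor_eq hNpos hyy.1)
  have b2 := abs_le.1 (abs_sub_le_of_floor_eq hNpos hyy.2)
  have hx' := abs_le.1 hx
  have hy' := abs_le.1 hy
  have hN1 : 1 / (N : ℝ) ≤ 1 := by
    rw [div_le_one hN0]; exact_mod_cast hNpos
  have hNi : 0 < 1 / (N : ℝ) := by positivity
  set m := 1 / (N : ℝ) with hm
  have hN' : 2 * m + 2 * m * (4 * K + 2) / (4 * a) < η := by
    have : 2 * m + 2 * m * (4 * K + 2) / (4 * a) = (2 + 2 * (4 * K + 2) / (4 * a)) / N := by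
      rw [hm]; field_simp
    rw [this]; exact hN
  have hv : (x.2 - y.2) ^ 2 - (x'.2 - y'.2) ^ 2 ≤ 2 * m * (4 * K + 2) := by
    have e1 : |(x.2 - y.2) - (x'.2 - y'.2)| ≤ 2 * m := abs_le.2 ⟨by linarith, by linarith⟩
    have e2 : |(x.2 - y.2) + (x'.2 - y'.2)| ≤ 4 * K + 2 := abs_le.2 ⟨by linarith, by linarith⟩
    calc _ = ((x.2 - y.2) - (x'.2 - y'.2)) * ((x.2 - y.2) + (x'.2 - y'.2)) := by ring
      _ ≤ |(x.2 - y.2) - (x'.2 - y'.2)| * |(x.2 - y.2) + (x'.2 - y'.2)| := by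
        rw [← abs_mul]; exact le_abs_self _
      _ ≤ _ := mul_le_mul e1 e2 (abs_nonneg _) (by positivity)
  have hv' : (x.2 - y.2) ^ 2 / (4 * a) - (x'.2 - y'.2) ^ 2 / (4 * a) ≤
      2 * m * (4 * K + 2) / (4 * a) := by
    rw [← sub_div]; exact div_le_div_of_nonneg_right hv (by positivity)
  unfold gapCost
  linarith

/-- The indices of the cells in a window. -/
abbrev CellWindow (M : ℤ) : Type := ↥(Finset.Icc (-M) M ×ˢ Finset.Icc (-M) M)

theorem exists_cellWindow (N : ℕ) (K : ℝ) : ∃ M : ℤ, ∀ x : ℝ × ℝ, |x.1| ≤ K → |x.2| ≤ K →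
    cellIndex N x ∈ Finset.Icc (-M) M ×ˢ Finset.Icc (-M) M := by
  refine ⟨⌈(N : ℝ) * K⌉ + 1, fun x h1 h2 => ?_⟩
  have key : ∀ y : ℝ, |y| ≤ K → ⌊(N : ℝ) * y⌋ ∈ Finset.Icc (-(⌈(N : ℝ) * K⌉ + 1)) (⌈(N : ℝ) * K⌉ + 1) :=
    fun y hy => by
      have hy' := abs_le.1 hy
      have hc := Int.le_ceil ((N : ℝ) * K)
      have e1 := mul_le_mul_of_nonneg_left hy'.1 (Nat.cast_nonneg N : (0 : ℝ) ≤ N)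
      have e2 := mul_le_mul_of_nonneg_left hy'.2 (Nat.cast_nonneg N : (0 : ℝ) ≤ N)
      rw [Finset.mem_Icc]
      constructor
      · rw [Int.le_floor]; push_cast; linarith
      · have := Int.floor_le ((N : ℝ) * y)
        have h3 : (⌊(N : ℝ) * y⌋ : ℝ) ≤ ((⌈(N : ℝ) * K⌉ + 1 : ℤ) : ℝ) := by push_cast; linarith
        exact_mod_cast h3
  exact Finset.mem_product.2 ⟨key _ h1, key _ h2⟩

theorem abs_le_of_cellIndex_mem {N : ℕ} (hN : 0 < N) {M : ℤ} {x : ℝ × ℝ}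
    (hx : cellIndex N x ∈ Finset.Icc (-M) M ×ˢ Finset.Icc (-M) M) :
    |x.1| ≤ |(M : ℝ)| + 1 ∧ |x.2| ≤ |(M : ℝ)| + 1 := by
  have hN' : (1 : ℝ) ≤ N := by exact_mod_cast hN
  have key : ∀ y : ℝ, ⌊(N : ℝ) * y⌋ ∈ Finset.Icc (-M) M → |y| ≤ |(M : ℝ)| + 1 := fun y hy => by
    rw [Finset.mem_Icc] at hy
    have h1 : (-(M : ℝ)) ≤ ⌊(N : ℝ) * y⌋ := by exact_mod_cast hy.1
    have h2 : (⌊(N : ℝ) * y⌋ : ℝ) ≤ M := by exact_mod_cast hy.2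
    have h3 := Int.floor_le ((N : ℝ) * y)
    have h4 := Int.lt_floor_add_one ((N : ℝ) * y)
    have h5 := le_abs_self (M : ℝ)
    have h6 : |(N : ℝ) * y| ≤ |(M : ℝ)| + 1 := abs_le.2 ⟨by linarith, by linarith⟩
    rw [abs_mul, Nat.abs_cast] at h6
    nlinarith [abs_nonneg y]
  obtain ⟨h1, h2⟩ := Finset.mem_product.1 hx
  exact ⟨key _ h1, key _ h2⟩

/-! ### Void probabilities near the poles -/

/-- The pole adjacent to a quadrant: `true` for the right one, `false` for the left one. -/
def sideOf : Fin 4 → Bool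
  | 0 => true
  | 1 => false
  | 2 => false
  | 3 => true

theorem rightSign_eq_one_iff_sideOf {i : Fin 4} : rightSign i = 1 ↔ sideOf i = true := by
  fin_cases i <;> norm_num [rightSign, sideOf]

theorem rightSign_eq_neg_one_iff_sideOf {i : Fin 4} : rightSign i = -1 ↔ sideOf i = false := by
  fin_cases i <;> norm_num [rightSign, sideOf]

/-- The mass that the limiting Poisson processes of the four quadrants give to a set of points
at either pole. -/
def limitMass (a : ℝ) (q : Fin 4 → ℝ) (f : Plane → ℝ) (S : Bool → Set (ℝ × ℝ)) : ℝ :=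
  ∑ i, poleDensity a f i *
    (volume (S (sideOf i) ∩ halfParabola a (q i) (upSign i))).toReal

theorem volume_ne_top_of_abs_le {c : Set (ℝ × ℝ)} {K : ℝ}
    (hK : ∀ x ∈ c, |x.1| ≤ K ∧ |x.2| ≤ K) : volume c ≠ ⊤ := by
  have hsub : c ⊆ Icc (-K) K ×ˢ Icc (-K) K := fun x hx =>
    ⟨abs_le.1 (hK x hx).1, abs_le.1 (hK x hx).2⟩
  exact ((isCompact_Icc.prod isCompact_Icc).measure_lt_top.trans_le' (measure_mono hsub)).ne

/-- For large r the two windows lie in opposite half planes, so their masses add. -/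
theorem disjoint_preimage_poleMap {a r K : ℝ} (hr : K < r ^ 2 * a) {S : Bool → Set (ℝ × ℝ)}
    (hK : ∀ b, ∀ x ∈ S b, |x.1| ≤ K ∧ |x.2| ≤ K) :
    Disjoint (poleMap a true r ⁻¹' S true) (poleMap a false r ⁻¹' S false) := by
  refine Set.disjoint_left.2 fun z h1 h2 => ?_
  have e1 := (abs_le.1 (hK _ _ h1).1).2
  have e2 := (abs_le.1 (hK _ _ h2).1).2
  simp only [poleMap, sideSign, if_true, Bool.false_eq_true, if_false] at e1 e2
  linarith

namespace Admissible

variable {a ν : ℝ} {g : Fin 4 → ℝ → ℝ} {q : Fin 4 → ℝ} {E : Set Plane} {f : Plane → ℝ}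

theorem tendsto_rpow_mul_densityLaw_real (hE : Admissible a ν g q E f) (b : Bool)
    {c : Set (ℝ × ℝ)} (hc : MeasurableSet c) {K : ℝ} (hK : ∀ x ∈ c, |x.1| ≤ K ∧ |x.2| ≤ K) :
    Tendsto (fun r => r ^ 3 * (densityLaw f).real (poleMap a b r ⁻¹' c)) atTop
      (𝓝 (f (axisPoint (sideSign b * a)) *
        ((volume (c ∩ halfParabola a (q (topIdx b)) 1)).toReal +
          (volume (c ∩ halfParabola a (q (botIdx b)) (-1))).toReal))) := by
  have hfin : ∀ s, volume (c ∩ s) ≠ ⊤ := fun s =>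
    ne_top_of_le_ne_top (volume_ne_top_of_abs_le hK) (measure_mono inter_subset_left)
  have h := (ENNReal.tendsto_toReal (ENNReal.mul_ne_top ENNReal.ofReal_ne_top
    (ENNReal.add_ne_top.2 ⟨hfin _, hfin _⟩))).comp (hE.tendsto_rpow_mul_densityLaw b hc hK)
  rw [ENNReal.toReal_mul, ENNReal.toReal_ofReal (hE.density_nonneg _),
    ENNReal.toReal_add (hfin _) (hfin _)] at h
  refine h.congr' ?_
  filter_upwards [eventually_ge_atTop 0] with r hr
  simp only [Function.comp_apply]
  rw [ENNReal.toReal_mul, ENNReal.toReal_ofReal (by positivity), Measure.real]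

theorem tendsto_rpow_mul_densityLaw_iUnion (hE : Admissible a ν g q E f)
    [IsProbabilityMeasure (densityLaw f)] {S : Bool → Set (ℝ × ℝ)}
    (hS : ∀ b, MeasurableSet (S b)) {K : ℝ} (hK : ∀ b, ∀ x ∈ S b, |x.1| ≤ K ∧ |x.2| ≤ K) :
    Tendsto (fun r => r ^ 3 * (densityLaw f).real (⋃ b, poleMap a b r ⁻¹' S b)) atTop
      (𝓝 (limitMass a q f S)) := by
  have h := (hE.tendsto_rpow_mul_densityLaw_real true (hS true) (hK true)).add
    (hE.tendsto_rpow_mul_densityLaw_real false (hS false) (hK false))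
  have hlim : limitMass a q f S = f (axisPoint (sideSign true * a)) *
        ((volume (S true ∩ halfParabola a (q (topIdx true)) 1)).toReal +
          (volume (S true ∩ halfParabola a (q (botIdx true)) (-1))).toReal) +
      f (axisPoint (sideSign false * a)) *
        ((volume (S false ∩ halfParabola a (q (topIdx false)) 1)).toReal +
          (volume (S false ∩ halfParabola a (q (botIdx false)) (-1))).toReal) := by
    simp only [limitMass, Fin.sum_univ_four, poleDensity, poleAbscissa, sideOf, upSign, topIdx,
      botIdx, sideSign, if_true, Bool.false_eq_true, if_false, one_mul, neg_one_mul]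
    ring
  rw [hlim]
  refine h.congr' ?_
  have hr : Tendsto (fun r : ℝ => r ^ 2 * a) atTop atTop :=
    (tendsto_pow_atTop two_ne_zero).atTop_mul_const hE.a_pos
  filter_upwards [hr.eventually_gt_atTop K] with r hr
  have hun : (⋃ b, poleMap a b r ⁻¹' S b) =
      poleMap a true r ⁻¹' S true ∪ poleMap a false r ⁻¹' S false := by
    ext z; simp [Set.mem_iUnion, Bool.exists_bool, or_comm]
  rw [hun, measureReal_union (disjoint_preimage_poleMap hr hK)
    (measurable_poleMap a false r (hS false)), mul_add]

variable {Ω : Type*} [MeasurableSpace Ω] {P : Measure Ω} [IsProbabilityMeasure P]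
  {X : ℕ → Ω → Plane}

theorem tendsto_void (hE : Admissible a ν g q E f) (hX : iIndepFun X P)
    (hlaw : ∀ i, HasLaw (X i) (densityLaw f) P) {S : Bool → Set (ℝ × ℝ)}
    (hS : ∀ b, MeasurableSet (S b)) {K : ℝ} (hK : ∀ b, ∀ x ∈ S b, |x.1| ≤ K ∧ |x.2| ≤ K) :
    Tendsto (fun n : ℕ => P.real {ω | ∀ i < n, X i ω ∉
      ⋃ b, poleMap a b ((n : ℝ) ^ (1 / 3 : ℝ)) ⁻¹' S b}) atTop
      (𝓝 (Real.exp (-limitMass a q f S))) := by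
  have : IsProbabilityMeasure (densityLaw f) := (hlaw 0).isProbabilityMeasure_iff.1 inferInstance
  refine tendsto_measureReal_forall_notMem hX hlaw
    (fun n => MeasurableSet.iUnion fun b => measurable_poleMap a b _ (hS b)) ?_
  have hr : Tendsto (fun n : ℕ => (n : ℝ) ^ (1 / 3 : ℝ)) atTop atTop :=
    (tendsto_rpow_atTop (by norm_num)).comp tendsto_natCast_atTop_atTop
  refine ((hE.tendsto_rpow_mul_densityLaw_iUnion hS hK).comp hr).congr fun n => ?_
  simp only [Function.comp_apply]
  rw [← Real.rpow_natCast, ← Real.rpow_mul (Nat.cast_nonneg n)]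
  norm_num

variable {Ω' : Type*} [MeasurableSpace Ω'] {P' : Measure Ω'} {Z : Fin 4 → Ω' → ℕ → ℝ × ℝ}

/-- By independence the void probability is a product over the quadrants, and the exponents add up
to `limitMass`. -/
theorem limit_void (hE : Admissible a ν g q E f) (hZ : iIndepFun Z P')
    (hlaw : ∀ i, HasLaw (Z i) (normAngleLaw (sigmaConst a (poleDensity a f i) (q i))
      (tauConst a (q i))) P') {S : Bool → Set (ℝ × ℝ)}
    (hS : ∀ b, MeasurableSet (S b)) {K : ℝ} (hK : ∀ b, ∀ x ∈ S b, |x.1| ≤ K ∧ |x.2| ≤ K) :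
    P'.real {ω | ∀ i m, polarPoint a (upSign i) (Z i ω m) ∉ S (sideOf i)} =
      Real.exp (-limitMass a q f S) := by
  have hm : ∀ i, MeasurableSet
      {z : ℕ → ℝ × ℝ | ∀ m, polarPoint a (upSign i) (z m) ∉ S (sideOf i)} := fun i => by
    rw [ofPred_forall]
    exact MeasurableSet.iInter fun m =>
      ((measurable_polarPoint a _).comp (measurable_pi_apply m) (hS _)).compl
  have h1 := hZ.measure_inter_preimage_eq_mul Finset.univ fun i _ => hm i
  have h2 : {ω | ∀ i m, polarPoint a (upSign i) (Z i ω m) ∉ S (sideOf i)} =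
      ⋂ i ∈ Finset.univ, Z i ⁻¹'
        {z : ℕ → ℝ × ℝ | ∀ m, polarPoint a (upSign i) (z m) ∉ S (sideOf i)} := by
    ext ω; simp
  rw [h2, Measure.real, h1, ENNReal.toReal_prod, limitMass, ← Finset.sum_neg_distrib,
    Real.exp_sum]
  refine Finset.prod_congr rfl fun i _ => ?_
  rw [← Measure.map_apply_of_aemeasurable (hlaw i).aemeasurable (hm i), (hlaw i).map_eq]
  -- The extra 1 makes the bound strict.
  exact measure_void_normAngleLaw (K := K + 1) hE.a_pos (hE.density_pole_pos i) (hE.q_pos i)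
    (hE.q_lt i) (upSign_sq i) (hS _) fun z hz => by linarith [le_abs_self z.1, (hK _ z hz).1]

end Admissible

/-! ### Occupied cells -/

section Cells

variable {Ω : Type*}

/-- The event that one of the first `n` points, rescaled at a pole, lies in a given cell. -/
def sampleHit (a : ℝ) (X : ℕ → Ω → Plane) (N : ℕ) (M : ℤ) (n : ℕ) (c : Bool × CellWindow M) :
    Set Ω :=
  {ω | ∃ i < n, cellIndex N (poleMap a c.1 ((n : ℝ) ^ (1 / 3 : ℝ)) (X i ω)) = c.2}

/-- The event that one of the points of the limit process lies in a given cell. -/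
def limitHit (a : ℝ) (Z : Fin 4 → Ω → ℕ → ℝ × ℝ) (N : ℕ) (M : ℤ) (c : Bool × CellWindow M) :
    Set Ω :=
  {ω | ∃ i, sideOf i = c.1 ∧ ∃ m, cellIndex N (polarPoint a (upSign i) (Z i ω m)) = c.2}

/-- The union of the cells in `A` at the pole `b`. -/
def cellUnion (N : ℕ) {M : ℤ} (A : Finset (Bool × CellWindow M)) (b : Bool) : Set (ℝ × ℝ) :=
  {x | ∃ c ∈ A, c.1 = b ∧ cellIndex N x = c.2}

theorem measurableSet_cellUnion (N : ℕ) {M : ℤ} (A : Finset (Bool × CellWindow M)) (b : Bool) :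
    MeasurableSet (cellUnion N A b) :=
  measurable_cellIndex N
    (MeasurableSet.of_discrete (s := {k | ∃ c ∈ A, c.1 = b ∧ k = (c.2 : ℤ × ℤ)}))

theorem abs_le_of_mem_cellUnion {N : ℕ} (hN : 0 < N) {M : ℤ} {A : Finset (Bool × CellWindow M)}
    {b : Bool} {x : ℝ × ℝ} (hx : x ∈ cellUnion N A b) :
    |x.1| ≤ |(M : ℝ)| + 1 ∧ |x.2| ≤ |(M : ℝ)| + 1 := by
  obtain ⟨c, -, -, hc⟩ := hx
  exact abs_le_of_cellIndex_mem hN (hc ▸ c.2.2)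

variable [MeasurableSpace Ω]

theorem measurableSet_sampleHit {a : ℝ} {X : ℕ → Ω → Plane} (hX : ∀ i, Measurable (X i)) (N : ℕ)
    (M : ℤ) (n : ℕ) (c : Bool × CellWindow M) : MeasurableSet (sampleHit a X N M n c) := by
  have : sampleHit a X N M n c = ⋃ i, ⋃ (_ : i < n),
      {ω | cellIndex N (poleMap a c.1 ((n : ℝ) ^ (1 / 3 : ℝ)) (X i ω)) = c.2} := by
    ext ω; simp [sampleHit]
  rw [this]
  exact MeasurableSet.iUnion fun i => MeasurableSet.iUnion fun _ =>
    ((measurable_cellIndex N).comp ((measurable_poleMap a _ _).comp (hX i)))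
      (measurableSet_singleton _)

theorem measurableSet_limitHit {a : ℝ} {Z : Fin 4 → Ω → ℕ → ℝ × ℝ} (hZ : ∀ i, Measurable (Z i))
    (N : ℕ) (M : ℤ) (c : Bool × CellWindow M) : MeasurableSet (limitHit a Z N M c) := by
  have : limitHit a Z N M c = ⋃ i, ⋃ (_ : sideOf i = c.1), ⋃ m,
      {ω | cellIndex N (polarPoint a (upSign i) (Z i ω m)) = c.2} := by
    ext ω; simp [limitHit]
  rw [this]
  exact MeasurableSet.iUnion fun i => MeasurableSet.iUnion fun _ => MeasurableSet.iUnion fun m =>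
    ((measurable_cellIndex N).comp ((measurable_polarPoint a _).comp
      ((measurable_pi_apply m).comp (hZ i)))) (measurableSet_singleton _)

/-- Leaving a set of cells empty has limiting probability exp(-`limitMass`) for the sample and
exactly this probability for the limit process. -/
theorem Admissible.tendsto_occupied {a ν : ℝ} {g : Fin 4 → ℝ → ℝ} {q : Fin 4 → ℝ} {E : Set Plane}
    {f : Plane → ℝ} (hE : Admissible a ν g q E f) {P : Measure Ω} [IsProbabilityMeasure P]
    {X : ℕ → Ω → Plane} (hXm : ∀ i, Measurable (X i)) (hX : iIndepFun X P)
    (hXlaw : ∀ i, HasLaw (X i) (densityLaw f) P)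
    {Ω' : Type*} [MeasurableSpace Ω'] {P' : Measure Ω'} [IsProbabilityMeasure P']
    {Z : Fin 4 → Ω' → ℕ → ℝ × ℝ} (hZm : ∀ i, Measurable (Z i)) (hZ : iIndepFun Z P')
    (hZlaw : ∀ i, HasLaw (Z i) (normAngleLaw (sigmaConst a (poleDensity a f i) (q i))
      (tauConst a (q i))) P') {N : ℕ} (hN : 0 < N) (M : ℤ)
    (F : Finset (Finset (Bool × CellWindow M))) :
    Tendsto (fun n => P.real {ω | occupied (sampleHit a X N M n) ω ∈ F}) atTop
      (𝓝 (P'.real {ω | occupied (limitHit a Z N M) ω ∈ F})) := by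
  refine tendsto_measureReal_occupied (measurableSet_sampleHit hXm N M)
    (measurableSet_limitHit hZm N M) (fun A => ?_) F
  have hS := measurableSet_cellUnion N A
  have hK : ∀ b, ∀ x ∈ cellUnion N A b, |x.1| ≤ |(M : ℝ)| + 1 ∧ |x.2| ≤ |(M : ℝ)| + 1 :=
    fun b x hx => abs_le_of_mem_cellUnion hN hx
  have e1 : ∀ n : ℕ, (⋂ c ∈ A, (sampleHit a X N M n c)ᶜ) = {ω | ∀ i < n, X i ω ∉
      ⋃ b, poleMap a b ((n : ℝ) ^ (1 / 3 : ℝ)) ⁻¹' cellUnion N A b} := fun n => by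
    ext ω
    simp only [mem_iInter, mem_compl_iff, sampleHit, cellUnion, mem_ofPred_eq, mem_iUnion,
      mem_preimage]
    constructor
    · rintro h i hi ⟨b, c, hc, rfl, hcb⟩
      exact h c hc ⟨i, hi, hcb⟩
    · rintro h c hc ⟨i, hi, hcb⟩
      exact h i hi ⟨c.1, c, hc, rfl, hcb⟩
  have e2 : (⋂ c ∈ A, (limitHit a Z N M c)ᶜ) =
      {ω | ∀ i m, polarPoint a (upSign i) (Z i ω m) ∉ cellUnion N A (sideOf i)} := by
    ext ω
    simp only [mem_iInter, mem_compl_iff, limitHit, cellUnion, mem_ofPred_eq]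
    constructor
    · rintro h i m ⟨c, hc, hci, hcm⟩
      exact h c hc ⟨i, hci.symm, m, hcm⟩
    · rintro h c hc ⟨i, hi, m, hcm⟩
      exact h i m ⟨c, hc, hi.symm, hcm⟩
  simp_rw [e1, e2, hE.limit_void hZ hZlaw hS hK]
  exact hE.tendsto_void hX hXlaw hS hK

/-- The sets of cells that contain a pair of opposite cells holding points of small cost. -/
def closePairs (a : ℝ) (N : ℕ) (M : ℤ) (K s : ℝ) : Finset (Finset (Bool × CellWindow M)) := by
  classical
  exact Finset.univ.filter fun B => ∃ c ∈ B, ∃ c' ∈ B, c.1 = true ∧ c'.1 = false ∧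
    ∃ x y : ℝ × ℝ, (|x.2| ≤ K ∧ |y.2| ≤ K) ∧
      (cellIndex N x = c.2 ∧ cellIndex N y = c'.2) ∧ gapCost a x y < s

theorem mem_closePairs {a : ℝ} {N : ℕ} {M : ℤ} {K s : ℝ} {B : Finset (Bool × CellWindow M)} :
    B ∈ closePairs a N M K s ↔ ∃ c ∈ B, ∃ c' ∈ B, c.1 = true ∧ c'.1 = false ∧
      ∃ x y : ℝ × ℝ, (|x.2| ≤ K ∧ |y.2| ≤ K) ∧
        (cellIndex N x = c.2 ∧ cellIndex N y = c'.2) ∧ gapCost a x y < s := by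
  simp [closePairs]

end Cells

/-! ### Cost bounds from occupied cells -/

/-- An occupied cell locates its point only up to the mesh, hence the loss η. The converse
`mem_closePairs_of_gapCost_lt` loses nothing. -/
theorem gapCost_lt_of_closePairs_sample {Ω : Type*} {a K s η : ℝ} {N : ℕ} {M : ℤ} {n : ℕ}
    {X : ℕ → Ω → Plane}
    (hN : ∀ x y x' y' : ℝ × ℝ, |x.2| ≤ K → |y.2| ≤ K → cellIndex N x = cellIndex N x' →
      cellIndex N y = cellIndex N y' → gapCost a x' y' ≤ gapCost a x y + η) {ω : Ω}
    (h : occupied (sampleHit a X N M n) ω ∈ closePairs a N M K s) :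
    ∃ i < n, ∃ j < n, gapCost a (poleMap a true ((n : ℝ) ^ (1 / 3 : ℝ)) (X i ω))
      (poleMap a false ((n : ℝ) ^ (1 / 3 : ℝ)) (X j ω)) < s + η := by
  obtain ⟨⟨b, c⟩, hc, ⟨b', c'⟩, hc', rfl, rfl, x, y, ⟨hx, hy⟩, ⟨hxc, hyc⟩, hxy⟩ :=
    mem_closePairs.1 h
  obtain ⟨i, hi, hic⟩ := mem_occupied.1 hc
  obtain ⟨j, hj, hjc⟩ := mem_occupied.1 hc'
  exact ⟨i, hi, j, hj, (hN x y _ _ hx hy (hxc.trans hic.symm) (hyc.trans hjc.symm)).trans_lt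
    (by linarith)⟩

theorem gapCost_lt_of_closePairs_limit {Ω : Type*} {a K s η : ℝ} {N : ℕ} {M : ℤ}
    {Z : Fin 4 → Ω → ℕ → ℝ × ℝ}
    (hN : ∀ x y x' y' : ℝ × ℝ, |x.2| ≤ K → |y.2| ≤ K → cellIndex N x = cellIndex N x' →
      cellIndex N y = cellIndex N y' → gapCost a x' y' ≤ gapCost a x y + η) {ω : Ω}
    (h : occupied (limitHit a Z N M) ω ∈ closePairs a N M K s) :
    ∃ i j, rightSign i = 1 ∧ rightSign j = -1 ∧ ∃ k l,
      gapCost a (polarPoint a (upSign i) (Z i ω k)) (polarPoint a (upSign j) (Z j ω l)) <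
        s + η := by
  obtain ⟨⟨b, c⟩, hc, ⟨b', c'⟩, hc', rfl, rfl, x, y, ⟨hx, hy⟩, ⟨hxc, hyc⟩, hxy⟩ :=
    mem_closePairs.1 h
  obtain ⟨i, hi, k, hk⟩ := mem_occupied.1 hc
  obtain ⟨j, hj, l, hl⟩ := mem_occupied.1 hc'
  exact ⟨i, j, rightSign_eq_one_iff_sideOf.2 hi, rightSign_eq_neg_one_iff_sideOf.2 hj, k, l,
    (hN x y _ _ hx hy (hxc.trans hk.symm) (hyc.trans hl.symm)).trans_lt (by linarith)⟩

theorem mem_closePairs_of_gapCost_lt {a K s : ℝ} {N : ℕ} {M : ℤ} {B : Finset (Bool × CellWindow M)}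
    {x y : ℝ × ℝ} (hM : ∀ x : ℝ × ℝ, |x.1| ≤ K → |x.2| ≤ K →
      cellIndex N x ∈ Finset.Icc (-M) M ×ˢ Finset.Icc (-M) M)
    (hx : |x.1| ≤ K ∧ |x.2| ≤ K) (hy : |y.1| ≤ K ∧ |y.2| ≤ K)
    (hxB : (true, ⟨cellIndex N x, hM x hx.1 hx.2⟩) ∈ B)
    (hyB : (false, ⟨cellIndex N y, hM y hy.1 hy.2⟩) ∈ B) (h : gapCost a x y < s) :
    B ∈ closePairs a N M K s :=
  mem_closePairs.2 ⟨_, hxB, _, hyB, rfl, rfl, x, y, ⟨hx.2, hy.2⟩, ⟨rfl, rfl⟩, h⟩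

/-! ### The maximum interpoint distance -/

theorem le_maxDist_iff {x : ℕ → Plane} {n : ℕ} (hn : 2 ≤ n) {c : ℝ} :
    c ≤ maxDist x n ↔ ∃ i j, i < j ∧ j < n ∧ c ≤ dist (x i) (x j) := by
  have : Nonempty {p : Fin n × Fin n // p.1 < p.2} :=
    ⟨⟨(⟨0, by omega⟩, ⟨1, by omega⟩), by simp [Fin.lt_def]⟩⟩
  constructor
  · intro h
    obtain ⟨p, hp⟩ := exists_eq_ciSup_of_finite
      (f := fun p : {p : Fin n × Fin n // p.1 < p.2} => dist (x p.1.1) (x p.1.2))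
    exact ⟨p.1.1, p.1.2, p.2, p.1.2.2, h.trans_eq hp.symm⟩
  · rintro ⟨i, j, hij, hj, h⟩
    exact h.trans (le_ciSup
      (f := fun p : {p : Fin n × Fin n // p.1 < p.2} => dist (x p.1.1) (x p.1.2))
      (Set.finite_range _).bddAbove ⟨(⟨i, hij.trans hj⟩, ⟨j, hj⟩), hij⟩)

theorem rpow_third_sq (n : ℕ) : ((n : ℝ) ^ (1 / 3 : ℝ)) ^ 2 = (n : ℝ) ^ (2 / 3 : ℝ) := by
  rw [← Real.rpow_natCast, ← Real.rpow_mul (Nat.cast_nonneg n)]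
  norm_num

theorem rescaled_maxDist_le_iff {a s : ℝ} {x : ℕ → Plane} {n : ℕ} (hn : 2 ≤ n) :
    (n : ℝ) ^ (2 / 3 : ℝ) * (2 * a - maxDist x n) ≤ s ↔
      ∃ i j, i < j ∧ j < n ∧ 2 * a - s / ((n : ℝ) ^ (1 / 3 : ℝ)) ^ 2 ≤ dist (x i) (x j) := by
  have hn0 : 0 < (n : ℝ) ^ (2 / 3 : ℝ) := Real.rpow_pos_of_pos (by positivity) _
  rw [← le_maxDist_iff hn, rpow_third_sq, ← le_div_iff₀' hn0, sub_le_comm]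

theorem measurable_maxDist {Ω : Type*} [MeasurableSpace Ω] {X : ℕ → Ω → Plane}
    (hX : ∀ i, Measurable (X i)) (n : ℕ) : Measurable fun ω => maxDist (fun i => X i ω) n :=
  Measurable.iSup fun _ => (hX _).dist (hX _)

theorem measurable_limitMin {Ω : Type*} [MeasurableSpace Ω] {Z : Fin 4 → Ω → ℕ → ℝ × ℝ}
    (hZ : ∀ i, Measurable (Z i)) (a : ℝ) : Measurable fun ω => limitMin a fun i => Z i ω := by
  have h : ∀ i k, Measurable fun ω => Z i ω k := fun i k => (measurable_pi_apply k).comp (hZ i)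
  have h1 : ∀ i k, Measurable fun ω => (Z i ω k).1 := fun i k => (h i k).fst
  have h2 : ∀ i k, Measurable fun ω => (Z i ω k).2 := fun i k => (h i k).snd
  have hs : ∀ i j, Measurable fun ω => minSum a (Z i ω) (Z j ω) := fun i j =>
    Measurable.iInf fun p => ((h1 i _).add (h1 j _)).add
      ((((h2 i _).add (h2 j _)).pow_const 2).const_mul _)
  have hd : ∀ i j, Measurable fun ω => minDiff a (Z i ω) (Z j ω) := fun i j =>
    Measurable.iInf fun p => ((h1 i _).add (h1 j _)).add
      ((((h2 i _).sub (h2 j _)).pow_const 2).const_mul _)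
  exact ((hs _ _).min (hd _ _)).min ((hd _ _).min (hs _ _))

/-! ### Convergence of the maximum interpoint distance -/

namespace Admissible

variable {a ν : ℝ} {g : Fin 4 → ℝ → ℝ} {q : Fin 4 → ℝ} {E : Set Plane} {f : Plane → ℝ}
  {Ω : Type*} [MeasurableSpace Ω] {P : Measure Ω} {X : ℕ → Ω → Plane}
  {Ω' : Type*} [MeasurableSpace Ω'] {P' : Measure Ω'} {Z : Fin 4 → Ω' → ℕ → ℝ × ℝ}

theorem ae_mem (hE : Admissible a ν g q E f) (hXlaw : ∀ i, HasLaw (X i) (densityLaw f) P) :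
    ∀ᵐ ω ∂P, ∀ i, X i ω ∈ E := by
  refine ae_all_iff.2 fun i => ae_of_ae_map (hXlaw i).aemeasurable ?_
  rw [(hXlaw i).map_eq]
  exact hE.densityLaw_compl

theorem ae_normAngle (hE : Admissible a ν g q E f)
    (hZlaw : ∀ i, HasLaw (Z i) (normAngleLaw (sigmaConst a (poleDensity a f i) (q i))
      (tauConst a (q i))) P') :
    ∀ᵐ ω ∂P', ∀ i, (∀ m, 0 ≤ (Z i ω m).1 ∧
      (Z i ω m).2 ^ 2 ≤ tauConst a (q i) ^ 2 * (Z i ω m).1) ∧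
        Tendsto (fun m => (Z i ω m).1) atTop atTop := by
  refine ae_all_iff.2 fun i => ae_of_ae_map (p := fun z : ℕ → ℝ × ℝ => (∀ m, 0 ≤ (z m).1 ∧
    (z m).2 ^ 2 ≤ tauConst a (q i) ^ 2 * (z m).1) ∧ Tendsto (fun m => (z m).1) atTop atTop)
    (hZlaw i).aemeasurable ?_
  rw [(hZlaw i).map_eq]
  filter_upwards [ae_normAngleLaw hE.a_pos (hE.density_pole_pos i) (hE.q_pos i) (hE.q_lt i)]
    with z hz using ⟨hz.1, hz.2.2⟩

theorem tendstoInDistribution_of_measurable (hE : Admissible a ν g q E f)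
    [IsProbabilityMeasure P] (hXm : ∀ i, Measurable (X i)) (hX : iIndepFun X P)
    (hXlaw : ∀ i, HasLaw (X i) (densityLaw f) P) [IsProbabilityMeasure P']
    (hZm : ∀ i, Measurable (Z i)) (hZ : iIndepFun Z P')
    (hZlaw : ∀ i, HasLaw (Z i) (normAngleLaw (sigmaConst a (poleDensity a f i) (q i))
      (tauConst a (q i))) P') :
    TendstoInDistribution
      (fun (n : ℕ) ω => (n : ℝ) ^ (2 / 3 : ℝ) * (2 * a - maxDist (fun i => X i ω) n)) atTop
      (fun ω => limitMin a (fun i => Z i ω)) (fun _ => P) P' := by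
  have ha := hE.a_pos
  have hr : Tendsto (fun n : ℕ => (n : ℝ) ^ (1 / 3 : ℝ)) atTop atTop :=
    (tendsto_rpow_atTop (by norm_num)).comp tendsto_natCast_atTop_atTop
  have hXE := hE.ae_mem hXlaw
  have hZ0 := hE.ae_normAngle hZlaw
  refine tendstoInDistribution_of_cdf_bounds
    (fun n => (((measurable_maxDist hXm n).const_sub _).const_mul _).aemeasurable)
    (measurable_limitMin hZm a).aemeasurable ?_ ?_
  -- A large distance at level s gives a sample pair of cost below (s + t)/2 in the window, hence a
  -- close pair of occupied cells. In the limit these cells give a pair of cost below t. One half of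
  -- the slack pays for the distance, the other for the mesh.
  · intro s t hst ε hε
    obtain ⟨K₀, hK₀⟩ := hE.exists_window (show s < (s + t) / 2 by linarith)
    set K := max K₀ 0
    obtain ⟨N, hN0, hN⟩ := gapCost_le_of_cellIndex_eq (η := (t - s) / 2) ha
      (le_max_right K₀ 0) (by linarith)
    obtain ⟨M, hM⟩ := exists_cellWindow N K
    have hlim := hE.tendsto_occupied hXm hX hXlaw hZm hZ hZlaw hN0 M
      (closePairs a N M K ((s + t) / 2))
    have hle : P'.real {ω | occupied (limitHit a Z N M) ω ∈ closePairs a N M K ((s + t) / 2)} ≤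
        P'.real {ω | limitMin a (fun i => Z i ω) < t} := by
      refine ENNReal.toReal_mono (measure_ne_top _ _) (measure_mono_ae ?_)
      filter_upwards [hZ0] with ω hω h
      refine (limitMin_lt_iff ha fun i m => ((hω i).1 m).1).2 ?_
      obtain ⟨i, j, hi, hj, k, l, hkl⟩ := gapCost_lt_of_closePairs_limit hN h
      exact ⟨i, j, hi, hj, k, l, by linarith⟩
    filter_upwards [hlim.eventually_lt_const (lt_add_of_pos_right _ hε), hr.eventually hK₀,
      eventually_ge_atTop 2] with n hn hn2 hn3
    refine le_trans ?_ (hn.le.trans (add_le_add_left hle ε))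
    refine ENNReal.toReal_mono (measure_ne_top _ _) (measure_mono_ae ?_)
    filter_upwards [hXE] with ω hω h
    obtain ⟨i, j, hij, hj, hd⟩ := (rescaled_maxDist_le_iff hn3).1 h
    obtain ⟨z', w', hzw, hz', hw', hcost⟩ := hn2 _ (hω i) _ (hω j) hd
    have hKmono : ∀ {u : ℝ}, u ≤ K₀ → u ≤ K := fun h => h.trans (le_max_left _ _)
    obtain ⟨i', j', hi', hj', rfl, rfl⟩ : ∃ i' j', i' < n ∧ j' < n ∧ z' = X i' ω ∧ w' = X j' ω := by
      rcases hzw with ⟨h1, h2⟩ | ⟨h1, h2⟩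
      · exact ⟨i, j, hij.trans hj, hj, h1, h2⟩
      · exact ⟨j, i, hj, hij.trans hj, h1, h2⟩
    exact mem_closePairs_of_gapCost_lt hM ⟨hKmono hz'.1, hKmono hz'.2⟩
      ⟨hKmono hw'.1, hKmono hw'.2⟩ (mem_occupied.2 ⟨i', hi', rfl⟩)
      (mem_occupied.2 ⟨j', hj', rfl⟩) hcost
  -- The same chain in reverse: a limit pair of cost below s, close occupied cells, a sample pair of
  -- cost below (s + t)/2, a large distance at level t.
  · intro s t hst ε hε
    set τ := ∑ i, tauConst a (q i) ^ 2
    have hτ : ∀ i, tauConst a (q i) ^ 2 ≤ τ := fun i =>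
      Finset.single_le_sum (f := fun i => tauConst a (q i) ^ 2) (fun i _ => sq_nonneg _)
        (Finset.mem_univ i)
    have hτ0 : 0 ≤ τ := (sq_nonneg _).trans (hτ 0)
    set K := max (s + a * τ * s + a ^ 2 * τ * s + 1) 0
    obtain ⟨N, hN0, hN⟩ := gapCost_le_of_cellIndex_eq (K := K) (η := (t - s) / 2) ha
      (le_max_right _ 0) (by linarith)
    obtain ⟨M, hM⟩ := exists_cellWindow N K
    have hlim := hE.tendsto_occupied hXm hX hXlaw hZm hZ hZlaw hN0 M (closePairs a N M K s)
    have hle : P'.real {ω | limitMin a (fun i => Z i ω) < s} ≤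
        P'.real {ω | occupied (limitHit a Z N M) ω ∈ closePairs a N M K s} := by
      refine ENNReal.toReal_mono (measure_ne_top _ _) (measure_mono_ae ?_)
      filter_upwards [hZ0] with ω hω h
      obtain ⟨i, j, hi, hj, k, l, hkl⟩ := (limitMin_lt_iff ha fun i m => ((hω i).1 m).1).1 h
      have hK : ∀ {u : ℝ}, u ≤ s + a * τ * s + a ^ 2 * τ * s + 1 → u ≤ K := fun h =>
        h.trans (le_max_left _ _)
      have hb : ∀ i m, (Z i ω m).2 ^ 2 ≤ τ * (Z i ω m).1 := fun i m =>
        ((hω i).1 m).2.trans (mul_le_mul_of_nonneg_right (hτ i) ((hω i).1 m).1)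
      have w1 := polarPoint_window ha (upSign_sq i) (upSign_sq j) ((hω i).1 k).1 ((hω j).1 l).1
        (hb i k) hτ0 hkl
      have w2 := polarPoint_window ha (upSign_sq j) (upSign_sq i) ((hω j).1 l).1 ((hω i).1 k).1
        (hb j l) hτ0 (by rwa [gapCost_comm])
      exact mem_closePairs_of_gapCost_lt hM ⟨hK w1.1, hK w1.2⟩ ⟨hK w2.1, hK w2.2⟩
        (mem_occupied.2 ⟨i, rightSign_eq_one_iff_sideOf.1 hi, k, rfl⟩)
        (mem_occupied.2 ⟨j, rightSign_eq_neg_one_iff_sideOf.1 hj, l, rfl⟩) hkl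
    -- This excludes that one sample point plays both roles, since its distance to itself is 0.
    have hsmall : ∀ᶠ r : ℝ in atTop, t / r ^ 2 < 2 * a :=
      (tendsto_const_nhds.div_atTop (tendsto_pow_atTop two_ne_zero)).eventually_lt_const
        (show 0 < 2 * a by linarith)
    filter_upwards [hlim.eventually_const_lt (sub_lt_self _ hε),
      hr.eventually (eventually_le_dist ha (show (s + t) / 2 < t by linarith)),
      hr.eventually hsmall, eventually_ge_atTop 2] with n hn hn2 hn3 hn4
    refine le_trans (sub_le_sub_right hle ε) (hn.le.trans (measureReal_mono fun ω h => ?_))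
    obtain ⟨i, hi, j, hj, hij⟩ := gapCost_lt_of_closePairs_sample hN h
    have hd := hn2 _ _ (hij.trans_eq (show s + (t - s) / 2 = (s + t) / 2 by ring))
    refine (rescaled_maxDist_le_iff hn4).2 ?_
    rcases lt_trichotomy i j with hlt | rfl | hlt
    · exact ⟨i, j, hlt, hj, hd⟩
    · rw [dist_self] at hd; linarith
    · exact ⟨j, i, hlt, hi, by rwa [dist_comm]⟩

/-- `HasLaw` gives only almost everywhere measurability. Measurable versions have the same laws and
independence and change everything on a null set only. -/
theorem tendstoInDistribution_maxDist (hE : Admissible a ν g q E f)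
    [IsProbabilityMeasure P] (hX : iIndepFun X P)
    (hXlaw : ∀ i, HasLaw (X i) (densityLaw f) P) [IsProbabilityMeasure P'] (hZ : iIndepFun Z P')
    (hZlaw : ∀ i, HasLaw (Z i) (normAngleLaw (sigmaConst a (poleDensity a f i) (q i))
      (tauConst a (q i))) P') :
    TendstoInDistribution
      (fun (n : ℕ) ω => (n : ℝ) ^ (2 / 3 : ℝ) * (2 * a - maxDist (fun i => X i ω) n)) atTop
      (fun ω => limitMin a (fun i => Z i ω)) (fun _ => P) P' := by
  have hXa : ∀ i, X i =ᵐ[P] (hXlaw i).aemeasurable.mk (X i) := fun i =>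
    (hXlaw i).aemeasurable.ae_eq_mk
  have hZa : ∀ i, Z i =ᵐ[P'] (hZlaw i).aemeasurable.mk (Z i) := fun i =>
    (hZlaw i).aemeasurable.ae_eq_mk
  have key := hE.tendstoInDistribution_of_measurable
    (fun i => (hXlaw i).aemeasurable.measurable_mk) (hX.congr hXa)
    (fun i => (hXlaw i).congr (hXa i).symm)
    (fun i => (hZlaw i).aemeasurable.measurable_mk) (hZ.congr hZa)
    (fun i => (hZlaw i).congr (hZa i).symm)
  refine key.congr (fun n => ?_) ?_
  · filter_upwards [ae_all_iff.2 hXa] with ω hω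
    simp only [hω]
  · filter_upwards [ae_all_iff.2 hZa] with ω hω
    simp only [hω]

end Admissible

end LargestDistance

end

theorem theorem2
    {a ν : ℝ} {g : Fin 4 → ℝ → ℝ} {q : Fin 4 → ℝ} {E : Set LargestDistance.Plane}
    {f : LargestDistance.Plane → ℝ} (hE : LargestDistance.Admissible a ν g q E f)
    -- the i.i.d. points with density `f`
    {Ω : Type*} [MeasurableSpace Ω] (P : Measure Ω) [IsProbabilityMeasure P]
    (X : ℕ → Ω → LargestDistance.Plane)
    (hX_indep : iIndepFun X P) (hX_law : ∀ i, HasLaw (X i) (LargestDistance.densityLaw f) P)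
    -- the four independent norm-angle sequences
    {Ω' : Type*} [MeasurableSpace Ω'] (P' : Measure Ω') [IsProbabilityMeasure P']
    (Z : Fin 4 → Ω' → ℕ → ℝ × ℝ)
    (hZ_indep : iIndepFun Z P')
    (hZ_law : ∀ i, HasLaw (Z i) (LargestDistance.normAngleLaw
      (LargestDistance.sigmaConst a (LargestDistance.poleDensity a f i) (q i))
      (LargestDistance.tauConst a (q i))) P') :
    (∀ᵐ ω ∂P', LargestDistance.MinimaAttained a (fun i => Z i ω)) ∧
    TendstoInDistribution
      (fun (n : ℕ) ω =>
        (n : ℝ) ^ (2 / 3 : ℝ) * (2 * a - LargestDistance.maxDist (fun i => X i ω) n))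
      atTop
      (fun ω => LargestDistance.limitMin a (fun i => Z i ω))
      (fun _ => P) P' := by
  refine ⟨?_, hE.tendstoInDistribution_maxDist hX_indep hX_law hZ_indep hZ_law⟩
  filter_upwards [hE.ae_normAngle hZ_law] with ω hω
  exact LargestDistance.minimaAttained_of_tendsto hE.a_pos (fun i m => ((hω i).1 m).1)
    fun i => (hω i).2
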